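/- Let $M\ge 1$ and $m$ be integers, let $\nu_0=0$ and let $\nu_1,\dots,\nu_M$ be non-negative integers. For $x,y>0$ put $$f(x)=G^{1,0}_{0,M+1}\left(x\,\middle|\,-\nu_0,-\nu_1,\dots,-\nu_M\right)=\frac1{2\pi i}\int_C\frac{\Gamma(-s)\,x^s}{\prod_{j=1}^M\Gamma(1+\nu_j+s)}\,ds,$$ $$g(y)=G^{M,0}_{0,M+1}\left(y\,\middle|\,\nu_1,\dots,\nu_M,\nu_0\right)=\frac1{2\pi i}\int_C\frac{\prod_{j=1}^M\Gamma(\nu_j-s)}{\Gamma(1+s)}\,y^s\,ds,$$ where the Meijer contour $C$ is the loop that comes from $+\infty-i$ along a horizontal line to $-\frac12-i$, goes up to $-\frac12+i$ and returns to $+\infty+i$ along a horizontal line, so that all poles of the integrands lie to its right. Define $\alpha_0,\dots,\alpha_M$ by $\prod_{i=1}^M(x-\nu_i)=\sum_{i=0}^M\alpha_ix^i$, and for $0\le j\le M$ $$\phi_j(x)=(-1)^{M-j+1}\Big(x\frac{d}{dx}\Big)^jf(x),\qquad \psi_j(y)=\sum_{i=0}^{M-j}\alpha_{i+j}\Big(y\frac{d}{dy}\Big)^ig(y).$$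 The generalized Bessel kernel is $$K_M(x,y)=\frac{\sum_{j=0}^M\phi_j(x)\psi_j(y)}{x-y},$$ where the value for $x=y$ is given by L'Hospital's rule. Let $0\le a_1<a_2<\dots<a_{2m}$ and $J=\bigcup_{k=1}^m(a_{2k-1},a_{2k})$. Let $K_M$ and $K_M'$ also denote the integral operators with the kernels $K_M(x,y)\chi_J(y)$ and $K_M(y,x)\chi_J(y)$. Assume that the Fredholm determinant $$\det(1-K_M)=\sum_{n\ge0}\frac{(-1)^n}{n!}\int_{J^n}\det\left[K_M(x_p,x_q)\right]_{p,q=1}^n\,dx_1\cdots dx_n$$ (the gap probability of $J$) is not zero. Then for $0\le j\le M$ there are functions $\mathcal Q_j=(1-K_M)^{-1}\phi_j$ and $\mathcal P_j=(1-K_M')^{-1}\psi_j$ on $(0,\infty)$, that is, unique functions which are square integrable on $J$ and satisfy, for all $x>0$, $$\mathcal Q_j(x)-\int_JK_M(x,y)\mathcal Q_j(y)\,dy=\phi_j(x),\qquad \mathcal P_j(x)-\int_JK_M(y,x)\mathcal P_j(y)\,dy=\psi_j(x).$$ Set $\epsilon_l=1$ for odd $l$, $\epsilon_l=\sqrt{-1}$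 for even $l$, and for $1\le l\le 2m$, $0\le j\le M$ put $$x_j^{(l)}=\epsilon_l\lim_{x\to a_l,\,x\in J}\mathcal Q_j(x),\qquad y_j^{(l)}=\epsilon_l\lim_{x\to a_l,\,x\in J}\mathcal P_j(x),$$ $$\xi_j=(-1)^M\sum_{k=1}^m\int_{a_{2k-1}}^{a_{2k}}\phi_0(x)\mathcal P_j(x)\,dx+(-1)^{M+1-j}e_{M+1-j}(\nu_0,\dots,\nu_M),$$ $$\eta_j=(-1)^M\sum_{k=1}^m\int_{a_{2k-1}}^{a_{2k}}\phi_j(x)\mathcal P_M(x)\,dx,$$ where $e_k$ is the $k$-th elementary symmetric polynomial. The limits defining $x_j^{(l)}$ exist, the limits defining $y_j^{(l)}$ exist if $a_l>0$, and the integrals converge absolutely. As functions of $a_1,\dots,a_{2m}$ these quantities have the partial derivatives that occur below and satisfy the following equations (a)–(f). Every equation is claimed if the variable with respect to which one differentiates is positive, and (b) if moreover $a_l>0$; hence all of them are claimed if $a_1>0$. If $a_1=0$, then in (c) and (d) the term with $k=1$, which has the factor $a_1$, is read as $0$. (a) For $0\le j\le M$ and $1\le k\ne l\le 2m$, $$\frac{\partial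 x_j^{(l)}}{\partial a_k}=-\frac{x_j^{(k)}}{a_l-a_k}\sum_{i=0}^Mx_i^{(l)}y_i^{(k)}.$$ (b) For $0\le j\le M$ and $1\le k\ne l\le 2m$, $$\frac{\partial y_j^{(l)}}{\partial a_k}=-\frac{y_j^{(k)}}{a_k-a_l}\sum_{i=0}^Mx_i^{(k)}y_i^{(l)}.$$ (c) For $0\le j\le M-1$ and $1\le l\le 2m$, $$a_l\frac{\partial x_j^{(l)}}{\partial a_l}=-\eta_jx_0^{(l)}-x_{j+1}^{(l)}+\sum_{k\ne l}x_j^{(k)}\frac{a_k}{a_l-a_k}\sum_{i=0}^Mx_i^{(l)}y_i^{(k)},$$ and $$a_l\frac{\partial x_M^{(l)}}{\partial a_l}=-\eta_Mx_0^{(l)}+(-1)^{M+1}a_lx_0^{(l)}+\sum_{i=0}^M\xi_ix_i^{(l)}+\sum_{k\ne l}x_M^{(k)}\frac{a_k}{a_l-a_k}\sum_{i=0}^Mx_i^{(l)}y_i^{(k)}.$$ (d) For $1\le j\le M$ and $1\le l\le 2m$, $$a_l\frac{\partial y_j^{(l)}}{\partial a_l}=-\xi_jy_M^{(l)}+y_{j-1}^{(l)}+\sum_{k\ne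 l}y_j^{(k)}\frac{a_k}{a_k-a_l}\sum_{i=0}^Mx_i^{(k)}y_i^{(l)},$$ and $$a_l\frac{\partial y_0^{(l)}}{\partial a_l}=-\xi_0y_M^{(l)}+(-1)^Ma_ly_M^{(l)}+\sum_{i=0}^M\eta_iy_i^{(l)}+\sum_{k\ne l}y_0^{(k)}\frac{a_k}{a_k-a_l}\sum_{i=0}^Mx_i^{(k)}y_i^{(l)}.$$ (e) For $0\le j\le M$ and $1\le l\le 2m$, $$\frac{\partial\xi_j}{\partial a_l}=(-1)^{M+1}x_0^{(l)}y_j^{(l)}.$$ (f) For $0\le j\le M$ and $1\le l\le 2m$, $$\frac{\partial\eta_j}{\partial a_l}=(-1)^{M+1}x_j^{(l)}y_M^{(l)}.$$ -/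

import Mathlib

open Set Filter Topology MeasureTheory

noncomputable section

namespace GenBessel

/-- The integrand `∏_{j ≤ m} Γ(b_j - s) / ∏_{j > m} Γ(1 - b_j + s) z^s` of the Meijer function
`G^{m,0}_{0,q}(z | b_1, …, b_q)`. (`Complex.Gamma` is `0` at the poles of `Γ`, so
`(Complex.Gamma w)⁻¹` is the entire function `1 / Γ`.) -/
def meijerIntegrand (m : ℕ) {q : ℕ} (b : Fin q → ℝ) (z : ℝ) (s : ℂ) : ℂ :=
  (∏ j : Fin q, if (j : ℕ) < m then Complex.Gamma ((b j : ℂ) - s)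
    else (Complex.Gamma (1 - (b j : ℂ) + s))⁻¹) * (z : ℂ) ^ s

/-- The Meijer function `G^{m,0}_{0,q}(z | b_1, …, b_q)` for real `b` and `z > 0`, that is
`(1 / 2πi) ∫_C ∏_{j ≤ m} Γ(b_j - s) / ∏_{j > m} Γ(1 - b_j + s) z^s ds`.
The contour `C` is the loop which comes from `+∞ - i` along the line `Im s = -1` to `c - i`, goes up
to `c + i`, and returns to `+∞ + i` along the line `Im s = 1`. For `c < b_1, …, b_m` all poles
`b_j + k` of the functions `Γ(b_j - s)`, `j ≤ m`, lie to the right of `C`, as they should, and the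
value does not depend on `c`. -/
def meijerG (c : ℝ) (m : ℕ) {q : ℕ} (b : Fin q → ℝ) (z : ℝ) : ℂ :=
  (2 * (Real.pi : ℂ) * Complex.I)⁻¹ *
    (-(∫ u in Ioi c, meijerIntegrand m b z ((u : ℂ) - Complex.I))
      + Complex.I * (∫ t in (-1 : ℝ)..1, meijerIntegrand m b z ((c : ℂ) + (t : ℂ) * Complex.I))
      + ∫ u in Ioi c, meijerIntegrand m b z ((u : ℂ) + Complex.I))

variable {M m : ℕ}

/-- `f(x) = G^{1,0}_{0,M+1}(x | -ν_0, -ν_1, …, -ν_M)`; here `ν_0 = 0`, so that `c = -1/2` is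
admissible. -/
def f (ν : Fin (M + 1) → ℕ) : ℝ → ℂ :=
  meijerG (-1 / 2) 1 (fun i => -(ν i : ℝ))

/-- `g(y) = G^{M,0}_{0,M+1}(y | ν_1, …, ν_M, ν_0)`. -/
def g (ν : Fin (M + 1) → ℕ) : ℝ → ℂ :=
  meijerG (-1 / 2) M
    (Fin.snoc (α := fun _ => ℝ) (fun i : Fin M => (ν i.succ : ℝ)) (ν 0 : ℝ))

/-- The operator `x d/dx`. -/
def euler (h : ℝ → ℂ) : ℝ → ℂ := fun x => (x : ℂ) * deriv h x

/-- The coefficients in `∏_{i=1}^M (x - ν_i) = ∑_i α_i x^i`. -/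
def alpha (ν : Fin (M + 1) → ℕ) (i : ℕ) : ℂ :=
  (∏ k : Fin M, (Polynomial.X - Polynomial.C (ν k.succ : ℂ))).coeff i

/-- `φ_j`, for `0 ≤ j ≤ M`. -/
def phi (ν : Fin (M + 1) → ℕ) (j : ℕ) (x : ℝ) : ℂ :=
  (-1) ^ (M - j + 1) * (euler^[j] (f ν)) x

/-- `ψ_j`, for `0 ≤ j ≤ M`. -/
def psi (ν : Fin (M + 1) → ℕ) (j : ℕ) (y : ℝ) : ℂ :=
  ∑ i ∈ Finset.range (M - j + 1), alpha ν (i + j) * (euler^[i] (g ν)) y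

/-- The generalized Bessel kernel `K_M(x, y) = (∑_j φ_j(x) ψ_j(y)) / (x - y)`, with the value given by
L'Hospital's rule on the diagonal. -/
def K (ν : Fin (M + 1) → ℕ) (x y : ℝ) : ℂ :=
  if x = y then ∑ j ∈ Finset.range (M + 1), deriv (phi ν j) x * psi ν j x
  else (∑ j ∈ Finset.range (M + 1), phi ν j x * psi ν j y) / ((x : ℂ) - (y : ℂ))

/-- The left endpoint of the interval number `k` (counted from `0`). -/
def left (a : Fin (2 * m) → ℝ) (k : Fin m) : ℝ := a ⟨2 * k, by omega⟩

/-- The right endpoint of the interval number `k` (counted from `0`). -/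
def right (a : Fin (2 * m) → ℝ) (k : Fin m) : ℝ := a ⟨2 * k + 1, by omega⟩

/-- `J = ⋃_{k=1}^m (a_{2k-1}, a_{2k})`. The endpoints are numbered from `0` here: `a_l` is
`a (l - 1)`. -/
def J (a : Fin (2 * m) → ℝ) : Set ℝ := ⋃ k : Fin m, Ioo (left a k) (right a k)

/-- The Fredholm determinant `det(1 - K_M)` of the operator with the kernel `K_M(x,y) χ_J(y)`,
as the Fredholm series. -/
def fredholmDet (ν : Fin (M + 1) → ℕ) (a : Fin (2 * m) → ℝ) : ℂ :=
  ∑' n : ℕ, ((-1) ^ n / (n.factorial : ℂ)) *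
    ∫ x in Set.pi univ (fun _ : Fin n => J a), (Matrix.of fun i j => K ν (x i) (x j)).det

/-- `u = (1 - k)⁻¹ h`, where `k` stands for the integral operator with the kernel `k(x,y) χ_S(y)`:
`u` is square integrable on `S` and `(1 - k) u = h` on `(0, ∞)`. -/
def IsResolventOf (k : ℝ → ℝ → ℂ) (S : Set ℝ) (h u : ℝ → ℂ) : Prop :=
  MemLp u 2 (volume.restrict S) ∧ ∀ x, 0 < x → u x - ∫ y in S, k x y * u y = h x

/-- The function `(1 - k)⁻¹ h` (unique on `(0, ∞)` when `1 - k` is invertible). -/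
def resolvent (k : ℝ → ℝ → ℂ) (S : Set ℝ) (h : ℝ → ℂ) : ℝ → ℂ :=
  Classical.epsilon (IsResolventOf k S h)

/-- `𝒬_j = (1 - K_M)⁻¹ φ_j`. -/
def Q (ν : Fin (M + 1) → ℕ) (j : ℕ) (a : Fin (2 * m) → ℝ) : ℝ → ℂ :=
  resolvent (K ν) (J a) (phi ν j)

/-- `𝒫_j = (1 - K_M')⁻¹ ψ_j`, where `K_M'` has the kernel `K_M(y,x) χ_J(y)`. -/
def P (ν : Fin (M + 1) → ℕ) (j : ℕ) (a : Fin (2 * m) → ℝ) : ℝ → ℂ :=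
  resolvent (fun x y => K ν y x) (J a) (psi ν j)

/-- The prefactor: `1` at the left endpoints `a_{2k-1}` and `√-1` at the right endpoints `a_{2k}`. -/
def prefactor (l : Fin (2 * m)) : ℂ := if Even (l : ℕ) then 1 else Complex.I

/-- The quantity `x_j^{(l)}`; the value at the endpoint is the limit from inside of `J`. -/
def xq (ν : Fin (M + 1) → ℕ) (j : ℕ) (l : Fin (2 * m)) (a : Fin (2 * m) → ℝ) : ℂ :=
  prefactor l * limUnder (𝓝[J a] (a l)) (Q ν j a)

/-- The quantity `y_j^{(l)}`. -/
def yq (ν : Fin (M + 1) → ℕ) (j : ℕ) (l : Fin (2 * m)) (a : Fin (2 * m) → ℝ) : ℂ :=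
  prefactor l * limUnder (𝓝[J a] (a l)) (P ν j a)

/-- The elementary symmetric polynomial `e_k(ν_0, …, ν_M)`. -/
def esymmNu (ν : Fin (M + 1) → ℕ) (k : ℕ) : ℂ :=
  (Finset.univ.val.map fun i : Fin (M + 1) => (ν i : ℂ)).esymm k

/-- The quantity `ξ_j`. -/
def xi (ν : Fin (M + 1) → ℕ) (j : ℕ) (a : Fin (2 * m) → ℝ) : ℂ :=
  (-1) ^ M * (∑ k : Fin m, ∫ x in (left a k)..(right a k), phi ν 0 x * P ν j a x)
    + (-1) ^ (M + 1 - j) * esymmNu ν (M + 1 - j)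

/-- The quantity `η_j`. -/
def eta (ν : Fin (M + 1) → ℕ) (j : ℕ) (a : Fin (2 * m) → ℝ) : ℂ :=
  (-1) ^ M * ∑ k : Fin m, ∫ x in (left a k)..(right a k), phi ν j x * P ν M a x

/-- The partial derivative `∂F/∂a_k` exists at `a` and equals `d`. -/
def HasPartialAt {n : ℕ} (F : (Fin n → ℝ) → ℂ) (a : Fin n → ℝ) (k : Fin n) (d : ℂ) : Prop :=
  HasDerivAt (fun t : ℝ => F (Function.update a k t)) d (a k)

end GenBessel

end

set_option linter.unusedSectionVars false

noncomputable section

namespace GenBessel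

/-! ### Functions which decay fast along the contour -/

/-! Write θ = x d/dx. Under the loop integral θ multiplies the Gamma factors by s, and a shift of
the contour by one turns the functional equation of Γ into the hypergeometric equations of f and g
(`polyMeijer_ode`). These become first-order systems for the φ_j and the ψ_j (`hasDerivAt_phi`,
`hasDerivAt_phi_last`, `hasDerivAt_psi`, `hasDerivAt_psi_zero`), and the systems are dual to each
other in such a way that (θ_x + θ_y) Σ φ_j(x) ψ_j(y) = (x - y) f(x) g(y). Integration along the ray
t ↦ (tx, ty) yields K_M(x,y) = ∫_0^1 f(tx) g(ty) dt (`sub_mul_besselKernel_of_pos`,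
`K_eq_besselKernel`).

So the kernel has two finite-rank commutators. From (x - y) K = Σ φ_j(x) ψ_j(y) comes the one with
multiplication by x; from (θ_x + θ_y + 1) K = f(x) g(y) comes the one with the dilation generator,
of rank one up to boundary terms at the endpoints. Both pass to the resolvent kernel R of K on J.
The first gives (x - y) R(x,y) = Σ 𝒬_j(x) 𝒫_j(y) (`sub_mul_resolventKernel`) and moves a factor x
through the resolvent (`resolve_id_mul`). The second, after integration by parts over J, expresses
θ𝒬_j by the resolvent of θφ_j, a multiple of 𝒬_0 and the values R(x, a_l) (`theta_resolve`). The
integrals that arise are the ones in ξ_j and η_j.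

R exists by classical Fredholm theory. The kernel is dominated by v(x) w(y) with v locally bounded
and w of order y^(-1/4) at the origin, so that both weights are square integrable on J; Hadamard's
inequality makes the series converge, and R is the first minor divided by the determinant
(`IsDominated.isResolventKernel`). The determinant is continuous in the endpoints
(`IsDominated.tendsto_fredholmSeries`), hence R exists with a uniform bound for all nearby endpoints
(`IsThetaKernel.eventually_isRegular`).

Moving a_k alters J by a short interval, and the solutions before and after are related by an exact
identity (`IsThetaKernel.sol_update`). Its derivative is ∂𝒬_j(x)/∂a_k = ± R(x, a_k) 𝒬_j(a_k). At x =
a_l the factors ε absorb the sign and R(a_l, a_k) becomes a sum of products of the x_i and y_i: this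
is (a). When the evaluation point moves too, the chain rule adds θ𝒬_j, whose boundary term at a_l
cancels the effect of moving the domain: this is (c). The bilinear version
`IsThetaKernel.integral_sol_update` gives (e) and (f). All statements on 𝒫_j, that is (b) and (d),
are the same arguments for the transposed kernel. -/

/-- `H` is holomorphic off the real half line `[d, ∞)` and decays faster than every exponential on
the lines `Im s = ±1`. -/
structure FastDecay (d : ℝ) (H : ℂ → ℂ) : Prop where
  diff : ∀ s : ℂ, s.im ≠ 0 ∨ s.re < d → DifferentiableAt ℂ H s
  decay : ∀ η : ℝ, |η| = 1 → ∀ c B : ℝ, ∃ C, 0 ≤ C ∧ ∀ u, c ≤ u →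
    ‖H (u + η * Complex.I)‖ ≤ C * Real.exp (-(B * u))

/-- Any point to the right can be moved back by unit steps into a compact interval of length at
least one without decreasing `h`. -/
lemma bounded_of_step {h : ℝ → ℝ} (hc : Continuous h) {c u₀ : ℝ}
    (hs : ∀ u, u₀ ≤ u → h (u + 1) ≤ h u) : ∃ C, 0 ≤ C ∧ ∀ u, c ≤ u → h u ≤ C := by
  obtain ⟨C, hC⟩ := (isCompact_Icc (a := min c u₀) (b := u₀ + 1)).bddAbove_image
    hc.continuousOn
  refine ⟨max C 0, le_max_right _ _, fun u hu => le_max_of_le_left ?_⟩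
  have key : ∀ n : ℕ, ∀ u, min c u₀ ≤ u → u ≤ u₀ + 1 + n → h u ≤ C := by
    intro n
    induction n with
    | zero =>
      intro u h1 h2
      exact hC ⟨u, ⟨h1, by simpa using h2⟩, rfl⟩
    | succ n ih =>
      intro u h1 h2
      by_cases h3 : u ≤ u₀ + 1
      · exact hC ⟨u, ⟨h1, h3⟩, rfl⟩
      · push Not at h3
        have h4 := hs (u - 1) (by linarith)
        rw [sub_add_cancel] at h4
        refine h4.trans (ih (u - 1) ((min_le_right _ _).trans (by linarith)) ?_)
        push_cast at h2
        linarith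
  refine key ⌈u - u₀ - 1⌉₊ u ((min_le_left _ _).trans hu) ?_
  have := Nat.le_ceil (u - u₀ - 1)
  linarith

/-- Once `u ≥ r + exp B`, the factor `|u - r|` exceeds `exp B`, so `‖G u‖ * exp (B * u)` does not
increase under unit steps. The recursion of Γ has this form, so no asymptotic expansion is needed.
-/
lemma decay_of_step {G : ℝ → ℂ} (hc : Continuous G) {r : ℝ}
    (hs : ∀ u, ‖G (u + 1)‖ * |u - r| ≤ ‖G u‖) (c B : ℝ) :
    ∃ C, 0 ≤ C ∧ ∀ u, c ≤ u → ‖G u‖ ≤ C * Real.exp (-(B * u)) := by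
  obtain ⟨C, hC0, hC⟩ := bounded_of_step (h := fun u => ‖G u‖ * Real.exp (B * u)) (c := c)
    (u₀ := r + Real.exp B) (by fun_prop) (fun u hu => by
      have h1 : Real.exp B ≤ |u - r| := le_trans (by linarith) (le_abs_self _)
      have h2 : ‖G (u + 1)‖ * Real.exp B ≤ ‖G u‖ :=
        (mul_le_mul_of_nonneg_left h1 (norm_nonneg _)).trans (hs u)
      calc ‖G (u + 1)‖ * Real.exp (B * (u + 1))
          = ‖G (u + 1)‖ * Real.exp B * Real.exp (B * u) := by
            rw [mul_add, mul_one, Real.exp_add]; ring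
        _ ≤ _ := mul_le_mul_of_nonneg_right h2 (Real.exp_pos _).le)
  refine ⟨C, hC0, fun u hu => ?_⟩
  have h1 := hC u hu
  have h2 : Real.exp (B * u) * Real.exp (-(B * u)) = 1 := by
    rw [← Real.exp_add]; simp
  calc ‖G u‖ = ‖G u‖ * Real.exp (B * u) * Real.exp (-(B * u)) := by rw [mul_assoc, h2, mul_one]
    _ ≤ _ := mul_le_mul_of_nonneg_right h1 (Real.exp_pos _).le

lemma abs_re_add_le_norm (x η : ℝ) : |x| ≤ ‖(x : ℂ) + η * Complex.I‖ := by
  have := Complex.abs_re_le_norm ((x : ℂ) + η * Complex.I)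
  simpa using this

/-- 1/Γ(w) = w/Γ(w + 1) is the recursion of `decay_of_step`, and |w| is at least its real part in
absolute value. -/
lemma fastDecay_inv_Gamma (b d : ℝ) : FastDecay d (fun s => (Complex.Gamma (b + s))⁻¹) where
  diff s _ := by
    have := Complex.differentiable_one_div_Gamma.differentiableAt (x := b + s)
    exact this.comp s (by fun_prop)
  decay η _ c B := by
    refine decay_of_step (G := fun u => (Complex.Gamma (b + (u + η * Complex.I)))⁻¹) (r := -b)
      (Complex.differentiable_one_div_Gamma.continuous.comp (by fun_prop)) (fun u => ?_) c B
    have h := Complex.one_div_Gamma_eq_self_mul_one_div_Gamma_add_one (b + (u + η * Complex.I))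
    rw [h, norm_mul, mul_comm]
    have e : (b : ℂ) + (u + η * Complex.I) + 1 = b + (((u + 1 : ℝ) : ℂ) + η * Complex.I) := by
      push_cast; ring
    rw [e]
    refine mul_le_mul_of_nonneg_right ?_ (norm_nonneg _)
    have := abs_re_add_le_norm (b + u) η
    push_cast at this
    rw [← add_assoc, sub_neg_eq_add, add_comm u b]
    exact this

/-- The poles lie on [b, ∞), which the lines Im s = ±1 avoid; Γ(w + 1) = w Γ(w) with w = b - s - 1
supplies the recursion as s moves to the right. -/
lemma fastDecay_Gamma (b : ℝ) : FastDecay b (fun s => Complex.Gamma (b - s)) where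
  diff s hs := by
    refine DifferentiableAt.comp s (Complex.differentiableAt_Gamma _ ?_) (by fun_prop)
    rintro m hm
    rcases hs with hs | hs
    · apply hs
      have := congrArg Complex.im hm
      simpa using this
    · have := congrArg Complex.re hm
      simp at this
      have hm0 : (0 : ℝ) ≤ m := m.cast_nonneg
      linarith
  decay η hη c B := by
    have hη0 : η ≠ 0 := by rintro rfl; simp at hη
    refine decay_of_step (G := fun u => Complex.Gamma (b - (u + η * Complex.I))) (r := b - 1)
      ?_ (fun u => ?_) c B
    · rw [continuous_iff_continuousAt]
      intro u
      refine ContinuousAt.comp (f := fun u : ℝ => (b : ℂ) - (u + η * Complex.I))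
        (Complex.differentiableAt_Gamma _ ?_).continuousAt (by fun_prop)
      rintro m hm
      have := congrArg Complex.im hm
      simp [hη0] at this
    · have e : (b : ℂ) - (u + η * Complex.I)
          = (b - (((u + 1 : ℝ) : ℂ) + η * Complex.I)) + 1 := by push_cast; ring
      rw [e, Complex.Gamma_add_one, norm_mul, mul_comm]
      · refine mul_le_mul_of_nonneg_right ?_ (norm_nonneg _)
        have := abs_re_add_le_norm (b - (u + 1)) (-η)
        have e₁ : u - (b - 1) = -(b - (u + 1)) := by ring
        have e₂ : (b : ℂ) - (((u + 1 : ℝ) : ℂ) + η * Complex.I)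
            = ((b - (u + 1) : ℝ) : ℂ) + ((-η : ℝ) : ℂ) * Complex.I := by push_cast; ring
        rw [e₁, abs_neg, e₂]
        exact this
      · intro h
        have := congrArg Complex.im h
        simp [hη0] at this

namespace FastDecay

variable {d : ℝ} {H H₁ H₂ : ℂ → ℂ}

lemma mul (h₁ : FastDecay d H₁) (h₂ : FastDecay d H₂) : FastDecay d (fun s => H₁ s * H₂ s) where
  diff s hs := (h₁.diff s hs).mul (h₂.diff s hs)
  decay η hη c B := by
    obtain ⟨C₁, p₁, h₁⟩ := h₁.decay η hη c B
    -- Rate 0: boundedness of the second factor is enough.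
    obtain ⟨C₂, p₂, h₂⟩ := h₂.decay η hη c 0
    refine ⟨C₁ * C₂, by positivity, fun u hu => ?_⟩
    have := h₂ u hu
    simp at this
    rw [norm_mul]
    calc _ ≤ (C₁ * Real.exp (-(B * u))) * C₂ := by
          gcongr
          exact h₁ u hu
      _ = _ := by ring

lemma add (h₁ : FastDecay d H₁) (h₂ : FastDecay d H₂) : FastDecay d (fun s => H₁ s + H₂ s) where
  diff s hs := (h₁.diff s hs).add (h₂.diff s hs)
  decay η hη c B := by
    obtain ⟨C₁, p₁, h₁⟩ := h₁.decay η hη c B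
    obtain ⟨C₂, p₂, h₂⟩ := h₂.decay η hη c B
    refine ⟨C₁ + C₂, by positivity, fun u hu => ?_⟩
    rw [add_mul]
    exact norm_add_le_of_le (h₁ u hu) (h₂ u hu)

lemma const_mul (h : FastDecay d H) (a : ℂ) : FastDecay d (fun s => a * H s) where
  diff s hs := (h.diff s hs).const_mul a
  decay η hη c B := by
    obtain ⟨C₁, p₁, h₁⟩ := h.decay η hη c B
    refine ⟨‖a‖ * C₁, by positivity, fun u hu => ?_⟩
    rw [norm_mul, mul_assoc]
    gcongr
    exact h₁ u hu

lemma abs_le_of_le {c u : ℝ} (hu : c ≤ u) : |u| ≤ u + 2 * |c| := by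
  rcases abs_cases u with ⟨h, _⟩ | ⟨h, _⟩ <;> rcases abs_cases c with ⟨h', _⟩ | ⟨h', _⟩ <;> linarith

lemma id_mul (h : FastDecay d H) : FastDecay d (fun s => s * H s) where
  diff s hs := differentiableAt_id.mul (h.diff s hs)
  decay η hη c B := by
    -- One extra unit of decay pays for the factor s, which is at most exp(u + 2|c|) in norm.
    obtain ⟨C₁, p₁, h₁⟩ := h.decay η hη c (B + 1)
    refine ⟨Real.exp (2 * |c|) * C₁, by positivity, fun u hu => ?_⟩
    have h2 : ‖(u : ℂ) + η * Complex.I‖ ≤ Real.exp (u + 2 * |c|) := by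
      refine (norm_add_le _ _).trans ?_
      have h3 := Real.add_one_le_exp (u + 2 * |c|)
      have h4 := abs_le_of_le hu
      simp [hη]
      linarith
    rw [norm_mul]
    calc _ ≤ Real.exp (u + 2 * |c|) * (C₁ * Real.exp (-((B + 1) * u))) := by
          gcongr
          exact h₁ u hu
      _ = Real.exp (2 * |c|) * C₁ * (Real.exp u * Real.exp (-((B + 1) * u))) := by
          rw [Real.exp_add]; ring
      _ = _ := by rw [← Real.exp_add]; ring_nf

lemma poly_mul (h : FastDecay d H) (p : Polynomial ℂ) : FastDecay d (fun s => p.eval s * H s) := by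
  induction p using Polynomial.induction_on' with
  | add p q hp hq =>
    simp only [Polynomial.eval_add, add_mul]
    exact hp.add hq
  | monomial n a =>
    simp only [Polynomial.eval_monomial, mul_assoc]
    refine const_mul ?_ a
    induction n with
    | zero => simpa using h
    | succ n ih =>
      simp only [pow_succ', mul_assoc]
      exact ih.id_mul

lemma mono {d' : ℝ} (h : FastDecay d H) (hd : d' ≤ d) : FastDecay d' H :=
  ⟨fun s hs => h.diff s (hs.imp_right fun h => h.trans_le hd), h.decay⟩

/-- The index set must be nonempty because the constant 1 does not decay. -/
lemma prod {ι : Type*} (s : Finset ι) (hs : s.Nonempty) {H : ι → ℂ → ℂ}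
    (h : ∀ i ∈ s, FastDecay d (H i)) : FastDecay d (fun z => ∏ i ∈ s, H i z) := by
  induction hs using Finset.Nonempty.cons_induction with
  | singleton a => simpa using h a (by simp)
  | cons a s ha hs ih =>
    simp only [Finset.prod_cons]
    exact (h a (by simp)).mul (ih fun i hi => h i (by simp [hi]))

end FastDecay

/-! ### Loop integrals -/

/-- The part of the loop integral over the line `Im s = η`. -/
def lineInt (c η : ℝ) (H : ℂ → ℂ) (z : ℝ) : ℂ :=
  ∫ u in Ioi c, H ((u : ℂ) + η * Complex.I) * (z : ℂ) ^ ((u : ℂ) + η * Complex.I)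

/-- The part of the loop integral over the vertical segment. -/
def segInt (c : ℝ) (H : ℂ → ℂ) (z : ℝ) : ℂ :=
  ∫ t in (-1 : ℝ)..1, H ((c : ℂ) + t * Complex.I) * (z : ℂ) ^ ((c : ℂ) + t * Complex.I)

/-- The loop integral `(1 / 2πi) ∫_C H(s) z^s ds`. -/
def loopInt (c : ℝ) (H : ℂ → ℂ) (z : ℝ) : ℂ :=
  (2 * (Real.pi : ℂ) * Complex.I)⁻¹ *
    (-lineInt c (-1) H z + Complex.I * segInt c H z + lineInt c 1 H z)

lemma meijerG_eq_loopInt (c : ℝ) (m : ℕ) {q : ℕ} (b : Fin q → ℝ) (z : ℝ) :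
    meijerG c m b z = loopInt c (fun s => ∏ j : Fin q, if (j : ℕ) < m then
      Complex.Gamma ((b j : ℂ) - s) else (Complex.Gamma (1 - (b j : ℂ) + s))⁻¹) z := by
  simp [meijerG, loopInt, lineInt, segInt, meijerIntegrand, sub_eq_add_neg]

section Loop

variable {d : ℝ} {H : ℂ → ℂ} (hH : FastDecay d H) {c η z : ℝ}

include hH

lemma FastDecay.continuous_line (hη : |η| = 1) : Continuous fun u : ℝ => H (u + η * Complex.I) := by
  have hη0 : η ≠ 0 := by rintro rfl; simp at hη
  rw [continuous_iff_continuousAt]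
  intro u
  refine ContinuousAt.comp (f := fun u : ℝ => (u : ℂ) + η * Complex.I)
    (hH.diff _ (Or.inl ?_)).continuousAt (by fun_prop)
  simpa using hη0

lemma FastDecay.continuous_seg (hc : c < d) : Continuous fun t : ℝ => H (c + t * Complex.I) := by
  rw [continuous_iff_continuousAt]
  intro u
  refine ContinuousAt.comp (f := fun u : ℝ => (c : ℂ) + u * Complex.I)
    (hH.diff _ (Or.inr ?_)).continuousAt (by fun_prop)
  simpa using hc

omit hH in
lemma continuous_cpow_line (hz : 0 < z) :
    Continuous fun u : ℝ => (z : ℂ) ^ ((u : ℂ) + η * Complex.I) :=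
  Continuous.const_cpow (by fun_prop) (Or.inl (by exact_mod_cast hz.ne'))

omit hH in
lemma continuous_cpow_seg (hz : 0 < z) :
    Continuous fun t : ℝ => (z : ℂ) ^ ((c : ℂ) + t * Complex.I) :=
  Continuous.const_cpow (by fun_prop) (Or.inl (by exact_mod_cast hz.ne'))

omit hH in
lemma norm_cpow_line (hz : 0 < z) (u η : ℝ) : ‖(z : ℂ) ^ ((u : ℂ) + η * Complex.I)‖ = z ^ u := by
  rw [Complex.norm_cpow_eq_rpow_re_of_pos hz]; simp

omit hH in
lemma rpow_le_exp {L u x : ℝ} (hx : 0 < x) (hL : |Real.log x| ≤ L) (hu : c ≤ u) :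
    x ^ u ≤ Real.exp (2 * |c| * L) * Real.exp (L * u) := by
  rw [Real.rpow_def_of_pos hx, ← Real.exp_add]
  refine Real.exp_le_exp.2 ((le_abs_self _).trans ?_)
  rw [abs_mul]
  have h1 := FastDecay.abs_le_of_le hu
  calc _ ≤ L * (u + 2 * |c|) := by
        gcongr
        exact (abs_nonneg _).trans hL
    _ = _ := by ring

/-- Decay at rate `L + 1` beats x^u, which is at most a constant times exp(L u), uniformly for |log
x| ≤ L. The remaining exp(-u) dominates the integrals when x varies. -/
lemma FastDecay.exists_line_bound (hη : |η| = 1) (c : ℝ) (L : ℝ) :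
    ∃ C, 0 ≤ C ∧ ∀ x : ℝ, 0 < x → |Real.log x| ≤ L → ∀ u, c ≤ u →
      ‖H (u + η * Complex.I) * (x : ℂ) ^ ((u : ℂ) + η * Complex.I)‖ ≤ C * Real.exp (-1 * u) := by
  obtain ⟨C, hC0, hC⟩ := hH.decay η hη c (L + 1)
  refine ⟨C * Real.exp (2 * |c| * L), by positivity, fun x hx hL u hu => ?_⟩
  rw [norm_mul, norm_cpow_line hx]
  calc _ ≤ (C * Real.exp (-((L + 1) * u))) * (Real.exp (2 * |c| * L) * Real.exp (L * u)) := by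
        gcongr
        · exact hC u hu
        · exact rpow_le_exp hx hL hu
    _ = C * Real.exp (2 * |c| * L) * (Real.exp (-((L + 1) * u)) * Real.exp (L * u)) := by ring
    _ = _ := by rw [← Real.exp_add]; ring_nf

lemma FastDecay.integrableOn_line (hη : |η| = 1) (hz : 0 < z) :
    IntegrableOn (fun u : ℝ => H (u + η * Complex.I) * (z : ℂ) ^ ((u : ℂ) + η * Complex.I))
      (Ioi c) := by
  obtain ⟨C, _, hC⟩ := hH.exists_line_bound hη c |Real.log z|
  refine Integrable.mono' ((exp_neg_integrableOn_Ioi c one_pos).const_mul C)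
    ((hH.continuous_line hη).mul (continuous_cpow_line hz)).aestronglyMeasurable ?_
  filter_upwards [self_mem_ae_restrict measurableSet_Ioi] with u hu
  exact hC z hz le_rfl u (le_of_lt hu)

omit hH in
lemma hasDerivAt_cpow_real {x : ℝ} (hx : x ≠ 0) {s : ℂ} (hs : s ≠ 0) :
    HasDerivAt (fun y : ℝ => (y : ℂ) ^ s) ((x : ℂ)⁻¹ * (s * (x : ℂ) ^ s)) x := by
  have := hasDerivAt_ofReal_cpow_const hx hs
  rw [Complex.cpow_sub _ _ (by exact_mod_cast hx), Complex.cpow_one] at this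
  convert this using 1
  ring

lemma FastDecay.hasDerivAt_lineInt (hη : |η| = 1) (hz : 0 < z) :
    HasDerivAt (lineInt c η H) ((z : ℂ)⁻¹ * lineInt c η (fun s => s * H s) z) z := by
  have hη0 : η ≠ 0 := by rintro rfl; simp at hη
  set L := |Real.log (z / 2)| + |Real.log (2 * z)| with hL
  obtain ⟨C, hC0, hC⟩ := hH.id_mul.exists_line_bound hη c L
  have hpos : ∀ x ∈ Ioo (z / 2) (2 * z), 0 < x := fun x hx => (half_pos hz).trans hx.1
  have hlog : ∀ x ∈ Ioo (z / 2) (2 * z), |Real.log x| ≤ L := by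
    intro x hx
    have h1 := Real.log_le_log (half_pos hz) hx.1.le
    have h2 := Real.log_le_log (hpos x hx) hx.2.le
    rw [abs_le]
    constructor
    · have := neg_abs_le (Real.log (z / 2)); have := abs_nonneg (Real.log (2 * z)); linarith
    · have := le_abs_self (Real.log (2 * z)); have := abs_nonneg (Real.log (z / 2)); linarith
  have key := hasDerivAt_integral_of_dominated_loc_of_deriv_le (μ := volume.restrict (Ioi c))
    (F := fun (x : ℝ) (u : ℝ) =>
      H (u + η * Complex.I) * (x : ℂ) ^ ((u : ℂ) + η * Complex.I))
    (F' := fun (x : ℝ) (u : ℝ) => (x : ℂ)⁻¹ * (((u : ℂ) + η * Complex.I) *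
      H (u + η * Complex.I) * (x : ℂ) ^ ((u : ℂ) + η * Complex.I)))
    (x₀ := z) (s := Ioo (z / 2) (2 * z))
    (bound := fun u => (z / 2)⁻¹ * (C * Real.exp (-1 * u)))
    (Ioo_mem_nhds (by linarith) (by linarith)) ?_ (hH.integrableOn_line hη hz) ?_ ?_ ?_ ?_
  · refine key.2.congr_deriv ?_
    rw [integral_const_mul, lineInt]
  · filter_upwards [Ioi_mem_nhds hz] with x hx
    exact ((hH.continuous_line hη).mul (continuous_cpow_line hx)).aestronglyMeasurable
  · exact ((hH.id_mul.integrableOn_line hη hz).const_mul _).aestronglyMeasurable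
  · filter_upwards [self_mem_ae_restrict measurableSet_Ioi] with u hu x hx
    rw [norm_mul]
    have h1 := hC x (hpos x hx) (hlog x hx) u (le_of_lt hu)
    gcongr
    rw [norm_inv, Complex.norm_real, Real.norm_of_nonneg (hpos x hx).le]
    exact inv_anti₀ (half_pos hz) hx.1.le
  · exact ((exp_neg_integrableOn_Ioi c one_pos).const_mul C).const_mul _
  · refine Eventually.of_forall fun u x hx => ?_
    have hs : ((u : ℂ) + η * Complex.I) ≠ 0 := by
      intro h
      have := congrArg Complex.im h
      simp [hη0] at this
    refine ((hasDerivAt_cpow_real (hpos x hx).ne' hs).const_mul _).congr_deriv ?_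
    ring

/-- `hc0` keeps the exponent c + it away from 0, as `hasDerivAt_cpow_real` requires; on the
horizontal lines the imaginary part does this. -/
lemma FastDecay.hasDerivAt_segInt (hc : c < d) (hc0 : c ≠ 0) (hz : 0 < z) :
    HasDerivAt (segInt c H) ((z : ℂ)⁻¹ * segInt c (fun s => s * H s) z) z := by
  have hpos : ∀ x ∈ Ioo (z / 2) (2 * z), 0 < x := fun x hx => (half_pos hz).trans hx.1
  have hcont := hH.continuous_seg hc
  have hcont' := hH.id_mul.continuous_seg hc
  have key := intervalIntegral.hasDerivAt_integral_of_dominated_loc_of_deriv_le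
    (μ := volume) (a := -1) (b := 1)
    (F := fun (x : ℝ) (t : ℝ) =>
      H (c + t * Complex.I) * (x : ℂ) ^ ((c : ℂ) + t * Complex.I))
    (F' := fun (x : ℝ) (t : ℝ) => (x : ℂ)⁻¹ * (((c : ℂ) + t * Complex.I) *
      H (c + t * Complex.I) * (x : ℂ) ^ ((c : ℂ) + t * Complex.I)))
    (x₀ := z) (s := Ioo (z / 2) (2 * z))
    (bound := fun t => (z / 2)⁻¹ * (‖((c : ℂ) + t * Complex.I) * H (c + t * Complex.I)‖ *
      (Real.exp (2 * |c| * (|Real.log (z / 2)| + |Real.log (2 * z)|)) *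
        Real.exp ((|Real.log (z / 2)| + |Real.log (2 * z)|) * c))))
    (Ioo_mem_nhds (by linarith) (by linarith)) ?_
    ((hcont.mul (continuous_cpow_seg hz)).intervalIntegrable _ _) ?_ ?_ ?_ ?_
  · refine key.2.congr_deriv ?_
    rw [intervalIntegral.integral_const_mul, segInt]
  · filter_upwards [Ioi_mem_nhds hz] with x hx
    exact (hcont.mul (continuous_cpow_seg hx)).aestronglyMeasurable
  · exact (continuous_const.mul (hcont'.mul (continuous_cpow_seg hz))).aestronglyMeasurable
  · refine Eventually.of_forall fun t _ x hx => ?_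
    have hlog : |Real.log x| ≤ |Real.log (z / 2)| + |Real.log (2 * z)| := by
      have h1 := Real.log_le_log (half_pos hz) hx.1.le
      have h2 := Real.log_le_log (hpos x hx) hx.2.le
      rw [abs_le]
      constructor
      · have := neg_abs_le (Real.log (z / 2)); have := abs_nonneg (Real.log (2 * z)); linarith
      · have := le_abs_self (Real.log (2 * z)); have := abs_nonneg (Real.log (z / 2)); linarith
    rw [norm_mul, norm_mul _ ((x : ℂ) ^ _), norm_cpow_line (hpos x hx)]
    have hxc : 0 ≤ x ^ c := Real.rpow_nonneg (hpos x hx).le c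
    gcongr
    · rw [norm_inv, Complex.norm_real, Real.norm_of_nonneg (hpos x hx).le]
      exact inv_anti₀ (half_pos hz) hx.1.le
    · exact rpow_le_exp (hpos x hx) hlog le_rfl
  · exact (continuous_const.mul (hcont'.norm.mul continuous_const)).intervalIntegrable _ _
  · refine Eventually.of_forall fun t _ x hx => ?_
    have hs : ((c : ℂ) + t * Complex.I) ≠ 0 := by
      intro h
      have := congrArg Complex.re h
      simp [hc0] at this
    refine ((hasDerivAt_cpow_real (hpos x hx).ne' hs).const_mul _).congr_deriv ?_
    ring

lemma FastDecay.hasDerivAt_loopInt (hc : c < d) (hc0 : c ≠ 0) (hz : 0 < z) :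
    HasDerivAt (loopInt c H) ((z : ℂ)⁻¹ * loopInt c (fun s => s * H s) z) z := by
  have h1 := hH.hasDerivAt_lineInt (c := c) (η := -1) (by simp) hz
  have h2 := hH.hasDerivAt_lineInt (c := c) (η := 1) (by simp) hz
  have h3 := hH.hasDerivAt_segInt hc hc0 hz
  refine (((h1.neg.add (h3.const_mul Complex.I)).add h2).const_mul _).congr_deriv ?_
  rw [loopInt]
  ring

lemma FastDecay.lineInt_sub {c' : ℝ} (hη : |η| = 1) (hz : 0 < z) :
    lineInt c η H z - lineInt c' η H z =
      ∫ u in c..c', H ((u : ℂ) + η * Complex.I) * (z : ℂ) ^ ((u : ℂ) + η * Complex.I) :=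
  intervalIntegral.integral_Ioi_sub_Ioi' (hH.integrableOn_line hη hz) (hH.integrableOn_line hη hz)

/-- Cauchy's theorem on the rectangle between the two vertical segments, which lies in Re s < d. Its
horizontal sides are the differences of the line integrals. -/
lemma FastDecay.loopInt_shift {c' : ℝ} (hc : c < d) (hc' : c' < d) (hz : 0 < z) :
    loopInt c H z = loopInt c' H z := by
  have hz' : (z : ℂ) ≠ 0 := by exact_mod_cast hz.ne'
  have key := Complex.integral_boundary_rect_eq_zero_of_differentiableOn
    (fun s => H s * (z : ℂ) ^ s) (c + (-1 : ℝ) * Complex.I) (c' + (1 : ℝ) * Complex.I) (by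
      intro s hs
      rw [Complex.mem_reProdIm] at hs
      have hre := hs.1
      simp at hre
      refine DifferentiableAt.differentiableWithinAt ?_
      refine (hH.diff s (Or.inr ?_)).mul
        ((differentiableAt_id).const_cpow (Or.inl hz'))
      have := hre.2
      rcases Set.mem_uIcc.1 hre with h | h <;> linarith [h.2])
  have h1 := hH.lineInt_sub (c := c) (c' := c') (η := -1) (by simp) hz
  have h2 := hH.lineInt_sub (c := c) (c' := c') (η := 1) (by simp) hz
  simp only [Complex.add_re, Complex.ofReal_re, Complex.mul_re, Complex.I_re, mul_zero,
    Complex.ofReal_im, Complex.I_im, mul_one, sub_self, add_zero, Complex.add_im, Complex.mul_im,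
    zero_add, smul_eq_mul] at key
  rw [← h1, ← h2] at key
  unfold loopInt
  congr 1
  unfold segInt
  linear_combination (-1 : ℂ) * key

/-- Re s ≥ c on the whole contour, so x^(Re s) ≤ A^(Re s - c) x^c for x ≤ A. Together with
`loopInt_shift`, the behaviour at the origin is governed by how far the contour can be moved to the
right. -/
lemma FastDecay.norm_loopInt_le (hc : c < d) {A : ℝ} (hA : 0 < A) :
    ∃ C, 0 ≤ C ∧ ∀ x, 0 < x → x ≤ A → ‖loopInt c H x‖ ≤ C * x ^ c := by
  have hline : ∀ η : ℝ, |η| = 1 → ∃ C, 0 ≤ C ∧ ∀ x, 0 < x → x ≤ A →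
      ‖lineInt c η H x‖ ≤ C * x ^ c := by
    intro η hη
    refine ⟨∫ u in Ioi c, A ^ (-c) * ‖H (u + η * Complex.I) * (A : ℂ) ^ ((u : ℂ) + η * Complex.I)‖,
      integral_nonneg fun u => by positivity, fun x hx hxA => ?_⟩
    rw [← integral_mul_const]
    refine norm_integral_le_of_norm_le
      (((hH.integrableOn_line hη hA).norm.const_mul _).mul_const _) ?_
    filter_upwards [self_mem_ae_restrict measurableSet_Ioi] with u hu
    rw [norm_mul, norm_mul, norm_cpow_line hx, norm_cpow_line hA]
    have h1 : x ^ (u - c) ≤ A ^ (u - c) :=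
      Real.rpow_le_rpow hx.le hxA (sub_nonneg.2 (le_of_lt hu))
    have h2 : x ^ u = x ^ (u - c) * x ^ c := by rw [← Real.rpow_add hx]; simp
    have h3 : A ^ (u - c) = A ^ (-c) * A ^ u := by rw [← Real.rpow_add hA]; ring_nf
    rw [h2]
    calc _ ≤ ‖H (u + η * Complex.I)‖ * (A ^ (u - c) * x ^ c) := by gcongr
      _ = _ := by rw [h3]; ring
  obtain ⟨C₁, hC₁, h₁⟩ := hline (-1) (by simp)
  obtain ⟨C₂, hC₂, h₂⟩ := hline 1 (by simp)
  set C₃ := ∫ t in (-1 : ℝ)..1, ‖H (c + t * Complex.I)‖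
  have hC₃ : 0 ≤ C₃ := intervalIntegral.integral_nonneg (by norm_num) fun t _ => norm_nonneg _
  refine ⟨‖(2 * (Real.pi : ℂ) * Complex.I)⁻¹‖ * (C₁ + C₃ + C₂), by positivity, fun x hx hxA => ?_⟩
  have h₃ : ‖segInt c H x‖ ≤ C₃ * x ^ c := by
    rw [← intervalIntegral.integral_mul_const]
    refine intervalIntegral.norm_integral_le_of_norm_le (by norm_num) ?_
      ((hH.continuous_seg hc).norm.mul continuous_const |>.intervalIntegrable _ _)
    refine Eventually.of_forall fun t _ => ?_
    rw [norm_mul, norm_cpow_line hx]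
  rw [loopInt, norm_mul, mul_assoc ‖_‖]
  refine mul_le_mul_of_nonneg_left ?_ (norm_nonneg _)
  rw [add_mul, add_mul]
  refine norm_add_le_of_le (norm_add_le_of_le ?_ ?_) (h₂ x hx hxA)
  · rw [norm_neg]; exact h₁ x hx hxA
  · rw [norm_mul, Complex.norm_I, one_mul]; exact h₃

-- Substitute s → s + 1 and split off z from z^(s+1).
omit hH in
lemma loopInt_comp_sub_one (hz : 0 < z) :
    loopInt c (fun s => H (s - 1)) z = z * loopInt (c - 1) H z := by
  have hz' : (z : ℂ) ≠ 0 := by exact_mod_cast hz.ne'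
  have hl : ∀ η : ℝ, lineInt c η (fun s => H (s - 1)) z = z * lineInt (c - 1) η H z := by
    intro η
    have h := (measurePreserving_sub_right volume (1 : ℝ)).setIntegral_preimage_emb
      (measurableEmbedding_subRight (1 : ℝ))
      (fun u : ℝ => H ((u : ℂ) + η * Complex.I) * (z : ℂ) ^ ((u : ℂ) + η * Complex.I)) (Ioi (c - 1))
    have hpre : (fun x : ℝ => x - 1) ⁻¹' Ioi (c - 1) = Ioi c := by ext; simp
    rw [hpre] at h
    rw [lineInt, lineInt, ← h, ← integral_const_mul]
    congr 1
    funext u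
    have e : (u : ℂ) + η * Complex.I = (((u - 1 : ℝ) : ℂ) + η * Complex.I) + 1 := by
      push_cast; ring
    rw [e, Complex.cpow_add _ _ hz', Complex.cpow_one, add_sub_cancel_right]
    ring
  have hs : segInt c (fun s => H (s - 1)) z = z * segInt (c - 1) H z := by
    rw [segInt, segInt, ← intervalIntegral.integral_const_mul]
    congr 1
    funext t
    have e : (c : ℂ) + t * Complex.I = (((c - 1 : ℝ) : ℂ) + t * Complex.I) + 1 := by
      push_cast; ring
    rw [e, Complex.cpow_add _ _ hz', Complex.cpow_one, add_sub_cancel_right]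
    ring
  rw [loopInt, loopInt, hl, hl, hs]
  ring

omit hH in
lemma loopInt_congr {H₁ H₂ : ℂ → ℂ} (hc : c < d)
    (h : ∀ s : ℂ, s.im ≠ 0 ∨ s.re < d → H₁ s = H₂ s) : loopInt c H₁ z = loopInt c H₂ z := by
  have hl : ∀ η : ℝ, η ≠ 0 → lineInt c η H₁ z = lineInt c η H₂ z := by
    intro η hη
    rw [lineInt, lineInt]
    congr 1
    funext u
    rw [h _ (Or.inl (by simpa using hη))]
  have hs : segInt c H₁ z = segInt c H₂ z := by
    rw [segInt, segInt]
    congr 1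
    funext u
    rw [h _ (Or.inr (by simpa using hc))]
  rw [loopInt, loopInt, hl _ (by norm_num), hl _ one_ne_zero, hs]

omit hH in
lemma loopInt_const_mul (a : ℂ) : loopInt c (fun s => a * H s) z = a * loopInt c H z := by
  simp only [loopInt, lineInt, segInt, mul_assoc, integral_const_mul,
    intervalIntegral.integral_const_mul]
  ring

lemma FastDecay.loopInt_add {H₂ : ℂ → ℂ} (hH₂ : FastDecay d H₂) (hc : c < d) (hz : 0 < z) :
    loopInt c (fun s => H s + H₂ s) z = loopInt c H z + loopInt c H₂ z := by
  have hl : ∀ η : ℝ, |η| = 1 → lineInt c η (fun s => H s + H₂ s) z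
      = lineInt c η H z + lineInt c η H₂ z := by
    intro η hη
    simp only [lineInt, add_mul]
    exact integral_add (hH.integrableOn_line hη hz) (hH₂.integrableOn_line hη hz)
  have hs : segInt c (fun s => H s + H₂ s) z = segInt c H z + segInt c H₂ z := by
    simp only [segInt, add_mul]
    exact intervalIntegral.integral_add
      (((hH.continuous_seg hc).mul (continuous_cpow_seg hz)).intervalIntegrable _ _)
      (((hH₂.continuous_seg hc).mul (continuous_cpow_seg hz)).intervalIntegrable _ _)
  rw [loopInt, loopInt, loopInt, hl _ (by simp), hl _ (by simp), hs]
  ring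

end Loop

end GenBessel

end

/-! ### Meijer functions with polynomial factors: derivative, differential equation, growth at the
origin -/

noncomputable section

namespace GenBessel

/-- The Gamma factors of the Meijer function. -/
def gammaFactor (m : ℕ) {q : ℕ} (b : Fin q → ℝ) (s : ℂ) : ℂ :=
  ∏ j : Fin q, if (j : ℕ) < m then Complex.Gamma ((b j : ℂ) - s)
    else (Complex.Gamma (1 - (b j : ℂ) + s))⁻¹

/-- The loop integral of `p(s)` times the Gamma factors, which is `p(θ)` applied to the Meijer
function. -/
def polyMeijer (m : ℕ) {q : ℕ} (b : Fin q → ℝ) (p : Polynomial ℂ) (z : ℝ) : ℂ :=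
  loopInt (-1 / 2) (fun s => p.eval s * gammaFactor m b s) z

section Meijer

variable {m q : ℕ} {b : Fin q → ℝ} {z : ℝ}

lemma fastDecay_gammaFactor {d : ℝ} (hq : 0 < q) (hb : ∀ j : Fin q, (j : ℕ) < m → d ≤ b j) :
    FastDecay d (gammaFactor m b) := by
  have : Nonempty (Fin q) := ⟨⟨0, hq⟩⟩
  refine FastDecay.prod Finset.univ Finset.univ_nonempty fun j _ => ?_
  by_cases hj : (j : ℕ) < m
  · simpa only [hj, if_true] using (fastDecay_Gamma (b j)).mono (hb j hj)
  · simp only [hj, if_false]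
    have := fastDecay_inv_Gamma (1 - b j) d
    push_cast at this
    exact this

variable (hq : 0 < q) (hb : ∀ j : Fin q, (j : ℕ) < m → 0 ≤ b j)
include hq hb

lemma hasDerivAt_polyMeijer (p : Polynomial ℂ) (hz : 0 < z) :
    HasDerivAt (polyMeijer m b p) ((z : ℂ)⁻¹ * polyMeijer m b (Polynomial.X * p) z) z := by
  have h := ((fastDecay_gammaFactor hq hb).poly_mul p).hasDerivAt_loopInt (c := -1 / 2)
    (by norm_num) (by norm_num) hz
  refine h.congr_deriv ?_
  simp only [polyMeijer, Polynomial.eval_mul, Polynomial.eval_X, mul_assoc]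

lemma iterate_euler_polyMeijer (p : Polynomial ℂ) (i : ℕ) :
    ∀ z, 0 < z → euler^[i] (polyMeijer m b p) z = polyMeijer m b (Polynomial.X ^ i * p) z := by
  induction i with
  | zero => intro z _; simp
  | succ i ih =>
    intro z hz
    rw [Function.iterate_succ_apply', euler]
    have he : euler^[i] (polyMeijer m b p) =ᶠ[𝓝 z] polyMeijer m b (Polynomial.X ^ i * p) := by
      filter_upwards [Ioi_mem_nhds hz] with x hx using ih x hx
    rw [he.deriv_eq, (hasDerivAt_polyMeijer hq hb _ hz).deriv, pow_succ', mul_assoc,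
      mul_inv_cancel_left₀ (by exact_mod_cast hz.ne')]

lemma polyMeijer_sum {ι : Type*} (s : Finset ι) (a : ι → ℂ) (p : ι → Polynomial ℂ) (hz : 0 < z) :
    polyMeijer m b (∑ i ∈ s, Polynomial.C (a i) * p i) z
      = ∑ i ∈ s, a i * polyMeijer m b (p i) z := by
  classical
  have hF := fastDecay_gammaFactor hq hb
  induction s using Finset.induction_on with
  | empty => simpa [polyMeijer] using loopInt_const_mul (c := -1 / 2) (z := z) (H := fun _ => 0) 0
  | insert i s hi ih =>
    rw [Finset.sum_insert hi, Finset.sum_insert hi, ← ih, polyMeijer, polyMeijer, polyMeijer,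
      ← loopInt_const_mul, ← FastDecay.loopInt_add (d := 0) ?_ (hF.poly_mul _) (by norm_num) hz]
    · congr 1
      funext s
      simp [add_mul, mul_assoc]
    · exact (hF.poly_mul _).const_mul _

-- Each factor contributes s - b_j by the functional equation of Γ: Γ(b_j - s + 1) = -(s - b_j)
-- Γ(b_j - s) for j < m, and 1/Γ(s - b_j) = (s - b_j)/Γ(s - b_j + 1) for the others. The condition
-- on s excludes s = b_j, where the first identity fails for the conventional value of Γ at its
-- poles.
omit hq in
lemma gammaFactor_sub_one (s : ℂ) (hs : s.im ≠ 0 ∨ s.re < 0) :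
    gammaFactor m b (s - 1) = (∏ j : Fin q, if (j : ℕ) < m then (-1 : ℂ) else 1)
      * (∏ j : Fin q, (s - b j)) * gammaFactor m b s := by
  rw [gammaFactor, gammaFactor, ← Finset.prod_mul_distrib, ← Finset.prod_mul_distrib]
  refine Finset.prod_congr rfl fun j _ => ?_
  by_cases hj : (j : ℕ) < m
  · simp only [hj, if_true]
    have hne : (b j : ℂ) - s ≠ 0 := by
      rw [sub_ne_zero]
      rintro h
      rcases hs with hs | hs
      · apply hs; rw [← h]; simp
      · rw [← h] at hs
        simp at hs
        exact absurd (hb j hj) (not_le.2 hs)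
    have := Complex.Gamma_add_one _ hne
    rw [show (b j : ℂ) - (s - 1) = b j - s + 1 by ring, this]
    ring
  · simp only [hj, if_false]
    have := Complex.one_div_Gamma_eq_self_mul_one_div_Gamma_add_one (s - b j)
    rw [show (1 : ℂ) - b j + (s - 1) = s - b j by ring, this,
      show s - (b j : ℂ) + 1 = 1 - b j + s by ring]
    ring

/-- The hypergeometric differential equation of the Meijer function. -/
lemma polyMeijer_ode (hz : 0 < z) :
    polyMeijer m b (∏ j : Fin q, (Polynomial.X - Polynomial.C (b j : ℂ))) z
      = (∏ j : Fin q, if (j : ℕ) < m then (-1 : ℂ) else 1) * (z * polyMeijer m b 1 z) := by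
  have hF := fastDecay_gammaFactor hq hb
  have h1 : polyMeijer m b 1 z = loopInt (-1 / 2) (gammaFactor m b) z := by simp [polyMeijer]
  -- The contour is first moved one unit to the left, where there are no poles; the factor z then
  -- moves it back and replaces s by s - 1 in the Gamma factors.
  rw [h1, hF.loopInt_shift (c := -1 / 2) (c' := -1 / 2 - 1) (by norm_num) (by norm_num) hz,
    ← loopInt_comp_sub_one hz, ← loopInt_const_mul, polyMeijer]
  refine loopInt_congr (d := 0) (by norm_num) fun s hs => ?_
  rw [gammaFactor_sub_one hb s hs, ← mul_assoc, ← mul_assoc, ← Finset.prod_mul_distrib,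
    Finset.prod_congr rfl (g := fun _ => (1 : ℂ))]
  · simp [Polynomial.eval_prod]
  · intro j _
    split_ifs <;> simp

lemma norm_polyMeijer_le (p : Polynomial ℂ) {c : ℝ} (hc : c < 0) {A : ℝ} (hA : 0 < A) :
    ∃ C, 0 ≤ C ∧ ∀ x, 0 < x → x ≤ A → ‖polyMeijer m b p x‖ ≤ C * x ^ c := by
  have hF := (fastDecay_gammaFactor hq hb).poly_mul p
  obtain ⟨C, hC, h⟩ := hF.norm_loopInt_le hc hA
  refine ⟨C, hC, fun x hx hxA => ?_⟩
  rw [polyMeijer, hF.loopInt_shift (c := -1 / 2) (c' := c) (by norm_num) hc hx]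
  exact h x hx hxA

/-- A polynomial which cancels the first poles improves the behaviour at the origin. -/
lemma norm_polyMeijer_mul_le (p : Polynomial ℂ) {c : ℝ} (hc : c < 1) {A : ℝ} (hA : 0 < A) :
    ∃ C, 0 ≤ C ∧ ∀ x, 0 < x → x ≤ A → ‖polyMeijer m b
      (p * ∏ j : Fin q, if (j : ℕ) < m then (Polynomial.X - Polynomial.C (b j : ℂ)) else 1) x‖
        ≤ C * x ^ c := by
  -- (s - b) Γ(b - s) = -Γ(b + 1 - s): the pole at b is gone, so the new integrand is holomorphic
  -- for Re s < 1 and the contour may pass the origin.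
  set H₁ : ℂ → ℂ := fun s => ∏ j : Fin q, if (j : ℕ) < m then
    (-1) * Complex.Gamma ((b j + 1 : ℝ) - s) else (Complex.Gamma ((1 - b j : ℝ) + s))⁻¹ with hH₁
  have hF : FastDecay 1 H₁ := by
    have : Nonempty (Fin q) := ⟨⟨0, hq⟩⟩
    refine FastDecay.prod Finset.univ Finset.univ_nonempty fun j _ => ?_
    by_cases hj : (j : ℕ) < m
    · simpa only [hj, if_true] using ((fastDecay_Gamma (b j + 1)).mono
        (by linarith [hb j hj])).const_mul (-1)
    · simpa only [hj, if_false] using fastDecay_inv_Gamma (1 - b j) 1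
  obtain ⟨C, hC, h⟩ := (hF.poly_mul p).norm_loopInt_le hc hA
  refine ⟨C, hC, fun x hx hxA => ?_⟩
  have e : polyMeijer m b (p * ∏ j : Fin q, if (j : ℕ) < m then
      (Polynomial.X - Polynomial.C (b j : ℂ)) else 1) x
        = loopInt (-1 / 2) (fun s => p.eval s * H₁ s) x := by
    refine loopInt_congr (d := 0) (by norm_num) fun s hs => ?_
    rw [Polynomial.eval_mul, mul_assoc, Polynomial.eval_prod, gammaFactor,
      ← Finset.prod_mul_distrib]
    congr 1
    refine Finset.prod_congr rfl fun j _ => ?_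
    by_cases hj : (j : ℕ) < m
    · simp only [hj, if_true]
      have hne : (b j : ℂ) - s ≠ 0 := by
        rw [sub_ne_zero]
        rintro h
        rcases hs with hs | hs
        · apply hs; rw [← h]; simp
        · rw [← h] at hs
          simp at hs
          exact absurd (hb j hj) (not_le.2 hs)
      have := Complex.Gamma_add_one _ hne
      rw [show ((b j + 1 : ℝ) : ℂ) - s = b j - s + 1 by push_cast; ring, this]
      simp
      ring
    · simp [hj]
  rw [e, (hF.poly_mul p).loopInt_shift (c := -1 / 2) (c' := c) (by norm_num) hc hx]
  exact h x hx hxA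

end Meijer

/-! ### The functions `φ_j` and `ψ_j` -/

section PhiPsi

variable {M : ℕ} (ν : Fin (M + 1) → ℕ)

/-- The coefficients of `∏_{i=0}^M (x - ν_i)`. -/
def beta (i : ℕ) : ℂ := (-1) ^ (M + 1 - i) * esymmNu ν (M + 1 - i)

/-- The polynomial `∑_i α_{i+j} x^i`. -/
def psiPoly (j : ℕ) : Polynomial ℂ :=
  ∑ i ∈ Finset.range (M - j + 1), Polynomial.C (alpha ν (i + j)) * Polynomial.X ^ i

/-- The parameters of `f`. -/
def fParam (i : Fin (M + 1)) : ℝ := -(ν i : ℝ)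

/-- The parameters of `g`. -/
def gParam : Fin (M + 1) → ℝ :=
  Fin.snoc (α := fun _ => ℝ) (fun i : Fin M => (ν i.succ : ℝ)) (ν 0 : ℝ)

lemma f_eq : f ν = polyMeijer 1 (fParam ν) 1 := by
  funext z
  rw [f, meijerG_eq_loopInt, polyMeijer]
  simp [gammaFactor, fParam]

lemma g_eq : g ν = polyMeijer M (gParam ν) 1 := by
  funext z
  rw [g, meijerG_eq_loopInt, polyMeijer]
  simp [gammaFactor, gParam]

lemma gParam_nonneg (j : Fin (M + 1)) : 0 ≤ gParam ν j := by
  refine Fin.lastCases ?_ (fun i => ?_) j <;> simp [gParam]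

variable {ν}

lemma fParam_nonneg (hν : ν 0 = 0) (j : Fin (M + 1)) (hj : (j : ℕ) < 1) : 0 ≤ fParam ν j := by
  have : j = 0 := by ext; simpa using hj
  simp [this, fParam, hν]

lemma phi_eq (hν : ν 0 = 0) (j : ℕ) {x : ℝ} (hx : 0 < x) :
    phi ν j x = (-1) ^ (M - j + 1) * polyMeijer 1 (fParam ν) (Polynomial.X ^ j) x := by
  rw [phi, f_eq, iterate_euler_polyMeijer (Nat.succ_pos _) (fParam_nonneg hν) _ _ _ hx, mul_one]

lemma psi_eq (j : ℕ) {x : ℝ} (hx : 0 < x) :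
    psi ν j x = polyMeijer M (gParam ν) (psiPoly ν j) x := by
  rw [psi, psiPoly, polyMeijer_sum (Nat.succ_pos _) (fun j _ => gParam_nonneg ν j) _ _ _ hx, g_eq]
  refine Finset.sum_congr rfl fun i _ => ?_
  rw [iterate_euler_polyMeijer (Nat.succ_pos _) (fun j _ => gParam_nonneg ν j) _ _ _ hx, mul_one]

lemma hasDerivAt_phi (hν : ν 0 = 0) {j : ℕ} (hj : j < M) {x : ℝ} (hx : 0 < x) :
    HasDerivAt (phi ν j) (-phi ν (j + 1) x / x) x := by
  have h := (hasDerivAt_polyMeijer (Nat.succ_pos _) (fParam_nonneg hν) (Polynomial.X ^ j) hx).const_mul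
    ((-1 : ℂ) ^ (M - j + 1))
  have he : phi ν j =ᶠ[𝓝 x] fun x => (-1) ^ (M - j + 1) *
      polyMeijer 1 (fParam ν) (Polynomial.X ^ j) x := by
    filter_upwards [Ioi_mem_nhds hx] with y hy using phi_eq hν j hy
  refine (h.congr_of_eventuallyEq he).congr_deriv ?_
  rw [phi_eq hν (j + 1) hx, ← pow_succ', show M - j + 1 = M - (j + 1) + 1 + 1 by omega,
    pow_succ _ (M - (j + 1) + 1)]
  ring

/-- Vieta's formula. The parameters of f are -ν_i, so the product is ∏ (X + ν_i) and the signs built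
into `beta` have to be undone. -/
lemma prod_fParam_eq :
    ∏ j : Fin (M + 1), (Polynomial.X - Polynomial.C (fParam ν j : ℂ))
      = Polynomial.X ^ (M + 1) + ∑ i ∈ Finset.range (M + 1),
          Polynomial.C ((-1) ^ (M + 1 - i) * beta ν i) * Polynomial.X ^ i := by
  have h := Multiset.prod_X_add_C_eq_sum_esymm
    (Finset.univ.val.map fun i : Fin (M + 1) => (ν i : ℂ))
  have hl : ((Finset.univ.val.map fun i : Fin (M + 1) => (ν i : ℂ)).map
      fun r => Polynomial.X + Polynomial.C r).prod
        = ∏ j : Fin (M + 1), (Polynomial.X - Polynomial.C (fParam ν j : ℂ)) := by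
    rw [Multiset.map_map, Finset.prod_map_val]
    refine Finset.prod_congr rfl fun j _ => ?_
    simp [fParam]
  rw [hl] at h
  rw [h]
  simp only [Multiset.card_map, Finset.card_val, Finset.card_univ, Fintype.card_fin]
  rw [Finset.sum_range_succ', ← Finset.sum_range_reflect, add_comm]
  refine congrArg₂ _ ?_ ?_
  · rw [Multiset.esymm, Multiset.powersetCard_zero_left]
    simp
  · refine Finset.sum_congr rfl fun i hi => ?_
    have hi' := Finset.mem_range.1 hi
    have hs : (-1 : ℂ) ^ (M + 1 - i) * beta ν i = esymmNu ν (M + 1 - i) := by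
      rw [beta, ← mul_assoc, ← mul_pow]
      simp
    have e1 : M + 1 - 1 - i + 1 = M + 1 - i := by omega
    have e2 : M + 1 - (M + 1 - i) = i := by omega
    rw [hs, e1, e2]
    rfl

/-- The hypergeometric equation of order M + 1 for f, solved for θ^(M+1) f. Only one Gamma factor
stands in the numerator, hence the total sign -1. -/
lemma hasDerivAt_phi_last (hν : ν 0 = 0) {x : ℝ} (hx : 0 < x) :
    HasDerivAt (phi ν M) (((-1) ^ (M + 1) * x * phi ν 0 x +
      ∑ i ∈ Finset.range (M + 1), beta ν i * phi ν i x) / x) x := by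
  have hx0 : (x : ℂ) ≠ 0 := by exact_mod_cast hx.ne'
  have h := (hasDerivAt_polyMeijer (Nat.succ_pos _) (fParam_nonneg hν) (Polynomial.X ^ M) hx).const_mul
    ((-1 : ℂ) ^ (M - M + 1))
  have he : phi ν M =ᶠ[𝓝 x] fun x => (-1) ^ (M - M + 1) *
      polyMeijer 1 (fParam ν) (Polynomial.X ^ M) x := by
    filter_upwards [Ioi_mem_nhds hx] with y hy using phi_eq hν M hy
  refine (h.congr_of_eventuallyEq he).congr_deriv ?_
  have hode := polyMeijer_ode (Nat.succ_pos _) (fParam_nonneg hν) hx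
  have hsign : (∏ j : Fin (M + 1), if (j : ℕ) < 1 then (-1 : ℂ) else 1) = -1 := by
    rw [Fin.prod_univ_succ]; simp
  -- The leading coefficient is set to 1 by hand; the formula for the others would need `beta` at
  -- the index M + 1.
  have hsum := polyMeijer_sum (Nat.succ_pos M) (fParam_nonneg hν) (Finset.range (M + 2))
    (fun i => if i = M + 1 then 1 else (-1) ^ (M + 1 - i) * beta ν i)
    (fun i => Polynomial.X ^ i) hx
  rw [Finset.sum_range_succ _ (M + 1), Finset.sum_range_succ _ (M + 1), if_pos rfl] at hsum
  have e1 : ∑ i ∈ Finset.range (M + 1), Polynomial.C (if i = M + 1 then (1 : ℂ) else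
      (-1) ^ (M + 1 - i) * beta ν i) * Polynomial.X ^ i = ∑ i ∈ Finset.range (M + 1),
        Polynomial.C ((-1) ^ (M + 1 - i) * beta ν i) * Polynomial.X ^ i := by
    refine Finset.sum_congr rfl fun i hi => ?_
    rw [if_neg (Finset.mem_range.1 hi).ne]
  have e2 : ∑ i ∈ Finset.range (M + 1), (if i = M + 1 then (1 : ℂ) else
      (-1) ^ (M + 1 - i) * beta ν i) * polyMeijer 1 (fParam ν) (Polynomial.X ^ i) x
        = ∑ i ∈ Finset.range (M + 1), beta ν i * phi ν i x := by
    refine Finset.sum_congr rfl fun i hi => ?_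
    have := Finset.mem_range.1 hi
    rw [if_neg (Finset.mem_range.1 hi).ne, phi_eq hν i hx,
      show M - i + 1 = M + 1 - i by omega]
    ring
  rw [e1, e2, add_comm, map_one, one_mul, ← prod_fParam_eq, hode, hsign, one_mul] at hsum
  rw [phi_eq hν 0 hx, ← pow_succ', eq_div_iff hx0]
  have hs : ((-1 : ℂ) ^ (M + 1)) * (-1) ^ (M + 1) = 1 := by
    rw [← mul_pow]; simp
  simp only [pow_zero, Nat.sub_zero, Nat.sub_self, zero_add, pow_one]
  have h3 : (x : ℂ)⁻¹ * x = 1 := inv_mul_cancel₀ hx0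
  linear_combination hsum - polyMeijer 1 (fParam ν) (Polynomial.X ^ (M + 1)) x * h3 -
    (x : ℂ) * polyMeijer 1 (fParam ν) 1 x * hs

lemma natDegree_prod_nu :
    (∏ k : Fin M, (Polynomial.X - Polynomial.C (ν k.succ : ℂ))).natDegree = M := by
  rw [Polynomial.natDegree_finsetProd_X_sub_C_eq_card]; simp

lemma alpha_last : alpha ν M = 1 := by
  have h : (∏ k : Fin M, (Polynomial.X - Polynomial.C (ν k.succ : ℂ))).Monic :=
    Polynomial.monic_prod_of_monic _ _ fun k _ => Polynomial.monic_X_sub_C _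
  have := h.coeff_natDegree
  rwa [natDegree_prod_nu] at this

lemma psiPoly_last : psiPoly ν M = 1 := by
  simp [psiPoly, alpha_last]

lemma psiPoly_zero : psiPoly ν 0 = ∏ k : Fin M, (Polynomial.X - Polynomial.C (ν k.succ : ℂ)) := by
  conv_rhs => rw [Polynomial.as_sum_range_C_mul_X_pow
    (∏ k : Fin M, (Polynomial.X - Polynomial.C (ν k.succ : ℂ))), natDegree_prod_nu]
  rfl

/-- The `psiPoly ν j` are the Horner quotients of ∏ (x - ν_k). This is what makes the ψ_j satisfy a
first-order system dual to that of the φ_j. -/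
lemma X_mul_psiPoly {j : ℕ} (hj : 1 ≤ j) (hjM : j ≤ M) :
    Polynomial.X * psiPoly ν j = psiPoly ν (j - 1) - Polynomial.C (alpha ν (j - 1)) := by
  obtain ⟨j, rfl⟩ : ∃ i, j = i + 1 := ⟨j - 1, by omega⟩
  rw [psiPoly, psiPoly, Nat.add_sub_cancel, show M - j + 1 = (M - (j + 1) + 1) + 1 by omega,
    Finset.sum_range_succ' _ (M - (j + 1) + 1), Finset.mul_sum]
  simp only [pow_zero, mul_one, zero_add, add_sub_cancel_right]
  refine Finset.sum_congr rfl fun i _ => ?_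
  rw [show i + 1 + j = i + (j + 1) by ring, pow_succ]
  ring

lemma prod_nu_coeff {i : ℕ} (hi : i ≤ M) :
    (∏ k : Fin (M + 1), (Polynomial.X - Polynomial.C (ν k : ℂ))).coeff i = beta ν i := by
  have h := Multiset.prod_X_sub_C_coeff
    (Finset.univ.val.map fun i : Fin (M + 1) => (ν i : ℂ)) (k := i)
    (by simp; omega)
  rw [Multiset.map_map, Finset.prod_map_val] at h
  simp only [Multiset.card_map, Finset.card_val, Finset.card_univ, Fintype.card_fin,
    Function.comp_def] at h
  exact h

/-- Because ν_0 = 0, the product over 0 ≤ i ≤ M is X times the product over 1 ≤ i ≤ M, which shifts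
the coefficients by one. -/
lemma beta_succ (hν : ν 0 = 0) {i : ℕ} (hi : i + 1 ≤ M) : beta ν (i + 1) = alpha ν i := by
  rw [← prod_nu_coeff hi, Fin.prod_univ_succ, hν]
  simp [alpha, Polynomial.coeff_X_mul]

lemma beta_zero (hν : ν 0 = 0) : beta ν 0 = 0 := by
  rw [← prod_nu_coeff (Nat.zero_le M), Fin.prod_univ_succ, hν]
  simp

lemma hasDerivAt_psi_aux (j : ℕ) {x : ℝ} (hx : 0 < x) :
    HasDerivAt (psi ν j)
      ((x : ℂ)⁻¹ * polyMeijer M (gParam ν) (Polynomial.X * psiPoly ν j) x) x := by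
  have h := hasDerivAt_polyMeijer (m := M) (Nat.succ_pos _) (fun j _ => gParam_nonneg ν j)
    (psiPoly ν j) hx
  have he : psi ν j =ᶠ[𝓝 x] polyMeijer M (gParam ν) (psiPoly ν j) := by
    filter_upwards [Ioi_mem_nhds hx] with y hy using psi_eq j hy
  exact h.congr_of_eventuallyEq he

lemma hasDerivAt_psi (hν : ν 0 = 0) {j : ℕ} (hj : 1 ≤ j) (hjM : j ≤ M) {x : ℝ} (hx : 0 < x) :
    HasDerivAt (psi ν j) ((psi ν (j - 1) x - beta ν j * psi ν M x) / x) x := by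
  refine (hasDerivAt_psi_aux j hx).congr_deriv ?_
  have h := polyMeijer_sum (m := M) (Nat.succ_pos M) (fun j _ => gParam_nonneg ν j)
    (Finset.range 2)
    (fun i => if i = 0 then 1 else - alpha ν (j - 1))
    (fun i => if i = 0 then psiPoly ν (j - 1) else 1) hx
  simp only [Finset.sum_range_succ, Finset.range_zero, Finset.sum_empty, zero_add, if_true,
    one_ne_zero, if_false, map_one, one_mul, mul_one, map_neg] at h
  rw [X_mul_psiPoly hj hjM, sub_eq_add_neg, h, psi_eq _ hx, psi_eq _ hx, psiPoly_last]
  obtain ⟨j, rfl⟩ : ∃ i, j = i + 1 := ⟨j - 1, by omega⟩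
  rw [beta_succ hν hjM, Nat.add_sub_cancel]
  ring

/-- X times `psiPoly ν 0` is the full characteristic polynomial, so the hypergeometric equation of g
closes the system. The term with `beta ν 0 = 0` is written only for uniformity with
`hasDerivAt_psi`. -/
lemma hasDerivAt_psi_zero (hν : ν 0 = 0) {x : ℝ} (hx : 0 < x) :
    HasDerivAt (psi ν 0) (((-1) ^ M * x * psi ν M x - beta ν 0 * psi ν M x) / x) x := by
  refine (hasDerivAt_psi_aux 0 hx).congr_deriv ?_
  have hode := polyMeijer_ode (Nat.succ_pos M) (fun j _ => gParam_nonneg ν j) hx (m := M)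
  have hsign : (∏ j : Fin (M + 1), if (j : ℕ) < M then (-1 : ℂ) else 1) = (-1) ^ M := by
    rw [Fin.prod_univ_castSucc]; simp
  have hp : ∏ j : Fin (M + 1), (Polynomial.X - Polynomial.C (gParam ν j : ℂ))
      = Polynomial.X * psiPoly ν 0 := by
    rw [Fin.prod_univ_castSucc, psiPoly_zero, mul_comm]
    simp [gParam, hν]
  rw [hp, hsign] at hode
  rw [hode, beta_zero hν, psi_eq M hx, psiPoly_last]
  ring

/-- For j ≥ 1 a factor s cancels the pole of Γ(-s) at 0, and the contour may be moved to Re s = 1/2.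
-/
lemma norm_phi_le (hν : ν 0 = 0) {j : ℕ} (hj : 1 ≤ j) {A : ℝ} (hA : 0 < A) :
    ∃ C, 0 ≤ C ∧ ∀ x, 0 < x → x ≤ A → ‖phi ν j x‖ ≤ C * x ^ (1 / 2 : ℝ) := by
  obtain ⟨C, hC, h⟩ := norm_polyMeijer_mul_le (Nat.succ_pos M) (fParam_nonneg hν)
    (Polynomial.X ^ (j - 1)) (c := 1 / 2) (by norm_num) hA
  refine ⟨C, hC, fun x hx hxA => ?_⟩
  rw [phi_eq hν j hx, norm_mul, norm_pow, norm_neg, norm_one, one_pow, one_mul]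
  convert h x hx hxA using 3
  rw [Fin.prod_univ_succ]
  obtain ⟨j, rfl⟩ : ∃ i, j = i + 1 := ⟨j - 1, by omega⟩
  simp [fParam, hν, pow_succ]

/-- Logarithms may occur at the origin when poles coincide. The exponent -1/4 covers them and is
still square integrable, as any exponent strictly between -1/2 and 0 would be. -/
lemma norm_psi_le (j : ℕ) {A : ℝ} (hA : 0 < A) :
    ∃ C, 0 ≤ C ∧ ∀ x, 0 < x → x ≤ A → ‖psi ν j x‖ ≤ C * x ^ (-1 / 4 : ℝ) := by
  obtain ⟨C, hC, h⟩ := norm_polyMeijer_le (Nat.succ_pos M) (fun j _ => gParam_nonneg ν j) (m := M)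
    (psiPoly ν j) (c := -1 / 4) (by norm_num) hA
  refine ⟨C, hC, fun x hx hxA => ?_⟩
  rw [psi_eq j hx]
  exact h x hx hxA

/-- `psiPoly ν 0` contains all factors s - ν_k and so cancels the first pole of every Gamma factor
in the numerator. -/
lemma norm_psi_zero_le {A : ℝ} (hA : 0 < A) :
    ∃ C, 0 ≤ C ∧ ∀ x, 0 < x → x ≤ A → ‖psi ν 0 x‖ ≤ C * x ^ (1 / 2 : ℝ) := by
  obtain ⟨C, hC, h⟩ := norm_polyMeijer_mul_le (Nat.succ_pos M) (fun j _ => gParam_nonneg ν j)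
    (m := M) 1 (c := 1 / 2) (by norm_num) hA
  refine ⟨C, hC, fun x hx hxA => ?_⟩
  rw [psi_eq 0 hx]
  convert h x hx hxA using 3
  rw [Fin.prod_univ_castSucc, psiPoly_zero]
  simp [gParam]

/-- The derivative -φ_1(x)/x is O(x^(-1/2)), hence integrable at 0, and φ_0 is a primitive. For M =
1 the function φ_1 is already the last one, which is why the continuity of φ_1 is proved in two
cases. -/
lemma exists_tendsto_phi_zero (hν : ν 0 = 0) (hM : 1 ≤ M) :
    ∃ L, Tendsto (phi ν 0) (𝓝[>] 0) (𝓝 L) := by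
  obtain ⟨C, hC, h⟩ := norm_phi_le hν le_rfl (zero_lt_one)
  have hcont : ContinuousOn (fun x : ℝ => -phi ν (0 + 1) x / (x : ℂ)) (Ioi 0) := by
    refine ContinuousOn.div (ContinuousOn.neg fun x hx => ?_) (by fun_prop)
      (fun x hx => by exact_mod_cast (ne_of_gt hx))
    rcases Nat.lt_or_ge (0 + 1) M with h1 | h1
    · exact (hasDerivAt_phi hν h1 hx).continuousAt.continuousWithinAt
    · obtain rfl : M = 0 + 1 := by omega
      exact (hasDerivAt_phi_last hν hx).continuousAt.continuousWithinAt
  have hint : IntegrableOn (fun x : ℝ => -phi ν (0 + 1) x / (x : ℂ)) (Ioc 0 1) := by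
    have hr : IntegrableOn (fun x : ℝ => C * x ^ (-1 / 2 : ℝ)) (Ioc 0 1) := by
      have := (intervalIntegral.intervalIntegrable_rpow' (r := -1 / 2) (a := 0) (b := 1)
        (by norm_num)).const_mul C
      rwa [intervalIntegrable_iff_integrableOn_Ioc_of_le zero_le_one] at this
    refine Integrable.mono' hr ((hcont.mono fun x hx => hx.1).aestronglyMeasurable
      measurableSet_Ioc) ?_
    filter_upwards [self_mem_ae_restrict measurableSet_Ioc] with x hx
    rw [norm_div, norm_neg, Complex.norm_real, Real.norm_of_nonneg hx.1.le, div_le_iff₀ hx.1]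
    refine (h x hx.1 hx.2).trans (le_of_eq ?_)
    rw [mul_assoc]
    congr 1
    conv_rhs => rw [← Real.rpow_one x, ← Real.rpow_mul hx.1.le, ← Real.rpow_add hx.1]
    norm_num
  have hprim := intervalIntegral.continuousOn_primitive_interval_left
    (f := fun x : ℝ => -phi ν (0 + 1) x / (x : ℂ)) (μ := volume) (a := 0) (b := 1)
    (by rwa [Set.uIcc_of_le zero_le_one, integrableOn_Icc_iff_integrableOn_Ioc])
  have hlim : Tendsto (fun x => ∫ t in x..1, -phi ν (0 + 1) t / (t : ℂ)) (𝓝[>] 0)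
      (𝓝 (∫ t in (0:ℝ)..1, -phi ν (0 + 1) t / (t : ℂ))) := by
    have h0 := hprim 0 (by simp)
    rw [Set.uIcc_of_le zero_le_one] at h0
    have h1 := h0.mono (s := Ioc 0 1) Ioc_subset_Icc_self
    rw [ContinuousWithinAt, nhdsWithin_Ioc_eq_nhdsGT zero_lt_one] at h1
    exact h1
  refine ⟨phi ν 0 1 - ∫ t in (0:ℝ)..1, -phi ν (0 + 1) t / (t : ℂ), ?_⟩
  refine (tendsto_const_nhds.sub hlim).congr' ?_
  filter_upwards [Ioo_mem_nhdsGT (zero_lt_one (α := ℝ))] with x hx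
  have hsub : Set.uIcc x 1 ⊆ Ioi 0 := by
    rw [Set.uIcc_of_le hx.2.le]
    exact fun y hy => hx.1.trans_le hy.1
  rw [intervalIntegral.integral_eq_sub_of_hasDerivAt (f := phi ν 0)
    (fun y hy => hasDerivAt_phi hν (by omega) (hsub hy))
    ((hcont.mono hsub).intervalIntegrable)]
  ring

end PhiPsi

end GenBessel

end

noncomputable section

namespace GenBessel

/-! ### Hadamard's inequality -/

-- The eigenvalues of A*A have product |det A|² and sum equal to the trace, at most n²; the
-- inequality of the arithmetic and geometric mean does the rest.
open scoped ComplexOrder in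
lemma norm_det_sq_le_of_norm_le_one {n : ℕ} (A : Matrix (Fin n) (Fin n) ℂ)
    (hA : ∀ i j, ‖A i j‖ ≤ 1) : ‖A.det‖ ^ 2 ≤ (n : ℝ) ^ n := by
  rcases Nat.eq_zero_or_pos n with rfl | hn
  · simp
  have hN := Matrix.posSemidef_conjTranspose_mul_self A
  set N := A.conjTranspose * A
  have hH := hN.isHermitian
  have hdet : ((‖A.det‖ ^ 2 : ℝ) : ℂ) = ∏ i, (hH.eigenvalues i : ℂ) := by
    rw [← RCLike.ofReal_eq_complex_ofReal, ← hH.det_eq_prod_eigenvalues, Matrix.det_mul,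
      Matrix.det_conjTranspose]
    have := Complex.normSq_eq_conj_mul_self (z := A.det)
    rw [Complex.normSq_eq_norm_sq] at this
    exact this
  have htr : (∑ i, hH.eigenvalues i : ℝ) ≤ (n : ℝ) ^ 2 := by
    have h1 : ((∑ i, hH.eigenvalues i : ℝ) : ℂ) = ∑ i, ∑ j, ((‖A j i‖ ^ 2 : ℝ) : ℂ) := by
      have h2 := hH.trace_eq_sum_eigenvalues
      push_cast
      refine Eq.trans h2.symm ?_
      rw [Matrix.trace]
      refine Finset.sum_congr rfl fun i _ => ?_
      refine (Matrix.mul_apply (M := A.conjTranspose) (N := A)).trans ?_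
      refine Finset.sum_congr rfl fun j _ => ?_
      have := Complex.normSq_eq_conj_mul_self (z := A j i)
      rw [Complex.normSq_eq_norm_sq] at this
      rw [Matrix.conjTranspose_apply]
      push_cast at this
      exact this.symm
    have h3 : (∑ i, hH.eigenvalues i : ℝ) = ∑ i, ∑ j, ‖A j i‖ ^ 2 := by exact_mod_cast h1
    rw [h3]
    calc _ ≤ ∑ i : Fin n, ∑ j : Fin n, (1 : ℝ) := by
          refine Finset.sum_le_sum fun i _ => Finset.sum_le_sum fun j _ => ?_
          exact pow_le_one₀ (norm_nonneg _) (hA j i)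
      _ = _ := by simp [sq]
  have hdet' : ‖A.det‖ ^ 2 = ∏ i, hH.eigenvalues i := by exact_mod_cast hdet
  have hnn : ∀ i, 0 ≤ hH.eigenvalues i := hN.eigenvalues_nonneg
  have hnpos : (0 : ℝ) < n := by exact_mod_cast hn
  have amgm := Real.geom_mean_le_arith_mean_weighted Finset.univ (fun _ : Fin n => (1 / n : ℝ))
    hH.eigenvalues (fun _ _ => by positivity) (by simp; field_simp) (fun i _ => hnn i)
  rw [Real.finsetProd_rpow _ _ (fun i _ => hnn i), ← hdet', ← Finset.mul_sum] at amgm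
  have h4 : (‖A.det‖ ^ 2) ^ (1 / n : ℝ) ≤ n := by
    refine amgm.trans ?_
    calc _ ≤ (1 / n : ℝ) * (n : ℝ) ^ 2 := by gcongr
      _ = n := by field_simp
  calc ‖A.det‖ ^ 2 = ((‖A.det‖ ^ 2) ^ (1 / n : ℝ)) ^ n := by
        rw [← Real.rpow_natCast _ n, ← Real.rpow_mul (by positivity), one_div,
          inv_mul_cancel₀ hnpos.ne', Real.rpow_one]
    _ ≤ _ := by gcongr

/-- The constant in Hadamard's inequality. -/
def hadamardConst (n : ℕ) : ℝ := Real.sqrt ((n : ℝ) ^ n)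

lemma hadamardConst_nonneg (n : ℕ) : 0 ≤ hadamardConst n := Real.sqrt_nonneg _

/-- Divide row i by a_i and column j by b_j to reach entries of norm at most 1. If one of these
numbers is zero, a whole row or column vanishes. -/
lemma norm_det_le {n : ℕ} (A : Matrix (Fin n) (Fin n) ℂ) {a b : Fin n → ℝ}
    (ha : ∀ i, 0 ≤ a i) (hb : ∀ i, 0 ≤ b i) (hA : ∀ i j, ‖A i j‖ ≤ a i * b j) :
    ‖A.det‖ ≤ hadamardConst n * ((∏ i, a i) * ∏ i, b i) := by
  have hR : 0 ≤ hadamardConst n * ((∏ i, a i) * ∏ i, b i) :=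
    mul_nonneg (hadamardConst_nonneg n) (mul_nonneg (Finset.prod_nonneg fun i _ => ha i)
      (Finset.prod_nonneg fun i _ => hb i))
  by_cases h : (∀ i, a i ≠ 0) ∧ ∀ i, b i ≠ 0
  · obtain ⟨ha', hb'⟩ := h
    have e : A = Matrix.of fun i j => (a i : ℂ) *
        Matrix.of (fun i j => (b j : ℂ) * (A i j / (a i * b j))) i j := by
      ext i j
      have h1 : (a i : ℂ) ≠ 0 := by exact_mod_cast ha' i
      have h2 : (b j : ℂ) ≠ 0 := by exact_mod_cast hb' j
      simp only [Matrix.of_apply]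
      field_simp
    have e₂ := Matrix.det_mul_column (fun i => (a i : ℂ))
      (Matrix.of (fun i j => (b j : ℂ) * (A i j / (a i * b j))))
    have e₃ := Matrix.det_mul_row (fun i => (b i : ℂ))
      (Matrix.of (fun i j => (A i j / (a i * b j))))
    rw [e, e₂]
    simp only [Matrix.of_apply] at e₃
    rw [e₃, norm_mul, norm_mul, norm_prod, norm_prod]
    simp only [Complex.norm_real, Real.norm_of_nonneg (ha _), Real.norm_of_nonneg (hb _)]
    have h1 : ‖(Matrix.of fun i j => A i j / ((a i : ℂ) * b j)).det‖ ≤ hadamardConst n := by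
      refine Real.le_sqrt_of_sq_le (norm_det_sq_le_of_norm_le_one _ fun i j => ?_)
      rw [Matrix.of_apply, norm_div, norm_mul, Complex.norm_real, Complex.norm_real,
        Real.norm_of_nonneg (ha _), Real.norm_of_nonneg (hb _)]
      exact div_le_one_of_le₀ (hA i j) (mul_nonneg (ha i) (hb j))
    have ha2 := Finset.prod_nonneg fun i (_ : i ∈ Finset.univ) => ha i
    have hb2 := Finset.prod_nonneg fun i (_ : i ∈ Finset.univ) => hb i
    calc _ ≤ (∏ i, a i) * ((∏ i, b i) * hadamardConst n) := by gcongr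
      _ = _ := by ring
  · have hz : A.det = 0 := by
      rw [not_and_or] at h
      push Not at h
      rcases h with ⟨i, hi⟩ | ⟨j, hj⟩
      · refine Matrix.det_eq_zero_of_row_eq_zero i fun j => ?_
        have := hA i j
        rw [hi, zero_mul] at this
        simpa using this
      · refine Matrix.det_eq_zero_of_column_eq_zero j fun i => ?_
        have := hA i j
        rw [hj, mul_zero] at this
        simpa using this
    rw [hz, norm_zero]
    exact hR

/-- The terms of the series which dominates the Fredholm minors. -/
def minorBound (W : ℝ) (n : ℕ) : ℝ := hadamardConst (n + 1) * W ^ n / n.factorial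

lemma minorBound_nonneg {W : ℝ} (hW : 0 ≤ W) (n : ℕ) : 0 ≤ minorBound W n := by
  have := hadamardConst_nonneg (n + 1)
  unfold minorBound
  positivity

lemma hadamardConst_mono : Monotone hadamardConst := by
  refine monotone_nat_of_le_succ fun n => Real.sqrt_le_sqrt ?_
  calc (n : ℝ) ^ n ≤ ((n + 1 : ℕ) : ℝ) ^ n := by
        gcongr
        omega
    _ ≤ ((n + 1 : ℕ) : ℝ) ^ (n + 1) := by
        refine pow_le_pow_right₀ ?_ (by omega)
        push_cast
        have : (0 : ℝ) ≤ n := n.cast_nonneg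
        linarith

lemma summable_minorBound {W : ℝ} (hW : 0 ≤ W) : Summable (minorBound W) := by
  -- compare with the square root of the factorial
  set V : ℝ := W + 1 with hV
  -- Enlarging W by one makes the terms nonzero also for W = 0, so that the ratios in the ratio test
  -- are meaningful.
  have hVpos : 0 < V := by linarith
  have hpow : ∀ n : ℕ, (n : ℝ) ^ n ≤ Real.exp 1 ^ n * n.factorial := by
    intro n
    have h := Real.pow_div_factorial_le_exp (n : ℝ) n.cast_nonneg n
    rw [div_le_iff₀ (by positivity)] at h
    rw [← Real.exp_nat_mul, mul_one]
    exact h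
  have hle : ∀ n : ℕ, minorBound W n ≤
      Real.sqrt (Real.exp 1 ^ (n + 1) * (n + 1).factorial) * V ^ n / n.factorial := by
    intro n
    unfold minorBound hadamardConst
    gcongr
    · exact hpow (n + 1)
    · linarith
  refine Summable.of_nonneg_of_le (minorBound_nonneg hW) hle ?_
  refine summable_of_ratio_test_tendsto_lt_one (l := 0) zero_lt_one
    (Eventually.of_forall fun n => by positivity) ?_
  -- The ratio V √(e (n + 2)) / (n + 1), written in terms of 1/(n + 1) so that its limit can be read
  -- off.
  have hratio : ∀ n : ℕ, ‖Real.sqrt (Real.exp 1 ^ (n + 1 + 1) * (n + 1 + 1).factorial) * V ^ (n + 1) /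
      (n + 1).factorial‖ / ‖Real.sqrt (Real.exp 1 ^ (n + 1) * (n + 1).factorial) * V ^ n /
        n.factorial‖ = V * Real.sqrt (Real.exp 1 * ((1 + 1 / ((n : ℝ) + 1)) * (1 / ((n : ℝ) + 1)))) := by
    intro n
    rw [Real.norm_of_nonneg (by positivity), Real.norm_of_nonneg (by positivity)]
    have e1 : Real.exp 1 ^ (n + 1 + 1) * ((n + 1 + 1).factorial : ℝ)
        = (Real.exp 1 ^ (n + 1) * ((n + 1).factorial : ℝ)) * (Real.exp 1 * ((n : ℝ) + 2)) := by
      rw [Nat.factorial_succ (n + 1)]; push_cast; ring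
    have e2 : Real.exp 1 * ((1 + 1 / ((n : ℝ) + 1)) * (1 / ((n : ℝ) + 1)))
        = (Real.exp 1 * ((n : ℝ) + 2)) / ((n : ℝ) + 1) ^ 2 := by
      have : (n : ℝ) + 1 ≠ 0 := by positivity
      field_simp
      ring
    rw [e1, e2, Real.sqrt_mul (by positivity), Real.sqrt_div (by positivity),
      Real.sqrt_sq (by positivity), Nat.factorial_succ n]
    have h1 : Real.sqrt (Real.exp 1 ^ (n + 1) * ((n + 1) * n.factorial : ℕ)) ≠ 0 := by
      have : (0:ℝ) < Real.exp 1 ^ (n + 1) * ((n + 1) * n.factorial : ℕ) := by positivity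
      exact (Real.sqrt_pos.2 this).ne'
    have h2 : (n.factorial : ℝ) ≠ 0 := by positivity
    have h3 : (n : ℝ) + 1 ≠ 0 := by positivity
    push_cast at h1 ⊢
    field_simp
    ring
  simp_rw [hratio]
  have hz : Tendsto (fun n : ℕ => 1 / ((n : ℝ) + 1)) atTop (𝓝 0) :=
    tendsto_one_div_add_atTop_nhds_zero_nat
  have hin : Tendsto (fun n : ℕ => Real.exp 1 * ((1 + 1 / ((n : ℝ) + 1)) * (1 / ((n : ℝ) + 1))))
      atTop (𝓝 (Real.exp 1 * ((1 + 0) * 0))) :=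
    ((tendsto_const_nhds.add hz).mul hz).const_mul _
  have := ((Real.continuous_sqrt.tendsto _).comp hin).const_mul V
  simpa using this

/-! ### Fredholm minors -/

section Fredholm

variable {X : Type*} [MeasurableSpace X]

/-- The matrix of the values `k (p_i) (q_j)`. -/
def kernelMatrix (k : X → X → ℂ) {n : ℕ} (p q : Fin n → X) : Matrix (Fin n) (Fin n) ℂ :=
  Matrix.of fun i j => k (p i) (q j)

/-- The integrated principal minors of order `n`. -/
def fredholmCoeff (k : X → X → ℂ) (μ : Measure X) (n : ℕ) : ℂ :=
  ∫ z, (kernelMatrix k z z).det ∂(Measure.pi fun _ : Fin n => μ)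

/-- The integrated bordered minors of order `n + 1`. -/
def fredholmMinorCoeff (k : X → X → ℂ) (μ : Measure X) (n : ℕ) (x y : X) : ℂ :=
  ∫ z : Fin n → X, (kernelMatrix k (Fin.cons x z : Fin (n + 1) → X)
    (Fin.cons y z : Fin (n + 1) → X)).det ∂(Measure.pi fun _ : Fin n => μ)

/-- The Fredholm determinant. -/
def fredholmSeries (k : X → X → ℂ) (μ : Measure X) : ℂ :=
  ∑' n : ℕ, ((-1) ^ n / (n.factorial : ℂ)) * fredholmCoeff k μ n

/-- The first Fredholm minor. -/
def fredholmMinor (k : X → X → ℂ) (μ : Measure X) (x y : X) : ℂ :=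
  ∑' n : ℕ, ((-1) ^ n / (n.factorial : ℂ)) * fredholmMinorCoeff k μ n x y

/-- A measurable kernel which is dominated by `v x * w y`. -/
structure IsDominated (k : X → X → ℂ) (v w : X → ℝ) : Prop where
  meas : Measurable (Function.uncurry k)
  meas_v : Measurable v
  meas_w : Measurable w
  v_nonneg : ∀ x, 0 ≤ v x
  w_nonneg : ∀ x, 0 ≤ w x
  bound : ∀ x y, ‖k x y‖ ≤ v x * w y

lemma IsDominated.swap {k : X → X → ℂ} {v w : X → ℝ} (h : IsDominated k v w) :
    IsDominated (fun x y => k y x) w v where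
  meas := h.meas.comp measurable_swap
  meas_v := h.meas_w
  meas_w := h.meas_v
  v_nonneg := h.w_nonneg
  w_nonneg := h.v_nonneg
  bound x y := by rw [mul_comm]; exact h.bound y x

variable {k : X → X → ℂ} {v w : X → ℝ} {μ : Measure X} [SigmaFinite μ]

omit [MeasurableSpace X] in
lemma kernelMatrix_swap {n : ℕ} (p q : Fin n → X) :
    kernelMatrix (fun x y => k y x) p q = (kernelMatrix k q p).transpose := rfl

omit [SigmaFinite μ] in
lemma fredholmCoeff_swap (n : ℕ) :
    fredholmCoeff (fun x y => k y x) μ n = fredholmCoeff k μ n := by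
  simp only [fredholmCoeff, kernelMatrix_swap, Matrix.det_transpose]

omit [SigmaFinite μ] in
lemma fredholmMinorCoeff_swap (n : ℕ) (x y : X) :
    fredholmMinorCoeff (fun x y => k y x) μ n x y = fredholmMinorCoeff k μ n y x := by
  simp only [fredholmMinorCoeff, kernelMatrix_swap, Matrix.det_transpose]

namespace IsDominated

variable (hk : IsDominated k v w)

include hk

lemma norm_det_kernelMatrix_le {n : ℕ} (p q : Fin n → X) :
    ‖(kernelMatrix k p q).det‖ ≤ hadamardConst n * ((∏ i, v (p i)) * ∏ i, w (q i)) :=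
  norm_det_le _ (fun _ => hk.v_nonneg _) (fun _ => hk.w_nonneg _) fun _ _ => hk.bound _ _

lemma measurable_det {Y : Type*} [MeasurableSpace Y] {n : ℕ} {p q : Y → Fin n → X}
    (hp : Measurable p) (hq : Measurable q) :
    Measurable fun y => (kernelMatrix k (p y) (q y)).det := by
  simp only [Matrix.det_apply]
  refine Finset.measurable_sum _ fun σ _ => Measurable.const_smul
    (Finset.measurable_prod _ fun i _ => ?_) _
  exact hk.meas.comp (((measurable_pi_apply _).comp hp).prodMk ((measurable_pi_apply _).comp hq))

omit hk in
lemma measurable_cons {Y : Type*} [MeasurableSpace Y] {n : ℕ} {p : Y → X} {q : Y → Fin n → X}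
    (hp : Measurable p) (hq : Measurable q) :
    Measurable fun y => (Fin.cons (p y) (q y) : Fin (n + 1) → X) := by
  rw [measurable_pi_iff]
  intro i
  refine Fin.cases ?_ (fun i => ?_) i
  · simpa using hp
  · simpa [Function.comp_def] using (measurable_pi_apply i).comp hq

variable (hvw : Integrable (fun x => v x * w x) μ)

include hvw

lemma norm_bordered_le {n : ℕ} (x y : X) (z : Fin n → X) :
    ‖(kernelMatrix k (Fin.cons x z : Fin (n + 1) → X) (Fin.cons y z : Fin (n + 1) → X)).det‖
      ≤ hadamardConst (n + 1) * (v x * w y) * ∏ i, v (z i) * w (z i) := by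
  refine (hk.norm_det_kernelMatrix_le _ _).trans (le_of_eq ?_)
  simp only [Fin.prod_univ_succ, Fin.cons_zero, Fin.cons_succ, Finset.prod_mul_distrib]
  ring

lemma integrable_prod_weights (n : ℕ) :
    Integrable (fun z : Fin n → X => ∏ i, v (z i) * w (z i)) (Measure.pi fun _ : Fin n => μ) :=
  Integrable.fintype_prod (μ := fun _ : Fin n => μ) (f := fun _ x => v x * w x) fun _ => hvw

lemma integrable_coeff (n : ℕ) :
    Integrable (fun z : Fin n → X => (kernelMatrix k z z).det)
      (Measure.pi fun _ : Fin n => μ) := by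
  refine ((hk.integrable_prod_weights hvw n).const_mul (hadamardConst n)).mono'
    (hk.measurable_det measurable_id measurable_id).aestronglyMeasurable
    (Eventually.of_forall fun z => ?_)
  rw [Finset.prod_mul_distrib]
  exact hk.norm_det_kernelMatrix_le z z

lemma integral_prod_weights (n : ℕ) :
    ∫ z : Fin n → X, ∏ i, v (z i) * w (z i) ∂(Measure.pi fun _ : Fin n => μ)
      = (∫ x, v x * w x ∂μ) ^ n := by
  have := integral_fintype_prod_eq_pow (ι := Fin n) (fun x => v x * w x) (μ := μ)
  simpa using this

lemma norm_fredholmCoeff_le (n : ℕ) :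
    ‖fredholmCoeff k μ n‖ ≤ hadamardConst n * (∫ x, v x * w x ∂μ) ^ n := by
  rw [← hk.integral_prod_weights hvw, ← integral_const_mul]
  refine norm_integral_le_of_norm_le ((hk.integrable_prod_weights hvw n).const_mul _)
    (Eventually.of_forall fun z => ?_)
  rw [Finset.prod_mul_distrib]
  exact hk.norm_det_kernelMatrix_le z z

lemma norm_fredholmMinorCoeff_le (n : ℕ) (x y : X) :
    ‖fredholmMinorCoeff k μ n x y‖ ≤
      hadamardConst (n + 1) * (v x * w y) * (∫ x, v x * w x ∂μ) ^ n := by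
  rw [← hk.integral_prod_weights hvw, ← integral_const_mul]
  exact norm_integral_le_of_norm_le ((hk.integrable_prod_weights hvw n).const_mul _)
    (Eventually.of_forall fun z => hk.norm_bordered_le hvw x y z)

lemma measurable_fredholmMinorCoeff (n : ℕ) :
    Measurable fun p : X × X => fredholmMinorCoeff k μ n p.1 p.2 := by
  have h : StronglyMeasurable fun q : (X × X) × (Fin n → X) =>
      (kernelMatrix k (Fin.cons q.1.1 q.2 : Fin (n + 1) → X)
        (Fin.cons q.1.2 q.2 : Fin (n + 1) → X)).det :=
    (hk.measurable_det (measurable_cons (by fun_prop) (by fun_prop))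
      (measurable_cons (by fun_prop) (by fun_prop))).stronglyMeasurable
  exact (h.integral_prod_right' (ν := Measure.pi fun _ : Fin n => μ)).measurable

-- Bringing row i to the front is a cycle of sign (-1)^i.
omit hk hvw [MeasurableSpace X] in
lemma det_insertNth {n : ℕ} (i : Fin (n + 1)) (ζ : X) (z : Fin n → X) (q : Fin (n + 1) → X) :
    (kernelMatrix k (i.insertNth (α := fun _ => X) ζ z) q).det
      = (-1) ^ (i : ℕ) * (kernelMatrix k (Fin.cons ζ z : Fin (n + 1) → X) q).det := by
  have h := Matrix.det_permute (Fin.cycleRange i)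
    (kernelMatrix k (Fin.cons ζ z : Fin (n + 1) → X) q)
  rw [Fin.sign_cycleRange] at h
  push_cast at h
  rw [← h]
  congr 1
  ext a b
  simp only [Matrix.submatrix_apply, kernelMatrix, Matrix.of_apply, id, Fin.cons_apply_cycleRange]

lemma integrable_border_term {n : ℕ} (x y : X) :
    Integrable (fun p : X × (Fin n → X) => k x p.1 *
      (kernelMatrix k (Fin.cons p.1 p.2 : Fin (n + 1) → X) (Fin.cons y p.2 : Fin (n + 1) → X)).det)
      (μ.prod (Measure.pi fun _ : Fin n => μ)) := by
  have hb := (hvw.mul_prod (hk.integrable_prod_weights hvw n)).const_mul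
    (hadamardConst (n + 1) * v x * w y)
  refine hb.mono' ?_ (Eventually.of_forall fun p => ?_)
  · exact (Measurable.mul (hk.meas.comp (measurable_const.prodMk measurable_fst))
      (hk.measurable_det (measurable_cons measurable_fst measurable_snd)
        (measurable_cons measurable_const measurable_snd))).aestronglyMeasurable
  · rw [norm_mul]
    have h1 := hk.norm_bordered_le hvw p.1 y p.2
    have h2 := hk.bound x p.1
    have h3 : 0 ≤ v x * w p.1 := mul_nonneg (hk.v_nonneg _) (hk.w_nonneg _)
    calc _ ≤ (v x * w p.1) * (hadamardConst (n + 1) * (v p.1 * w y) * ∏ i, v (p.2 i) * w (p.2 i)) :=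
          mul_le_mul h2 h1 (norm_nonneg _) h3
      _ = _ := by ring

/-- Expand along the row of x. The first column gives k(x,y) times a principal minor. In the column
of z_i, moving the row of z_i to the front turns the cofactor sign (-1)^(i+1) into -1, and by
symmetry the n + 1 resulting terms have the same integral. -/
lemma fredholmMinorCoeff_succ (n : ℕ) (x y : X) :
    fredholmMinorCoeff k μ (n + 1) x y = fredholmCoeff k μ (n + 1) * k x y
      - (n + 1) * ∫ z, k x z * fredholmMinorCoeff k μ n z y ∂μ := by
  have hexp : ∀ z : Fin (n + 1) → X, (kernelMatrix k (Fin.cons x z : Fin (n + 1 + 1) → X)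
      (Fin.cons y z : Fin (n + 1 + 1) → X)).det = (kernelMatrix k z z).det * k x y
        - ∑ i : Fin (n + 1), k x (z i) * (kernelMatrix k (Fin.cons (z i) (i.removeNth z) :
          Fin (n + 1) → X) (Fin.cons y (i.removeNth z) : Fin (n + 1) → X)).det := by
    intro z
    rw [Matrix.det_succ_row_zero, Fin.sum_univ_succ, sub_eq_add_neg, ← Finset.sum_neg_distrib]
    congr 1
    · have e : (kernelMatrix k (Fin.cons x z : Fin (n + 1 + 1) → X)
          (Fin.cons y z : Fin (n + 1 + 1) → X)).submatrix Fin.succ (Fin.succAbove 0)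
            = kernelMatrix k z z := by
        ext a b
        simp [kernelMatrix]
      rw [e]
      simp [kernelMatrix]
      ring
    · refine Finset.sum_congr rfl fun i _ => ?_
      have e : (kernelMatrix k (Fin.cons x z : Fin (n + 1 + 1) → X)
          (Fin.cons y z : Fin (n + 1 + 1) → X)).submatrix Fin.succ (Fin.succAbove i.succ)
            = kernelMatrix k (i.insertNth (α := fun _ => X) (z i) (i.removeNth z))
              (Fin.cons y (i.removeNth z) : Fin (n + 1) → X) := by
        rw [Fin.insertNth_self_removeNth]
        ext a b
        refine Fin.cases ?_ (fun b => ?_) b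
        · simp [kernelMatrix]
        · simp [kernelMatrix, Fin.removeNth]
      rw [e, det_insertNth]
      have hs : ((-1 : ℂ) ^ (i : ℕ)) * (-1) ^ (i : ℕ) = 1 := by rw [← mul_pow]; simp
      simp only [kernelMatrix, Matrix.of_apply, Fin.cons_zero, Fin.cons_succ, Fin.val_succ,
        pow_succ]
      linear_combination (-k x (z i) * (Matrix.of fun a b => k ((Fin.cons (z i) (i.removeNth z) :
        Fin (n + 1) → X) a) ((Fin.cons y (i.removeNth z) : Fin (n + 1) → X) b)).det) * hs
  have hterm : ∀ i : Fin (n + 1),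
      Integrable (fun z : Fin (n + 1) → X => k x (z i) * (kernelMatrix k
        (Fin.cons (z i) (i.removeNth z) : Fin (n + 1) → X)
        (Fin.cons y (i.removeNth z) : Fin (n + 1) → X)).det) (Measure.pi fun _ => μ) ∧
      ∫ z : Fin (n + 1) → X, k x (z i) * (kernelMatrix k
        (Fin.cons (z i) (i.removeNth z) : Fin (n + 1) → X)
        (Fin.cons y (i.removeNth z) : Fin (n + 1) → X)).det ∂(Measure.pi fun _ => μ)
        = ∫ z, k x z * fredholmMinorCoeff k μ n z y ∂μ := by
    intro i
    -- Splitting off the coordinate z_i preserves the product measure, so the integral no longer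
    -- depends on i.
    have hmp := measurePreserving_piFinSuccAbove (fun _ : Fin (n + 1) => μ) i
    have hint := hk.integrable_border_term hvw (n := n) x y
    have h1 := (hmp.integrable_comp_emb (MeasurableEquiv.measurableEmbedding _)).2 hint
    have h2 := hmp.integral_comp' (g := fun p : X × (Fin n → X) => k x p.1 *
      (kernelMatrix k (Fin.cons p.1 p.2 : Fin (n + 1) → X) (Fin.cons y p.2 : Fin (n + 1) → X)).det)
    refine ⟨h1, h2.trans ?_⟩
    rw [integral_prod _ hint]
    simp only [integral_const_mul]
    rfl
  rw [fredholmMinorCoeff]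
  simp_rw [hexp]
  rw [integral_sub ((hk.integrable_coeff hvw _).mul_const _)
    (integrable_finsetSum _ fun i _ => (hterm i).1), integral_mul_const,
    integral_finsetSum _ fun i _ => (hterm i).1]
  simp only [(hterm _).2]
  simp [fredholmCoeff]

lemma norm_term_le (n : ℕ) (x y : X) :
    ‖((-1) ^ n / (n.factorial : ℂ)) * fredholmMinorCoeff k μ n x y‖
      ≤ minorBound (∫ x, v x * w x ∂μ) n * (v x * w y) := by
  rw [norm_mul, norm_div, norm_pow, norm_neg, norm_one, one_pow, Complex.norm_natCast]
  have h := hk.norm_fredholmMinorCoeff_le hvw n x y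
  unfold minorBound
  calc _ ≤ 1 / (n.factorial : ℝ) *
        (hadamardConst (n + 1) * (v x * w y) * (∫ x, v x * w x ∂μ) ^ n) := by gcongr
    _ = _ := by ring

lemma integral_weights_nonneg : 0 ≤ ∫ x, v x * w x ∂μ :=
  integral_nonneg fun x => mul_nonneg (hk.v_nonneg x) (hk.w_nonneg x)

lemma norm_coeff_term_le (n : ℕ) :
    ‖((-1) ^ n / (n.factorial : ℂ)) * fredholmCoeff k μ n‖ ≤ minorBound (∫ x, v x * w x ∂μ) n := by
  rw [norm_mul, norm_div, norm_pow, norm_neg, norm_one, one_pow, Complex.norm_natCast]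
  have h := hk.norm_fredholmCoeff_le hvw n
  have h0 := hk.integral_weights_nonneg hvw
  have h1 := hadamardConst_mono (Nat.le_succ n)
  unfold minorBound
  calc _ ≤ 1 / (n.factorial : ℝ) * (hadamardConst (n + 1) * (∫ x, v x * w x ∂μ) ^ n) := by
        gcongr
        exact h.trans (by gcongr)
    _ = _ := by ring

lemma summable_coeff_term :
    Summable fun n => ((-1) ^ n / (n.factorial : ℂ)) * fredholmCoeff k μ n :=
  Summable.of_norm_bounded (summable_minorBound (hk.integral_weights_nonneg hvw))
    (hk.norm_coeff_term_le hvw)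

lemma summable_term (x y : X) :
    Summable fun n => ((-1) ^ n / (n.factorial : ℂ)) * fredholmMinorCoeff k μ n x y :=
  Summable.of_norm_bounded ((summable_minorBound (hk.integral_weights_nonneg hvw)).mul_right _)
    fun n => hk.norm_term_le hvw n x y

lemma norm_fredholmMinor_le (x y : X) :
    ‖fredholmMinor k μ x y‖ ≤ (∑' n, minorBound (∫ x, v x * w x ∂μ) n) * (v x * w y) := by
  rw [← tsum_mul_right]
  exact tsum_of_norm_bounded
    ((summable_minorBound (hk.integral_weights_nonneg hvw)).mul_right _).hasSum
    fun n => hk.norm_term_le hvw n x y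

lemma measurable_fredholmMinor :
    Measurable fun p : X × X => fredholmMinor k μ p.1 p.2 := by
  refine measurable_of_tendsto_metrizable (f := fun N (p : X × X) => ∑ n ∈ Finset.range N,
    ((-1) ^ n / (n.factorial : ℂ)) * fredholmMinorCoeff k μ n p.1 p.2) (fun N => ?_) ?_
  · exact Finset.measurable_sum _ fun n _ =>
      (hk.measurable_fredholmMinorCoeff hvw n).const_mul _
  · rw [tendsto_pi_nhds]
    exact fun p => (hk.summable_term hvw p.1 p.2).hasSum.tendsto_sum_nat

/-- Sum the recursion for the bordered minors with the weights (-1)^n/n!: the factor n + 1 turns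
1/(n + 1)! into 1/n!, so the last terms reassemble to the minor under the integral. This is the
resolvent equation before division by the determinant. -/
lemma fredholmMinor_eq (x y : X) :
    fredholmMinor k μ x y = fredholmSeries k μ * k x y + ∫ z, k x z * fredholmMinor k μ z y ∂μ := by
  have hW := hk.integral_weights_nonneg hvw
  have hbd : ∀ n z, ‖k x z * (((-1) ^ n / (n.factorial : ℂ)) * fredholmMinorCoeff k μ n z y)‖
      ≤ minorBound (∫ x, v x * w x ∂μ) n * (v x * w y) * (v z * w z) := by
    intro n z
    rw [norm_mul]
    calc _ ≤ (v x * w z) * (minorBound (∫ x, v x * w x ∂μ) n * (v z * w y)) :=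
          mul_le_mul (hk.bound x z) (hk.norm_term_le hvw n z y) (norm_nonneg _)
            (mul_nonneg (hk.v_nonneg _) (hk.w_nonneg _))
      _ = _ := by ring
  have hmeas : ∀ n, AEStronglyMeasurable (fun z => k x z *
      (((-1) ^ n / (n.factorial : ℂ)) * fredholmMinorCoeff k μ n z y)) μ := fun n =>
    ((hk.meas.comp (by fun_prop : Measurable fun z => (x, z))).mul
      (((hk.measurable_fredholmMinorCoeff hvw n).comp
        (by fun_prop : Measurable fun z => (z, y))).const_mul _)).aestronglyMeasurable
  have hint : ∀ n, Integrable (fun z => k x z *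
      (((-1) ^ n / (n.factorial : ℂ)) * fredholmMinorCoeff k μ n z y)) μ := fun n =>
    (hvw.const_mul _).mono' (hmeas n) (Eventually.of_forall (hbd n))
  -- Sum and integral are exchanged because the integrated norms are dominated by `minorBound`.
  have hsum := hasSum_integral_of_summable_integral_norm hint (by
    refine Summable.of_nonneg_of_le (fun n => integral_nonneg fun z => norm_nonneg _) (fun n => ?_)
      (((summable_minorBound hW).mul_right (v x * w y)).mul_right (∫ x, v x * w x ∂μ))
    rw [← integral_const_mul]
    exact integral_mono (hint n).norm (hvw.const_mul _) (hbd n))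
  simp only [tsum_mul_left] at hsum
  have h1 := (hk.summable_term hvw x y).hasSum
  rw [← hasSum_nat_add_iff' 1] at h1
  have h2 := (hk.summable_coeff_term hvw).hasSum
  rw [← hasSum_nat_add_iff' 1] at h2
  have h3 := (h2.mul_right (k x y)).add hsum
  have hterm : ∀ n : ℕ, ((-1) ^ (n + 1) / ((n + 1).factorial : ℂ)) *
      fredholmMinorCoeff k μ (n + 1) x y
      = ((-1) ^ (n + 1) / ((n + 1).factorial : ℂ)) * fredholmCoeff k μ (n + 1) * k x y
        + ∫ z, k x z * (((-1) ^ n / (n.factorial : ℂ)) * fredholmMinorCoeff k μ n z y) ∂μ := by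
    intro n
    have e : ∀ z, k x z * (((-1) ^ n / (n.factorial : ℂ)) * fredholmMinorCoeff k μ n z y)
        = ((-1) ^ n / (n.factorial : ℂ)) * (k x z * fredholmMinorCoeff k μ n z y) := fun z => by ring
    simp_rw [e]
    rw [integral_const_mul, hk.fredholmMinorCoeff_succ hvw, Nat.factorial_succ]
    have hf : (n.factorial : ℂ) ≠ 0 := by exact_mod_cast n.factorial_ne_zero
    have hn : (n : ℂ) + 1 ≠ 0 := by exact_mod_cast n.succ_ne_zero
    push_cast
    field_simp
    ring
  simp_rw [hterm] at h1
  have h4 := h1.unique h3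
  have h00 : fredholmMinorCoeff k μ 0 x y = k x y := by
    simp [fredholmMinorCoeff, kernelMatrix, measureReal_def]
  have h01 : fredholmCoeff k μ 0 = 1 := by
    simp [fredholmCoeff, measureReal_def]
  simp only [Finset.sum_range_one, pow_zero, Nat.factorial_zero, Nat.cast_one, div_one, one_mul,
    h00, h01] at h4
  simp only [fredholmMinor, fredholmSeries]
  linear_combination h4

end IsDominated

/-- `R` is the resolvent kernel of `k`, with the bound `C * (v x * w y)`. -/
structure IsResolventKernel (k : X → X → ℂ) (v w : X → ℝ) (μ : Measure X) (C : ℝ)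
    (R : X → X → ℂ) : Prop where
  meas : Measurable (Function.uncurry R)
  nonneg : 0 ≤ C
  bound : ∀ x y, ‖R x y‖ ≤ C * (v x * w y)
  eq_left : ∀ x y, R x y = k x y + ∫ z, k x z * R z y ∂μ
  eq_right : ∀ x y, R x y = k x y + ∫ z, R x z * k z y ∂μ

omit [SigmaFinite μ] in
lemma IsResolventKernel.swap {C : ℝ} {R : X → X → ℂ} (h : IsResolventKernel k v w μ C R) :
    IsResolventKernel (fun x y => k y x) w v μ C (fun x y => R y x) where
  meas := h.meas.comp measurable_swap
  nonneg := h.nonneg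
  bound x y := by rw [mul_comm (w x)]; exact h.bound y x
  eq_left x y := by simp only [mul_comm (k _ x)]; exact h.eq_right y x
  eq_right x y := by simp only [mul_comm _ (k y _)]; exact h.eq_left y x

lemma IsDominated.isResolventKernel (hk : IsDominated k v w)
    (hvw : Integrable (fun x => v x * w x) μ) (hD : fredholmSeries k μ ≠ 0) :
    IsResolventKernel k v w μ
      ((∑' n, minorBound (∫ x, v x * w x ∂μ) n) / ‖fredholmSeries k μ‖)
      (fun x y => fredholmMinor k μ x y / fredholmSeries k μ) where
  meas := (hk.measurable_fredholmMinor hvw).div_const _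
  nonneg := div_nonneg (tsum_nonneg fun n => minorBound_nonneg (hk.integral_weights_nonneg hvw) n)
    (norm_nonneg _)
  bound x y := by
    rw [norm_div, div_mul_eq_mul_div]
    gcongr
    exact hk.norm_fredholmMinor_le hvw x y
  eq_left x y := by
    rw [hk.fredholmMinor_eq hvw]
    simp only [mul_div_assoc', integral_div]
    field_simp
  eq_right x y := by
    -- The right resolvent equation is the left one for the transposed kernel, which has the same
    -- determinant and the transposed minor.
    have h := hk.swap.fredholmMinor_eq (μ := μ) (by simpa only [mul_comm] using hvw) y x
    have e1 : ∀ x y, fredholmMinor (fun x y => k y x) μ x y = fredholmMinor k μ y x := fun x y => by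
      simp only [fredholmMinor, fredholmMinorCoeff_swap]
    have e2 : fredholmSeries (fun x y => k y x) μ = fredholmSeries k μ := by
      simp only [fredholmSeries, fredholmCoeff_swap]
    simp only [e1, e2] at h
    rw [h]
    simp only [div_mul_eq_mul_div, integral_div, mul_comm (fredholmMinor k μ x _)]
    field_simp

/-- The Fredholm determinant depends continuously on the domain. -/
lemma IsDominated.tendsto_fredholmSeries (hk : IsDominated k v w)
    (hvw : Integrable (fun x => v x * w x) μ) {ι : Type*} {l : Filter ι} [l.IsCountablyGenerated]
    {S : ι → Set X} {S₀ : Set X} (hS : ∀ i, MeasurableSet (S i)) (hS₀ : MeasurableSet S₀)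
    (hlim : ∀ᵐ x ∂μ, ∀ᶠ i in l, (x ∈ S i ↔ x ∈ S₀)) :
    Tendsto (fun i => fredholmSeries k (μ.restrict (S i))) l
      (𝓝 (fredholmSeries k (μ.restrict S₀))) := by
  have hW := hk.integral_weights_nonneg hvw
  have hset : ∀ (T : Set X), MeasurableSet T → ∀ n, fredholmCoeff k (μ.restrict T) n =
      ∫ z, (Set.univ.pi fun _ : Fin n => T).indicator (fun z => (kernelMatrix k z z).det) z
        ∂(Measure.pi fun _ : Fin n => μ) := by
    intro T hT n
    rw [integral_indicator (MeasurableSet.univ_pi fun _ => hT), Measure.restrict_pi_pi]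
    rfl
  -- Dominated convergence is used twice: for the series, with the total weight on the whole space
  -- as majorant, and in each coefficient for the indicator of the product set.
  refine tendsto_tsum_of_dominated_convergence (summable_minorBound hW) (fun n => ?_) ?_
  · refine Tendsto.const_mul _ ?_
    simp only [hset _ (hS _), hset _ hS₀]
    refine tendsto_integral_filter_of_dominated_convergence
      (fun z => ‖(kernelMatrix k z z).det‖) ?_ ?_ (hk.integrable_coeff hvw n).norm ?_
    · exact Eventually.of_forall fun i => ((hk.measurable_det measurable_id measurable_id).indicator
        (MeasurableSet.univ_pi fun _ => hS i)).aestronglyMeasurable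
    · exact Eventually.of_forall fun i => Eventually.of_forall fun z =>
        norm_indicator_le_norm_self _ _
    · have hae : ∀ᵐ z ∂(Measure.pi fun _ : Fin n => μ), ∀ j, ∀ᶠ i in l, (z j ∈ S i ↔ z j ∈ S₀) := by
        rw [ae_all_iff]
        intro j
        exact (Measure.tendsto_eval_ae_ae (μ := fun _ : Fin n => μ) (i := j)).eventually hlim
      filter_upwards [hae] with z hz
      refine Tendsto.congr' ?_ tendsto_const_nhds
      filter_upwards [eventually_all.2 hz] with i hi
      have : z ∈ (Set.univ.pi fun _ : Fin n => S i) ↔ z ∈ (Set.univ.pi fun _ : Fin n => S₀) := by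
        simp only [Set.mem_univ_pi, hi]
      by_cases hz' : z ∈ (Set.univ.pi fun _ : Fin n => S₀)
      · rw [indicator_of_mem hz', indicator_of_mem (this.2 hz')]
      · rw [indicator_of_notMem hz', indicator_of_notMem (mt this.1 hz')]
  · refine Eventually.of_forall fun i n => (hk.norm_coeff_term_le (hvw.restrict) n).trans ?_
    unfold minorBound
    have h1 := hk.integral_weights_nonneg (hvw.restrict (s := S i))
    have h2 : ∫ x in S i, v x * w x ∂μ ≤ ∫ x, v x * w x ∂μ :=
      setIntegral_le_integral hvw
        (Eventually.of_forall fun x => mul_nonneg (hk.v_nonneg x) (hk.w_nonneg x))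
    have h3 := hadamardConst_nonneg (n + 1)
    gcongr

end Fredholm

end GenBessel

end

noncomputable section

namespace GenBessel

/-! ### Integral operators with dominated kernels -/

section Operators

variable {k R : ℝ → ℝ → ℂ} {v w v' w' : ℝ → ℝ} {μ μ₁ μ₂ : Measure ℝ} [SFinite μ] [SFinite μ₁]
  [SFinite μ₂] {h u : ℝ → ℂ} {C : ℝ}

lemma IsResolventKernel.isDominated (hk : IsDominated k v w)
    (hR : IsResolventKernel k v w μ C R) : IsDominated R (fun x => C * v x) w where
  meas := hR.meas
  meas_v := hk.meas_v.const_mul C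
  meas_w := hk.meas_w
  v_nonneg x := mul_nonneg hR.nonneg (hk.v_nonneg x)
  w_nonneg := hk.w_nonneg
  bound x y := by rw [mul_assoc]; exact hR.bound x y

lemma IsDominated.measurable_right (hk : IsDominated k v w) (x : ℝ) : Measurable fun y => k x y :=
  hk.meas.comp (measurable_const.prodMk measurable_id)

lemma IsDominated.measurable_left (hk : IsDominated k v w) (y : ℝ) : Measurable fun x => k x y :=
  hk.meas.comp (measurable_id.prodMk measurable_const)

lemma IsDominated.memLp_left (hk : IsDominated k v w) (hv : MemLp v 2 μ) (y : ℝ) :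
    MemLp (fun x => k x y) 2 μ := by
  refine MemLp.of_le (hv.const_mul (w y)) (hk.measurable_left y).aestronglyMeasurable
    (Eventually.of_forall fun x => ?_)
  rw [Real.norm_of_nonneg (mul_nonneg (hk.w_nonneg y) (hk.v_nonneg x)), mul_comm]
  exact hk.bound x y

lemma IsDominated.integrable_mul (hk : IsDominated k v w)
    (hh : AEStronglyMeasurable h μ) (hwh : Integrable (fun y => w y * ‖h y‖) μ) (x : ℝ) :
    Integrable (fun y => k x y * h y) μ := by
  refine (hwh.const_mul (v x)).mono' ((hk.measurable_right x).aestronglyMeasurable.mul hh)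
    (Eventually.of_forall fun y => ?_)
  rw [norm_mul, ← mul_assoc]
  gcongr
  exact hk.bound x y

lemma IsDominated.norm_integral_le (hk : IsDominated k v w)
    (hwh : Integrable (fun y => w y * ‖h y‖) μ) (x : ℝ) :
    ‖∫ y, k x y * h y ∂μ‖ ≤ v x * ∫ y, w y * ‖h y‖ ∂μ := by
  rw [← integral_const_mul]
  refine norm_integral_le_of_norm_le (hwh.const_mul (v x)) (Eventually.of_forall fun y => ?_)
  rw [norm_mul, ← mul_assoc]
  gcongr
  exact hk.bound x y

lemma integrable_mul_norm (hw : MemLp w 2 μ) (hh : MemLp h 2 μ) :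
    Integrable (fun y => w y * ‖h y‖) μ := hw.integrable_mul hh.norm

lemma IsDominated.aestronglyMeasurable_integral (hk : IsDominated k v w)
    (hh : AEStronglyMeasurable h μ₂) : AEStronglyMeasurable (fun x => ∫ y, k x y * h y ∂μ₂) μ := by
  obtain ⟨h', hm, he⟩ := hh
  have e : (fun x => ∫ y, k x y * h y ∂μ₂) = fun x => ∫ y, k x y * h' y ∂μ₂ := by
    funext x
    refine integral_congr_ae ?_
    filter_upwards [he] with y hy
    rw [hy]
  rw [e]
  have : StronglyMeasurable fun p : ℝ × ℝ => k p.1 p.2 * h' p.2 :=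
    (hk.meas.mul (hm.measurable.comp measurable_snd)).stronglyMeasurable
  exact (this.integral_prod_right' (ν := μ₂)).aestronglyMeasurable

lemma IsDominated.memLp_integral (hk : IsDominated k v w) (hv : MemLp v 2 μ)
    (hh : AEStronglyMeasurable h μ₂) (hwh : Integrable (fun y => w y * ‖h y‖) μ₂) :
    MemLp (fun x => ∫ y, k x y * h y ∂μ₂) 2 μ := by
  refine MemLp.of_le (hv.mul_const (∫ y, w y * ‖h y‖ ∂μ₂)) (hk.aestronglyMeasurable_integral hh)
    (Eventually.of_forall fun x => ?_)
  refine (hk.norm_integral_le hwh x).trans (le_abs_self _)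

/-- Fubini's theorem for products of kernels. -/
lemma IsDominated.integral_comp (hk : IsDominated k v w) (hR : IsDominated R v' w')
    (hwv : Integrable (fun z => w z * v' z) μ₁) (hh : AEStronglyMeasurable h μ₂)
    (hwh : Integrable (fun y => w' y * ‖h y‖) μ₂) (x : ℝ) :
    ∫ z, k x z * (∫ y, R z y * h y ∂μ₂) ∂μ₁ = ∫ y, (∫ z, k x z * R z y ∂μ₁) * h y ∂μ₂ := by
  have hint : Integrable (fun p : ℝ × ℝ => k x p.1 * (R p.1 p.2 * h p.2)) (μ₁.prod μ₂) := by
    refine ((hwv.mul_prod hwh).const_mul (v x)).mono' ?_ (Eventually.of_forall fun p => ?_)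
    · exact ((hk.measurable_right x).comp measurable_fst).aestronglyMeasurable.mul
        (hR.meas.aestronglyMeasurable.mul hh.comp_snd)
    · rw [norm_mul, norm_mul]
      calc _ ≤ (v x * w p.1) * ((v' p.1 * w' p.2) * ‖h p.2‖) := by
            refine mul_le_mul (hk.bound _ _) (mul_le_mul_of_nonneg_right (hR.bound _ _)
              (norm_nonneg _)) (by positivity) (mul_nonneg (hk.v_nonneg _) (hk.w_nonneg _))
        _ = _ := by ring
  have h1 := integral_integral_swap (f := fun z y => k x z * (R z y * h y)) hint
  simp only [← integral_const_mul, ← integral_mul_const]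
  rw [h1]
  refine integral_congr_ae (Eventually.of_forall fun y => ?_)
  refine integral_congr_ae (Eventually.of_forall fun z => ?_)
  simp only [mul_assoc]

/-- The function `(1 + R) h`. -/
def resolve (R : ℝ → ℝ → ℂ) (μ : Measure ℝ) (h : ℝ → ℂ) (x : ℝ) : ℂ := h x + ∫ y, R x y * h y ∂μ

variable (hk : IsDominated k v w) (hR : IsResolventKernel k v w μ C R) (hv : MemLp v 2 μ)
  (hw : MemLp w 2 μ)

include hk hR hv hw

lemma memLp_resolve (hh : MemLp h 2 μ) : MemLp (resolve R μ h) 2 μ :=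
  hh.add ((hR.isDominated hk).memLp_integral (hv.const_mul C) hh.aestronglyMeasurable
    (integrable_mul_norm hw hh))

lemma norm_resolve_le {B : ℝ} (hh : MemLp h 2 μ) (hB : ∀ x, ‖h x‖ ≤ B * v x) (x : ℝ) :
    ‖resolve R μ h x‖ ≤ (B + C * ∫ y, w y * ‖h y‖ ∂μ) * v x := by
  have := (hR.isDominated hk).norm_integral_le (integrable_mul_norm hw hh) x
  refine (norm_add_le _ _).trans ?_
  have := hB x
  nlinarith

/-- `(1 + R) h` solves the equation `u - k u = h`. -/
lemma resolve_sub (hh : MemLp h 2 μ) (x : ℝ) :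
    resolve R μ h x - ∫ y, k x y * resolve R μ h y ∂μ = h x := by
  have hRd := hR.isDominated hk
  have hwh := integrable_mul_norm hw hh
  have hRh : MemLp (fun x => ∫ y, R x y * h y ∂μ) 2 μ :=
    hRd.memLp_integral (hv.const_mul C) hh.aestronglyMeasurable hwh
  have h1 : ∫ y, k x y * resolve R μ h y ∂μ
      = ∫ y, k x y * h y ∂μ + ∫ y, k x y * ∫ z, R y z * h z ∂μ ∂μ := by
    simp only [resolve, mul_add]
    exact integral_add (hk.integrable_mul hh.aestronglyMeasurable hwh x)
      (hk.integrable_mul hRh.aestronglyMeasurable (integrable_mul_norm hw hRh) x)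
  have h2 := hk.integral_comp hRd (hw.integrable_mul (hv.const_mul C)) hh.aestronglyMeasurable
    hwh x
  -- After Fubini, k R = R - k cancels everything but h.
  have h3 : ∀ y, ∫ z, k x z * R z y ∂μ = R x y - k x y := fun y => by
    rw [hR.eq_left x y]; ring
  simp only [h3, sub_mul] at h2
  rw [integral_sub (hRd.integrable_mul hh.aestronglyMeasurable hwh x)
    (hk.integrable_mul hh.aestronglyMeasurable hwh x)] at h2
  rw [h1, h2, resolve]
  ring

/-- Every square integrable solution of `u - k u = h` is `(1 + R) h`. -/
lemma eq_resolve {T : Set ℝ} (hT : ∀ᵐ x ∂μ, x ∈ T) (hu : MemLp u 2 μ)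
    (heq : ∀ x ∈ T, u x - ∫ y, k x y * u y ∂μ = h x) : ∀ x ∈ T, u x = resolve R μ h x := by
  intro x hx
  have hRd := hR.isDominated hk
  have hwu := integrable_mul_norm hw hu
  have hku : MemLp (fun x => ∫ y, k x y * u y ∂μ) 2 μ :=
    hk.memLp_integral hv hu.aestronglyMeasurable hwu
  -- Under the integral h may be replaced by u - k u, since the equation holds almost everywhere;
  -- then R k = R - k reduces R h to k u.
  have h1 : ∫ y, R x y * h y ∂μ = ∫ y, R x y * u y ∂μ - ∫ y, R x y * ∫ z, k y z * u z ∂μ ∂μ := by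
    rw [← integral_sub (hRd.integrable_mul hu.aestronglyMeasurable hwu x)
      (hRd.integrable_mul hku.aestronglyMeasurable (integrable_mul_norm hw hku) x)]
    refine integral_congr_ae ?_
    filter_upwards [hT] with y hy
    rw [← heq y hy]
    ring
  have h2 := hRd.integral_comp hk (hw.integrable_mul hv) hu.aestronglyMeasurable hwu x
  have h3 : ∀ y, ∫ z, R x z * k z y ∂μ = R x y - k x y := fun y => by
    rw [hR.eq_right x y]; ring
  simp only [h3, sub_mul] at h2
  rw [integral_sub (hRd.integrable_mul hu.aestronglyMeasurable hwu x)
    (hk.integrable_mul hu.aestronglyMeasurable hwu x)] at h2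
  rw [resolve, h1, h2, ← heq x hx]
  ring

lemma resolve_add {h₁ h₂ : ℝ → ℂ} (hh₁ : MemLp h₁ 2 μ) (hh₂ : MemLp h₂ 2 μ) (x : ℝ) :
    resolve R μ (fun x => h₁ x + h₂ x) x = resolve R μ h₁ x + resolve R μ h₂ x := by
  have hRd := hR.isDominated hk
  simp only [resolve, mul_add]
  rw [integral_add (hRd.integrable_mul hh₁.aestronglyMeasurable (integrable_mul_norm hw hh₁) x)
    (hRd.integrable_mul hh₂.aestronglyMeasurable (integrable_mul_norm hw hh₂) x)]
  ring

omit hk hR hv hw in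
lemma resolve_const_mul (c : ℂ) (x : ℝ) :
    resolve R μ (fun x => c * h x) x = c * resolve R μ h x := by
  simp only [resolve, mul_left_comm _ c, integral_const_mul]
  ring

lemma resolve_sum {ι : Type*} (s : Finset ι) {c : ι → ℂ} {h : ι → ℝ → ℂ}
    (hh : ∀ i ∈ s, MemLp (h i) 2 μ) (x : ℝ) :
    resolve R μ (fun x => ∑ i ∈ s, c i * h i x) x = ∑ i ∈ s, c i * resolve R μ (h i) x := by
  have hRd := hR.isDominated hk
  simp only [resolve, Finset.mul_sum, mul_add, Finset.sum_add_distrib]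
  congr 1
  rw [integral_finsetSum]
  · simp only [mul_left_comm _ (c _), integral_const_mul]
  · intro i hi
    simp only [mul_left_comm _ (c _)]
    exact (hRd.integrable_mul (hh i hi).aestronglyMeasurable
      (integrable_mul_norm hw (hh i hi)) x).const_mul _

/-- The resolvent kernel is the resolvent applied to the kernel. -/
lemma resolve_kernel (x y : ℝ) : resolve R μ (fun x => k x y) x = R x y := by
  rw [resolve, hR.eq_right x y]

/-- The adjoint of the resolvent. -/
lemma integral_mul_resolve {p : ℝ → ℂ} (hp : MemLp p 2 μ) (hh : MemLp h 2 μ) :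
    ∫ x, p x * resolve R μ h x ∂μ = ∫ x, h x * resolve (fun x y => R y x) μ p x ∂μ := by
  have hRd := hR.isDominated hk
  have hwh := integrable_mul_norm hw hh
  have hvp := integrable_mul_norm (hv.const_mul C) hp
  have hRh : MemLp (fun x => ∫ y, R x y * h y ∂μ) 2 μ :=
    hRd.memLp_integral (hv.const_mul C) hh.aestronglyMeasurable hwh
  have hRp : MemLp (fun x => ∫ y, R y x * p y ∂μ) 2 μ :=
    hRd.swap.memLp_integral hw hp.aestronglyMeasurable hvp
  have hint : Integrable (fun q : ℝ × ℝ => p q.1 * (R q.1 q.2 * h q.2)) (μ.prod μ) := by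
    refine (hvp.mul_prod hwh).mono' ?_ (Eventually.of_forall fun q => ?_)
    · exact hp.aestronglyMeasurable.comp_fst.mul
        (hRd.meas.aestronglyMeasurable.mul hh.aestronglyMeasurable.comp_snd)
    · rw [norm_mul, norm_mul]
      calc _ ≤ ‖p q.1‖ * ((C * v q.1 * w q.2) * ‖h q.2‖) := by
            gcongr
            exact hRd.bound _ _
        _ = _ := by ring
  have h1 := integral_integral_swap (f := fun x y => p x * (R x y * h y)) hint
  simp only [resolve, mul_add]
  refine (integral_add (hp.integrable_mul hh) (hp.integrable_mul hRh)).trans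
    (Eq.trans ?_ (integral_add (hh.integrable_mul hp) (hh.integrable_mul hRp)).symm)
  simp only [Pi.mul_apply]
  simp only [mul_comm (h _) (p _)]
  congr 1
  simp only [← integral_const_mul]
  rw [h1]
  refine integral_congr_ae (Eventually.of_forall fun y => ?_)
  refine integral_congr_ae (Eventually.of_forall fun z => ?_)
  simp only
  ring

/-! #### Kernels of integrable form -/

section Integrable

variable {ι : Type*} [Fintype ι] {φ ψ : ι → ℝ → ℂ} {S T : Set ℝ}
  (hN : ∀ x ∈ S, ∀ y ∈ T, ((x : ℂ) - y) * k x y = ∑ i, φ i x * ψ i y)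
  (hS : ∀ᵐ x ∂μ, x ∈ S) (hT : ∀ᵐ x ∂μ, x ∈ T) {A : ℝ} (hA : ∀ᵐ x ∂μ, |x| ≤ A)
  (hφ : ∀ i, MemLp (φ i) 2 μ) (hψ : ∀ i, MemLp (ψ i) 2 μ)

omit hk hR hv hw in
include hA in
lemma memLp_id_mul (hh : MemLp h 2 μ) : MemLp (fun x : ℝ => (x : ℂ) * h x) 2 μ := by
  refine MemLp.of_le (hh.norm.const_mul A) ((by fun_prop : Measurable fun x : ℝ =>
    (x : ℂ)).aestronglyMeasurable.mul hh.aestronglyMeasurable) ?_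
  filter_upwards [hA] with x hx
  rw [norm_mul, Complex.norm_real, norm_mul, norm_norm, Real.norm_eq_abs, Real.norm_eq_abs]
  exact mul_le_mul_of_nonneg_right (hx.trans (le_abs_self A)) (norm_nonneg _)

include hN hS hT hA hφ hψ

/-- The commutator of the resolvent with the multiplication by `x`. -/
lemma resolve_id_mul (hh : MemLp h 2 μ) : ∀ x ∈ S, resolve R μ (fun x => (x : ℂ) * h x) x
    = x * resolve R μ h x - ∑ i, resolve R μ (φ i) x * ∫ y, ψ i y * resolve R μ h y ∂μ := by
  have hu := memLp_resolve hk hR hv hw hh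
  set u := resolve R μ h with hu_def
  have hxu := memLp_id_mul hA hu
  have hxh := memLp_id_mul hA hh
  have hsum : MemLp (fun x => ∑ i, (∫ y, ψ i y * u y ∂μ) * φ i x) 2 μ :=
    memLp_finsetSum _ fun i _ => (hφ i).const_mul _
  -- From y k(x,y) = x k(x,y) - Σ φ_i(x) ψ_i(y) it follows that x u(x) solves the equation with
  -- right-hand side x h + Σ φ_i ∫ ψ_i u. Uniqueness identifies it.
  have key := eq_resolve hk hR hv hw (T := S) (h := (fun x : ℝ => (x : ℂ) * h x) +
    fun x => ∑ i, (∫ y, ψ i y * u y ∂μ) * φ i x) hS hxu (by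
    intro x hx
    have h1 := resolve_sub hk hR hv hw hh x
    rw [← hu_def] at h1
    have h2 : ∫ y, k x y * ((y : ℂ) * u y) ∂μ
        = x * (∫ y, k x y * u y ∂μ) - ∑ i, φ i x * ∫ y, ψ i y * u y ∂μ := by
      have hψu : ∀ i, Integrable (fun y => φ i x * (ψ i y * u y)) μ := fun i =>
        ((hψ i).integrable_mul hu).const_mul _
      simp only [← integral_const_mul]
      rw [← integral_finsetSum _ fun i _ => hψu i,
        ← integral_sub ((hk.integrable_mul hu.aestronglyMeasurable
          (integrable_mul_norm hw hu) x).const_mul _) (integrable_finsetSum _ fun i _ => hψu i)]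
      refine integral_congr_ae ?_
      filter_upwards [hT] with y hy
      have := hN x hx y hy
      simp only [← mul_assoc]
      rw [← Finset.sum_mul, ← this]
      ring
    rw [h2]
    simp only [Pi.add_apply]
    rw [← h1]
    simp only [mul_comm (φ _ x)]
    ring)
  intro x hx
  have h3 := key x hx
  have h4 := resolve_add hk hR hv hw hxh hsum x
  rw [resolve_sum hk hR hv hw _ fun i _ => hφ i] at h4
  have h5 : resolve R μ ((fun x : ℝ => (x : ℂ) * h x) + fun x => ∑ i, (∫ y, ψ i y * u y ∂μ) * φ i x) x
      = resolve R μ (fun x => (x : ℂ) * h x + ∑ i, (∫ y, ψ i y * u y ∂μ) * φ i x) x := rfl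
  rw [h5, h4] at h3
  simp only [mul_comm (resolve R μ (φ _) x)]
  linear_combination -h3

/-- The resolvent kernel is of integrable form again. -/
lemma sub_mul_resolventKernel : ∀ x ∈ S, ∀ y ∈ T, ((x : ℂ) - y) * R x y
    = ∑ i, resolve R μ (φ i) x * resolve (fun x y => R y x) μ (ψ i) y := by
  intro x hx y hy
  have hRd := hR.isDominated hk
  have hRy : MemLp (fun x => R x y) 2 μ := hRd.memLp_left (hv.const_mul C) y
  have hu : MemLp (fun x : ℝ => ((x : ℂ) - y) * R x y) 2 μ := by
    simp only [sub_mul]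
    exact (memLp_id_mul hA hRy).sub (hRy.const_mul _)
  have hint := integrable_mul_norm hw hRy
  -- For fixed y the function (x - y) R(x,y) solves the equation whose right-hand side is the
  -- combination of the φ_i with the values at y of the adjoint solutions as coefficients.
  have key := eq_resolve hk hR hv hw (T := S)
    (h := fun x => ∑ i, resolve (fun x y => R y x) μ (ψ i) y * φ i x) hS hu (by
    intro x hx
    have h2 : ∫ z, k x z * (((z : ℂ) - y) * R z y) ∂μ
        = ((x : ℂ) - y) * (∫ z, k x z * R z y ∂μ) - ∑ i, φ i x * ∫ z, R z y * ψ i z ∂μ := by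
      have hRψ : ∀ i, Integrable (fun z => φ i x * (R z y * ψ i z)) μ := fun i =>
        (hRy.integrable_mul (hψ i)).const_mul _
      simp only [← integral_const_mul]
      rw [← integral_finsetSum _ fun i _ => hRψ i,
        ← integral_sub ((hk.integrable_mul hRy.aestronglyMeasurable hint x).const_mul _)
          (integrable_finsetSum _ fun i _ => hRψ i)]
      refine integral_congr_ae ?_
      filter_upwards [hT] with z hz
      have := hN x hx z hz
      have e : ∑ i, φ i x * (R z y * ψ i z) = (((x : ℂ) - z) * k x z) * R z y := by
        rw [this, Finset.sum_mul]
        exact Finset.sum_congr rfl fun i _ => by ring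
      rw [e]
      ring
    rw [h2]
    have h3 := hR.eq_left x y
    have h4 := hN x hx y hy
    simp only [resolve, add_mul, Finset.sum_add_distrib]
    have e1 : ∑ i, ψ i y * φ i x = ((x : ℂ) - y) * k x y := by
      rw [h4]; exact Finset.sum_congr rfl fun i _ => mul_comm _ _
    have e2 : ∑ i, (∫ z, R z y * ψ i z ∂μ) * φ i x = ∑ i, φ i x * ∫ z, R z y * ψ i z ∂μ :=
      Finset.sum_congr rfl fun i _ => mul_comm _ _
    rw [e1, e2]
    linear_combination ((x : ℂ) - y) * h3)
  rw [key x hx, resolve_sum hk hR hv hw _ fun i _ => hφ i]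
  exact Finset.sum_congr rfl fun i _ => mul_comm _ _

end Integrable

end Operators

/-! ### Continuity -/

/-- A dominated kernel which is continuous on `U × V` and whose weights are locally bounded on the
open sets `U` and `V`. -/
structure IsKernel (U V : Set ℝ) (k : ℝ → ℝ → ℂ) (v w : ℝ → ℝ) : Prop
    extends IsDominated k v w where
  openU : IsOpen U
  openV : IsOpen V
  cont : ∀ x ∈ U, ∀ y ∈ V, ContinuousAt (Function.uncurry k) (x, y)
  locU : ∀ x ∈ U, ∃ B, ∀ᶠ y in 𝓝 x, v y ≤ B
  locV : ∀ x ∈ V, ∃ B, ∀ᶠ y in 𝓝 x, w y ≤ B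

section Continuity

variable {k R : ℝ → ℝ → ℂ} {v w : ℝ → ℝ} {μ : Measure ℝ} [SFinite μ] {U V : Set ℝ}
  {h : ℝ → ℂ} {C : ℝ}

lemma IsKernel.swap (hk : IsKernel U V k v w) : IsKernel V U (fun x y => k y x) w v where
  toIsDominated := hk.toIsDominated.swap
  openU := hk.openV
  openV := hk.openU
  cont x hx y hy := ContinuousAt.comp (f := Prod.swap) (x := (x, y)) (hk.cont y hy x hx)
    continuous_swap.continuousAt
  locU := hk.locV
  locV := hk.locU

lemma IsKernel.continuousAt_left (hk : IsKernel U V k v w) {x y : ℝ} (hx : x ∈ U) (hy : y ∈ V) :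
    ContinuousAt (fun x => k x y) x :=
  ContinuousAt.comp (f := fun x => (x, y)) (hk.cont x hx y hy) (by fun_prop)

lemma IsKernel.continuousAt_integral (hk : IsKernel U V k v w) (hV : ∀ᵐ y ∂μ, y ∈ V)
    (hh : AEStronglyMeasurable h μ) (hwh : Integrable (fun y => w y * ‖h y‖) μ) {x : ℝ}
    (hx : x ∈ U) : ContinuousAt (fun x => ∫ y, k x y * h y ∂μ) x := by
  obtain ⟨B, hB⟩ := hk.locU x hx
  refine tendsto_integral_filter_of_dominated_convergence (fun y => B * (w y * ‖h y‖)) ?_ ?_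
    (hwh.const_mul B) ?_
  · exact Eventually.of_forall fun x =>
      (hk.measurable_right x).aestronglyMeasurable.mul hh
  · filter_upwards [hB] with x' hx'
    refine Eventually.of_forall fun y => ?_
    rw [norm_mul, ← mul_assoc]
    gcongr
    exact (hk.bound x' y).trans (mul_le_mul_of_nonneg_right hx' (hk.w_nonneg y))
  · filter_upwards [hV] with y hy
    exact (hk.continuousAt_left hx hy).mul continuousAt_const

variable (hk : IsKernel U V k v w) (hR : IsResolventKernel k v w μ C R) (hv : MemLp v 2 μ)
  (hw : MemLp w 2 μ) (hU : ∀ᵐ y ∂μ, y ∈ U) (hV : ∀ᵐ y ∂μ, y ∈ V)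

include hk hR hv hw hV

lemma continuousAt_resolventKernel_left {x y : ℝ} (hx : x ∈ U) (hy : y ∈ V) :
    ContinuousAt (fun x => R x y) x := by
  have hRy : MemLp (fun x => R x y) 2 μ :=
    (hR.isDominated hk.toIsDominated).memLp_left (hv.const_mul C) y
  have e : (fun x => R x y) = fun x => k x y + ∫ z, k x z * R z y ∂μ := by
    funext x; exact hR.eq_left x y
  rw [e]
  exact (hk.continuousAt_left hx hy).add (hk.continuousAt_integral hV hRy.aestronglyMeasurable
    (integrable_mul_norm hw hRy) hx)

include hU

/-- In R = k + ∫ k(x,z) R(z,y) dz the integrand needs continuity of R in its second variable only.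
This is the one-variable statement for the transposed kernel, so there is no circularity. -/
lemma continuousAt_resolventKernel {x y : ℝ} (hx : x ∈ U) (hy : y ∈ V) :
    ContinuousAt (Function.uncurry R) (x, y) := by
  have hRd := hR.isDominated hk.toIsDominated
  have e : Function.uncurry R
      = fun p : ℝ × ℝ => k p.1 p.2 + ∫ z, k p.1 z * R z p.2 ∂μ := by
    funext p; exact hR.eq_left p.1 p.2
  rw [e]
  refine ContinuousAt.add (hk.cont x hx y hy) ?_
  obtain ⟨B₁, hB₁⟩ := hk.locU x hx
  obtain ⟨B₂, hB₂⟩ := hk.locV y hy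
  refine tendsto_integral_filter_of_dominated_convergence
    (fun z => (B₁ * (C * B₂)) * (w z * v z)) ?_ ?_ ((hw.integrable_mul hv).const_mul _) ?_
  · exact Eventually.of_forall fun p => ((hk.measurable_right p.1).mul
      (hRd.measurable_left p.2)).aestronglyMeasurable
  · rw [nhds_prod_eq]
    filter_upwards [prod_mem_prod hB₁ hB₂] with p hp
    refine Eventually.of_forall fun z => ?_
    have h1 := (hk.bound p.1 z).trans (mul_le_mul_of_nonneg_right hp.1 (hk.w_nonneg z))
    have h2 : ‖R z p.2‖ ≤ C * v z * B₂ := (hRd.bound z p.2).trans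
      (mul_le_mul_of_nonneg_left hp.2 (hRd.v_nonneg z))
    rw [norm_mul]
    calc _ ≤ (B₁ * w z) * (C * v z * B₂) :=
          mul_le_mul h1 h2 (norm_nonneg _) ((norm_nonneg _).trans h1)
      _ = _ := by ring
  · filter_upwards [hU, hV] with z hzU hzV
    have h1 : Tendsto (fun p : ℝ × ℝ => k p.1 z) (𝓝 (x, y)) (𝓝 (k x z)) :=
      (hk.continuousAt_left hx hzV).tendsto.comp continuous_fst.continuousAt
    have h2 : Tendsto (fun p : ℝ × ℝ => R z p.2) (𝓝 (x, y)) (𝓝 (R z y)) :=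
      (continuousAt_resolventKernel_left hk.swap hR.swap hw hv hU hy hzU).tendsto.comp
        continuous_snd.continuousAt
    exact h1.mul h2

/-- In u = h + k u the integral term is continuous because k is; R itself does not enter. -/
lemma continuousAt_resolve (hh : MemLp h 2 μ) {x : ℝ} (hx : x ∈ U) (hc : ContinuousAt h x) :
    ContinuousAt (resolve R μ h) x := by
  have hu := memLp_resolve hk.toIsDominated hR hv hw hh
  have e : resolve R μ h = fun x => h x + ∫ y, k x y * resolve R μ h y ∂μ := by
    funext x
    have := resolve_sub hk.toIsDominated hR hv hw hh x
    linear_combination this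
  rw [e]
  exact hc.add (hk.continuousAt_integral hV hu.aestronglyMeasurable (integrable_mul_norm hw hu) hx)

end Continuity

end GenBessel

end

noncomputable section

namespace GenBessel

/-! ### The union of intervals `J` -/

section Intervals

variable {m : ℕ} {a : Fin (2 * m) → ℝ}

/-- The sign with which an endpoint contributes to integrals over `J`. -/
def endSign (l : Fin (2 * m)) : ℂ := if Even (l : ℕ) then -1 else 1

/-- This is the purpose of the factors ε_l: a product of two quantities at the same endpoint carries
minus the sign of that endpoint in integrals over J, so the final equations are the same for left
and right endpoints. -/
lemma prefactor_mul_self (l : Fin (2 * m)) : prefactor l * prefactor l = -endSign l := by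
  unfold prefactor endSign
  split_ifs <;> simp

lemma sum_fin_two_mul (G : Fin (2 * m) → ℂ) :
    ∑ l, G l = ∑ k : Fin m, (G ⟨2 * k, by omega⟩ + G ⟨2 * k + 1, by omega⟩) := by
  have h := Fintype.sum_equiv ((finProdFinEquiv (m := m) (n := 2)).trans (finCongr (mul_comm m 2)))
    (fun q => G (((finProdFinEquiv (m := m) (n := 2)).trans (finCongr (mul_comm m 2))) q)) G
    (fun _ => rfl)
  rw [← h, Fintype.sum_prod_type]
  refine Finset.sum_congr rfl fun k _ => ?_
  rw [Fin.sum_univ_two]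
  congr 2 <;> ext <;> simp [finProdFinEquiv]
  ring

lemma sum_endSign (H : Fin (2 * m) → ℂ) :
    ∑ l, endSign l * H l = ∑ k : Fin m, (H ⟨2 * k + 1, by omega⟩ - H ⟨2 * k, by omega⟩) := by
  rw [sum_fin_two_mul]
  refine Finset.sum_congr rfl fun k _ => ?_
  simp [endSign, parity_simps]
  ring

lemma measurableSet_J : MeasurableSet (J a) := MeasurableSet.iUnion fun _ => measurableSet_Ioo

lemma left_lt_right (ha : StrictMono a) (k : Fin m) : left a k < right a k :=
  ha (by simp [Fin.lt_def])

lemma pairwise_disjoint_intervals (ha : StrictMono a) :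
    Pairwise (Function.onFun Disjoint fun k : Fin m => Ioo (left a k) (right a k)) := by
  have key : ∀ i j : Fin m, i < j → Disjoint (Ioo (left a i) (right a i))
      (Ioo (left a j) (right a j)) := by
    intro i j hij
    rw [Set.disjoint_left]
    intro x hx hx'
    have : right a i < left a j := ha (by
      simp only [Fin.lt_def] at hij ⊢
      omega)
    linarith [hx.2, hx'.1]
  intro i j hij
  rcases lt_or_gt_of_ne hij with h | h
  · exact key i j h
  · exact (key j i h).symm

lemma J_subset {A : ℝ} (ha0 : ∀ l, 0 ≤ a l) (hA : ∀ l, a l ≤ A) : J a ⊆ Ioc 0 A := by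
  intro x hx
  obtain ⟨k, hk⟩ := Set.mem_iUnion.1 hx
  exact ⟨(ha0 _).trans_lt hk.1, hk.2.le.trans (hA _)⟩

lemma setIntegral_J (ha : StrictMono a) {h : ℝ → ℂ} (hh : IntegrableOn h (J a)) :
    ∫ x in J a, h x = ∑ k : Fin m, ∫ x in (left a k)..(right a k), h x := by
  rw [J, integral_iUnion_fintype (fun k => measurableSet_Ioo) (pairwise_disjoint_intervals ha)
    (fun k => hh.mono_set (Set.subset_iUnion (fun k => Ioo (left a k) (right a k)) k))]
  refine Finset.sum_congr rfl fun k _ => ?_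
  rw [intervalIntegral.integral_of_le (left_lt_right ha k).le, integral_Ioc_eq_integral_Ioo]

lemma intervalIntegrable_of_Ioc {A : ℝ} {h : ℝ → ℂ} (hh : IntegrableOn h (Ioc 0 A)) {s t : ℝ}
    (hs : 0 ≤ s) (hs' : s ≤ A) (ht : 0 ≤ t) (ht' : t ≤ A) : IntervalIntegrable h volume s t := by
  rw [intervalIntegrable_iff]
  refine hh.mono_set fun x hx => ?_
  rw [Set.mem_uIoc] at hx
  rcases hx with hx | hx
  · exact ⟨hs.trans_lt hx.1, hx.2.trans ht'⟩
  · exact ⟨ht.trans_lt hx.1, hx.2.trans hs'⟩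

/-- Writing the integral with primitives based at 0 separates the endpoints, so moving one of them
changes one summand. -/
lemma setIntegral_J_eq_sum (ha : StrictMono a) {A : ℝ} (ha0 : ∀ l, 0 ≤ a l) (hA : ∀ l, a l ≤ A)
    {h : ℝ → ℂ} (hh : IntegrableOn h (Ioc 0 A)) :
    ∫ x in J a, h x = ∑ l, endSign l * ∫ x in (0 : ℝ)..(a l), h x := by
  rw [setIntegral_J ha (hh.mono_set (J_subset ha0 hA)), sum_endSign]
  refine Finset.sum_congr rfl fun k _ => ?_
  rw [intervalIntegral.integral_interval_sub_left]
  · rfl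
  · exact intervalIntegrable_of_Ioc hh le_rfl ((ha0 _).trans (hA ⟨2 * k, by omega⟩)) (ha0 _) (hA _)
  · exact intervalIntegrable_of_Ioc hh le_rfl ((ha0 _).trans (hA ⟨2 * k, by omega⟩)) (ha0 _) (hA _)

/-- The effect of moving one endpoint. -/
lemma setIntegral_J_update {p : Fin (2 * m)} {t A : ℝ} (ha : StrictMono a) (ha0 : ∀ l, 0 ≤ a l)
    (hA : ∀ l, a l ≤ A) (ha' : StrictMono (Function.update a p t))
    (ha0' : ∀ l, 0 ≤ Function.update a p t l) (hA' : ∀ l, Function.update a p t l ≤ A)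
    {h : ℝ → ℂ} (hh : IntegrableOn h (Ioc 0 A)) :
    ∫ x in J (Function.update a p t), h x
      = (∫ x in J a, h x) + endSign p * ∫ x in (a p)..t, h x := by
  rw [setIntegral_J_eq_sum ha ha0 hA hh, setIntegral_J_eq_sum ha' ha0' hA' hh,
    ← sub_eq_iff_eq_add', ← Finset.sum_sub_distrib, Finset.sum_eq_single p]
  · have h1 := ha0' p
    have h2 := hA' p
    rw [Function.update_self] at h1 h2 ⊢
    rw [← mul_sub, intervalIntegral.integral_interval_sub_left]
    · exact intervalIntegrable_of_Ioc hh le_rfl (h1.trans h2) h1 h2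
    · exact intervalIntegrable_of_Ioc hh le_rfl (h1.trans h2) (ha0 _) (hA _)
  · intro l _ hl
    rw [Function.update_of_ne hl, sub_self]
  · simp

/-- The fundamental theorem of calculus on `J`. -/
lemma setIntegral_J_deriv (ha : StrictMono a) (ha0 : ∀ l, 0 ≤ a l) {F F' : ℝ → ℂ}
    (hF : ∀ x, 0 < x → HasDerivAt F (F' x) x) (hF' : IntegrableOn F' (J a)) (h0 : F 0 = 0)
    (hlim : Tendsto F (𝓝[>] 0) (𝓝 0)) :
    ∫ x in J a, F' x = ∑ l, endSign l * F (a l) := by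
  rw [setIntegral_J ha hF', sum_endSign]
  refine Finset.sum_congr rfl fun k _ => ?_
  have hlt := left_lt_right ha k
  have hl0 : 0 ≤ left a k := ha0 _
  -- The first left endpoint may be 0, where F need not be differentiable; the assumed limit at 0
  -- replaces differentiability there.
  have hcont : ∀ x, 0 ≤ x → Tendsto F (𝓝[>] x) (𝓝 (F x)) := by
    intro x hx
    rcases hx.eq_or_lt with rfl | hx
    · rw [h0]; exact hlim
    · exact (hF x hx).continuousAt.tendsto.mono_left nhdsWithin_le_nhds
  refine intervalIntegral.integral_eq_sub_of_hasDerivAt_of_tendsto hlt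
    (fun x hx => hF x (hl0.trans_lt hx.1)) ?_ (hcont _ hl0)
    ((hF _ (hl0.trans_lt hlt)).continuousAt.tendsto.mono_left nhdsWithin_le_nhds)
  rw [intervalIntegrable_iff_integrableOn_Ioo_of_le hlt.le]
  exact hF'.mono_set (Set.subset_iUnion (fun k => Ioo (left a k) (right a k)) k)

lemma eventually_update (ha : StrictMono a) (ha0 : ∀ l, 0 ≤ a l) {A : ℝ} (hA : ∀ l, a l < A)
    {p : Fin (2 * m)} (hp : 0 < a p) : ∀ᶠ t in 𝓝 (a p), StrictMono (Function.update a p t) ∧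
      (∀ l, 0 ≤ Function.update a p t l) ∧ ∀ l, Function.update a p t l ≤ A := by
  have hc : ∀ l, ContinuousAt (fun t => Function.update a p t l) (a p) := by
    intro l
    by_cases hl : l = p
    · subst hl; simpa using continuous_id'.continuousAt
    · simpa [hl] using continuousAt_const
  have h1 : ∀ᶠ t in 𝓝 (a p), ∀ i j, i < j → Function.update a p t i < Function.update a p t j := by
    simp only [eventually_all]
    intro i j hij
    exact (hc i).eventually_lt (hc j) (by simpa using ha hij)
  have h2 : ∀ᶠ t in 𝓝 (a p), ∀ l, Function.update a p t l < A := by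
    rw [eventually_all]
    intro l
    exact (hc l).eventually_lt continuousAt_const (by simpa using hA l)
  filter_upwards [h1, h2, Ioi_mem_nhds hp] with t h1 h2 h3
  refine ⟨fun i j => h1 i j, fun l => ?_, fun l => (h2 l).le⟩
  by_cases hl : l = p
  · subst hl; simpa using le_of_lt h3
  · simpa [hl] using ha0 l

/-- The almost everywhere convergence of the indicators which `IsDominated.tendsto_fredholmSeries`
requires; only the moving endpoint itself is exceptional. -/
lemma eventually_mem_J_update {p : Fin (2 * m)} {x : ℝ} (hx : x ≠ a p) :
    ∀ᶠ t in 𝓝 (a p), (x ∈ J (Function.update a p t) ↔ x ∈ J a) := by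
  have h1 : ∀ᶠ t in 𝓝 (a p), ∀ l, (Function.update a p t l < x ↔ a l < x) ∧
      (x < Function.update a p t l ↔ x < a l) := by
    rw [eventually_all]
    intro l
    by_cases hl : l = p
    · subst hl
      rcases lt_or_gt_of_ne hx with h | h
      · filter_upwards [Ioi_mem_nhds h] with t ht
        have : x < t := ht
        simp [h, this, h.not_gt, this.not_gt]
      · filter_upwards [Iio_mem_nhds h] with t ht
        have : t < x := ht
        simp [h, this, h.not_gt, this.not_gt]
    · exact Eventually.of_forall fun t => by simp [hl]
  filter_upwards [h1] with t ht
  simp only [J, Set.mem_iUnion, Set.mem_Ioo, left, right, ht]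

end Intervals

/-! ### Kernels which are homogeneous up to a rank one term -/

/-- The kernels `k₁ = x ∂k/∂x` and `k₂ = y ∂k/∂y` satisfy `k₁ + k₂ + k = F(x) G(y)`. -/
structure IsThetaKernel (U V : Set ℝ) (k k₁ k₂ : ℝ → ℝ → ℂ) (v w : ℝ → ℝ) (F G : ℝ → ℂ) : Prop where
  ker : IsKernel U V k v w
  ker₁ : IsKernel U V k₁ v w
  ker₂ : IsKernel U V k₂ v w
  subU : Ioi 0 ⊆ U
  subV : Ioi 0 ⊆ V
  memLp_v : ∀ A, MemLp v 2 (volume.restrict (Ioc 0 A))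
  memLp_w : ∀ A, MemLp w 2 (volume.restrict (Ioc 0 A))
  vanish : Tendsto (fun y => y * (v y * w y)) (𝓝[>] 0) (𝓝 0)
  deriv₁ : ∀ x y, 0 < x → 0 < y → HasDerivAt (fun x => k x y) (k₁ x y / x) x
  deriv₂ : ∀ x y, 0 < x → 0 < y → HasDerivAt (fun y => k x y) (k₂ x y / y) y
  euler_eq : ∀ x y, 0 < x → 0 < y → k₁ x y + k₂ x y + k x y = F x * G y
  memLp_F : ∀ A, MemLp F 2 (volume.restrict (Ioc 0 A))
  memLp_G : ∀ A, MemLp G 2 (volume.restrict (Ioc 0 A))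

namespace IsThetaKernel

variable {U V : Set ℝ} {k k₁ k₂ : ℝ → ℝ → ℂ} {v w : ℝ → ℝ} {F G : ℝ → ℂ}

lemma swap (hT : IsThetaKernel U V k k₁ k₂ v w F G) :
    IsThetaKernel V U (fun x y => k y x) (fun x y => k₂ y x) (fun x y => k₁ y x) w v G F where
  ker := hT.ker.swap
  ker₁ := hT.ker₂.swap
  ker₂ := hT.ker₁.swap
  subU := hT.subV
  subV := hT.subU
  memLp_v := hT.memLp_w
  memLp_w := hT.memLp_v
  vanish := by simpa only [mul_comm (w _)] using hT.vanish
  deriv₁ x y hx hy := hT.deriv₂ y x hy hx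
  deriv₂ x y hx hy := hT.deriv₁ y x hy hx
  euler_eq x y hx hy := by rw [mul_comm, ← hT.euler_eq y x hy hx]; ring
  memLp_F := hT.memLp_G
  memLp_G := hT.memLp_F

variable {m : ℕ} {a : Fin (2 * m) → ℝ} {R : ℝ → ℝ → ℂ} {C B A : ℝ} {φ φ₁ : ℝ → ℂ}
  (hT : IsThetaKernel U V k k₁ k₂ v w F G) (ha : StrictMono a) (ha0 : ∀ l, 0 ≤ a l)
  (hA : ∀ l, a l ≤ A) (hR : IsResolventKernel k v w (volume.restrict (J a)) C R)
  (hφm : Measurable φ) (hφb : ∀ x, ‖φ x‖ ≤ B * v x)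

lemma memLp_J {E : Type*} [NormedAddCommGroup E] {h : ℝ → E}
    (hh : ∀ A, MemLp h 2 (volume.restrict (Ioc 0 A))) (ha0 : ∀ l, 0 ≤ a l)
    (hA : ∀ l, a l ≤ A) : MemLp h 2 (volume.restrict (J a)) :=
  (hh A).mono_measure (Measure.restrict_mono (J_subset ha0 hA) le_rfl)

lemma ae_pos (ha0 : ∀ l, 0 ≤ a l) (hA : ∀ l, a l ≤ A) :
    ∀ᵐ x ∂(volume.restrict (J a)), x ∈ Ioi (0 : ℝ) := by
  filter_upwards [self_mem_ae_restrict measurableSet_J] with x hx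
  exact (J_subset ha0 hA hx).1

lemma ae_le (ha0 : ∀ l, 0 ≤ a l) (hA : ∀ l, a l ≤ A) :
    ∀ᵐ x ∂(volume.restrict (J a)), |x| ≤ A := by
  filter_upwards [self_mem_ae_restrict measurableSet_J] with x hx
  have := J_subset ha0 hA hx
  rw [abs_of_pos this.1]
  exact this.2

lemma memLp_of_bound (hv : ∀ A, MemLp v 2 (volume.restrict (Ioc 0 A))) (hφm : Measurable φ)
    (hφb : ∀ x, ‖φ x‖ ≤ B * v x) (A : ℝ) : MemLp φ 2 (volume.restrict (Ioc 0 A)) :=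
  MemLp.of_le ((hv A).const_mul B) hφm.aestronglyMeasurable
    (Eventually.of_forall fun x => (hφb x).trans (le_abs_self _))

include hT ha0 hA hR hφm hφb

/-- Differentiating u = φ + k u under the integral involves derivatives of k alone, so
differentiability of the resolvent kernel is not needed. -/
lemma hasDerivAt_resolve {x : ℝ} {d : ℂ} (hx : 0 < x) (hd : HasDerivAt φ (d / x) x) :
    HasDerivAt (resolve R (volume.restrict (J a)) φ)
      ((d + ∫ y in J a, k₁ x y * resolve R (volume.restrict (J a)) φ y) / x) x := by
  set μ := volume.restrict (J a) with hμ
  have hv := memLp_J hT.memLp_v ha0 hA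
  have hw := memLp_J hT.memLp_w ha0 hA
  have hφ : MemLp φ 2 μ := memLp_J (memLp_of_bound hT.memLp_v hφm hφb) ha0 hA
  have hu := memLp_resolve hT.ker.toIsDominated hR hv hw hφ
  have hwu := integrable_mul_norm hw hu
  have e : resolve R μ φ = fun x => φ x + ∫ y, k x y * resolve R μ φ y ∂μ := by
    funext x
    linear_combination resolve_sub hT.ker.toIsDominated hR hv hw hφ x
  obtain ⟨b, hb⟩ := hT.ker.locU x (hT.subU hx)
  have hs : {x' | v x' ≤ b} ∩ Ioi (x / 2) ∈ 𝓝 x := inter_mem hb (Ioi_mem_nhds (by linarith))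
  have key := hasDerivAt_integral_of_dominated_loc_of_deriv_le (μ := μ)
    (F := fun x y => k x y * resolve R μ φ y)
    (F' := fun x y => k₁ x y / x * resolve R μ φ y) (x₀ := x)
    (bound := fun y => (x / 2)⁻¹ * (b * (w y * ‖resolve R μ φ y‖))) hs ?_
    (hT.ker.integrable_mul hu.aestronglyMeasurable hwu x) ?_ ?_ ?_ ?_
  · have h2 := hd.add key.2
    refine (h2.congr_of_eventuallyEq (Eventually.of_forall fun x => congrFun e x)).congr_deriv ?_
    rw [add_div, ← integral_div]
    congr 2
    funext y
    ring
  · exact Eventually.of_forall fun x =>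
      (hT.ker.measurable_right x).aestronglyMeasurable.mul hu.aestronglyMeasurable
  · exact ((hT.ker₁.measurable_right x).div_const _).aestronglyMeasurable.mul
      hu.aestronglyMeasurable
  · refine Eventually.of_forall fun y x' hx' => ?_
    have h1 := (hT.ker₁.bound x' y).trans
      (mul_le_mul_of_nonneg_right hx'.1 (hT.ker₁.w_nonneg y))
    have h2 : x / 2 < x' := hx'.2
    have h3 : 0 < x' := by linarith
    rw [norm_mul, norm_div, Complex.norm_real, Real.norm_of_nonneg h3.le, div_eq_inv_mul,
      mul_assoc, ← mul_assoc b]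
    have h4 : x'⁻¹ ≤ (x / 2)⁻¹ := inv_anti₀ (by linarith) h2.le
    have h5 : 0 ≤ b * w y := (norm_nonneg _).trans h1
    gcongr
  · exact (hwu.const_mul b).const_mul _
  · filter_upwards [ae_pos ha0 hA] with y hy x' hx'
    have h2 : x / 2 < x' := hx'.2
    exact (hT.deriv₁ x' y (by linarith) hy).mul_const _

include ha

/-- The logarithmic derivative of the resolvent. -/
lemma theta_resolve (hφ₁ : ∀ A, MemLp φ₁ 2 (volume.restrict (Ioc 0 A)))
    (hd : ∀ x, 0 < x → HasDerivAt φ (φ₁ x / x) x) {x : ℝ} (hx : 0 < x) :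
    φ₁ x + ∫ y in J a, k₁ x y * resolve R (volume.restrict (J a)) φ y
      = resolve R (volume.restrict (J a)) φ₁ x
        + (∫ y in J a, G y * resolve R (volume.restrict (J a)) φ y) *
            resolve R (volume.restrict (J a)) F x
        - ∑ l, endSign l * a l * resolve R (volume.restrict (J a)) φ (a l) * R x (a l) := by
  set μ := volume.restrict (J a) with hμ
  have hkd := hT.ker.toIsDominated
  have hv : MemLp v 2 μ := memLp_J hT.memLp_v ha0 hA
  have hw : MemLp w 2 μ := memLp_J hT.memLp_w ha0 hA
  have hφ : MemLp φ 2 μ := memLp_J (memLp_of_bound hT.memLp_v hφm hφb) ha0 hA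
  have hφ₁ : MemLp φ₁ 2 μ := memLp_J hφ₁ ha0 hA
  have hF : MemLp F 2 μ := memLp_J hT.memLp_F ha0 hA
  have hG : MemLp G 2 μ := memLp_J hT.memLp_G ha0 hA
  have hu := memLp_resolve hkd hR hv hw hφ
  have hbu := norm_resolve_le hkd hR hv hw hφ hφb
  set u := resolve R μ φ with hudef
  set B' := B + C * ∫ y, w y * ‖φ y‖ ∂μ
  have hwu := integrable_mul_norm hw hu
  have hderiv : ∀ y, 0 < y → HasDerivAt u ((φ₁ y + ∫ z, k₁ y z * u z ∂μ) / y) y := fun y hy =>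
    hT.hasDerivAt_resolve ha0 hA hR hφm hφb hy (hd y hy)
  set u₁ : ℝ → ℂ := fun y => φ₁ y + ∫ z, k₁ y z * u z ∂μ with hu₁def
  have hu₁ : MemLp u₁ 2 μ :=
    hφ₁.add (hT.ker₁.toIsDominated.memLp_integral hv hu.aestronglyMeasurable hwu)
  have hwu₁ := integrable_mul_norm hw hu₁
  -- integration by parts
  have hparts : ∀ x, 0 < x → ∫ y, (k x y * u y + k₂ x y * u y + k x y * u₁ y) ∂μ
      = ∑ l, endSign l * ((a l : ℂ) * k x (a l) * u (a l)) := by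
    intro x hx
    refine setIntegral_J_deriv ha ha0 (F := fun y : ℝ => (y : ℂ) * k x y * u y) ?_ ?_ (by simp) ?_
    · intro y hy
      have hy0 : (y : ℂ) ≠ 0 := by exact_mod_cast hy.ne'
      have h1 := (((hasDerivAt_id y).ofReal_comp).mul (hT.deriv₂ x y hx hy)).mul (hderiv y hy)
      refine h1.congr_deriv ?_
      simp only [id, Complex.ofReal_one, one_mul, Pi.mul_apply, hu₁def]
      field_simp
    · exact ((hkd.integrable_mul hu.aestronglyMeasurable hwu x).add
        (hT.ker₂.integrable_mul hu.aestronglyMeasurable hwu x)).add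
        (hkd.integrable_mul hu₁.aestronglyMeasurable hwu₁ x)
    -- The boundary term y k(x,y) u(y) at the origin is at most a multiple of y v(y) w(y).
    · have h0 := hT.vanish.const_mul (v x * B')
      rw [mul_zero] at h0
      refine squeeze_zero_norm' ?_ h0
      filter_upwards [self_mem_nhdsWithin] with y hy
      have hy' : 0 < y := hy
      rw [norm_mul, norm_mul, Complex.norm_real, Real.norm_of_nonneg hy'.le]
      have h2 := mul_le_mul (hkd.bound x y) (hbu y) (norm_nonneg _)
        (mul_nonneg (hkd.v_nonneg x) (hkd.w_nonneg y))
      calc _ = y * (‖k x y‖ * ‖u y‖) := by ring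
        _ ≤ y * (v x * w y * (B' * v y)) := by gcongr
        _ = _ := by ring
  have hint₁ : ∀ x, Integrable (fun y => k x y * u y + k₂ x y * u y) μ := fun x =>
    (hkd.integrable_mul hu.aestronglyMeasurable hwu x).add
      (hT.ker₂.integrable_mul hu.aestronglyMeasurable hwu x)
  have hsum : MemLp (fun x => ∑ l, (-(endSign l * a l * u (a l))) * k x (a l)) 2 μ :=
    memLp_finsetSum _ fun l _ => (hkd.memLp_left hv (a l)).const_mul _
  have hFc : MemLp (fun x => (∫ y, G y * u y ∂μ) * F x) 2 μ := hF.const_mul _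
  -- u₁ = θu satisfies a Fredholm equation of its own. In θu = φ₁ + k₁ u, replace k₁ by F G - k -
  -- k₂; integration by parts turns -∫ (k + k₂) u into ∫ k u₁ minus the endpoint terms. Applying 1 +
  -- R to the remaining source gives the formula, with R(·, a_l) coming from k(·, a_l).
  have key := eq_resolve hkd hR hv hw (T := Ioi 0)
    (h := fun x => φ₁ x + ((∫ y, G y * u y ∂μ) * F x +
      ∑ l, (-(endSign l * a l * u (a l))) * k x (a l))) (ae_pos ha0 hA) hu₁ (by
    intro x hx
    have hx : 0 < x := hx
    have h1 := hparts x hx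
    rw [integral_add (hint₁ x) (hkd.integrable_mul hu₁.aestronglyMeasurable hwu₁ x)] at h1
    have h2 : ∫ y, (k x y * u y + k₂ x y * u y) ∂μ + ∫ y, k₁ x y * u y ∂μ
        = F x * ∫ y, G y * u y ∂μ := by
      rw [← integral_add (hint₁ x)
        (hT.ker₁.integrable_mul hu.aestronglyMeasurable hwu x), ← integral_const_mul]
      refine integral_congr_ae ?_
      filter_upwards [ae_pos ha0 hA] with y hy
      have := hT.euler_eq x y hx hy
      linear_combination (u y) * this
    have h3 : ∑ l, (-(endSign l * a l * u (a l))) * k x (a l)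
        = -∑ l, endSign l * ((a l : ℂ) * k x (a l) * u (a l)) := by
      rw [← Finset.sum_neg_distrib]
      exact Finset.sum_congr rfl fun l _ => by ring
    rw [h3, ← h1, hu₁def]
    simp only
    linear_combination h2)
  have h4 := key x hx
  have hFs : MemLp (fun x => (∫ y, G y * u y ∂μ) * F x +
      ∑ l, (-(endSign l * a l * u (a l))) * k x (a l)) 2 μ := hFc.add hsum
  rw [resolve_add hkd hR hv hw hφ₁ hFs, resolve_add hkd hR hv hw hFc hsum,
    resolve_const_mul, resolve_sum hkd hR hv hw _ fun l _ => hkd.memLp_left hv (a l)] at h4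
  simp only [resolve_kernel hkd hR hv hw] at h4
  have h5 : ∑ l, (-(endSign l * a l * u (a l))) * R x (a l)
      = -∑ l, endSign l * a l * u (a l) * R x (a l) := by
    rw [← Finset.sum_neg_distrib]
    exact Finset.sum_congr rfl fun l _ => by ring
  rw [h5] at h4
  linear_combination h4

end IsThetaKernel

end GenBessel

end

noncomputable section

namespace GenBessel

/-! ### Moving an endpoint -/

/-- The resolvent kernel on the set `S`, as the quotient of the Fredholm minor and determinant. -/
def resKernel (k : ℝ → ℝ → ℂ) (S : Set ℝ) (x y : ℝ) : ℂ :=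
  fredholmMinor k (volume.restrict S) x y / fredholmSeries k (volume.restrict S)

/-- The solution of `u - k u = h` on the set `S`. -/
def sol (k : ℝ → ℝ → ℂ) (S : Set ℝ) (h : ℝ → ℂ) : ℝ → ℂ :=
  resolve (resKernel k S) (volume.restrict S) h

lemma resKernel_swap (k : ℝ → ℝ → ℂ) (S : Set ℝ) :
    resKernel (fun x y => k y x) S = fun x y => resKernel k S y x := by
  funext x y
  simp only [resKernel, fredholmMinor, fredholmSeries, fredholmCoeff_swap, fredholmMinorCoeff_swap]

/-- The endpoints `b` are admissible and the resolvent on `J b` exists, with the constant `C`. -/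
structure IsRegular {m : ℕ} (k : ℝ → ℝ → ℂ) (v w : ℝ → ℝ) (A C : ℝ) (b : Fin (2 * m) → ℝ) :
    Prop where
  mono : StrictMono b
  nonneg : ∀ l, 0 ≤ b l
  le : ∀ l, b l ≤ A
  res : IsResolventKernel k v w (volume.restrict (J b)) C (resKernel k (J b))

section Moving

variable {U V : Set ℝ} {k k₁ k₂ : ℝ → ℝ → ℂ} {v w : ℝ → ℝ} {F G : ℝ → ℂ} {m : ℕ}
  {a : Fin (2 * m) → ℝ} {A B C : ℝ} {p : Fin (2 * m)} {φ : ℝ → ℂ}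

lemma IsRegular.swap (h : IsRegular k v w A C a) : IsRegular (fun x y => k y x) w v A C a where
  mono := h.mono
  nonneg := h.nonneg
  le := h.le
  res := by rw [resKernel_swap]; exact h.res.swap

lemma measurable_resolve {R : ℝ → ℝ → ℂ} (hR : Measurable (Function.uncurry R)) {μ : Measure ℝ}
    [SFinite μ] (hφ : Measurable φ) : Measurable (resolve R μ φ) := by
  have : StronglyMeasurable fun q : ℝ × ℝ => R q.1 q.2 * φ q.2 :=
    (hR.mul (hφ.comp measurable_snd)).stronglyMeasurable
  exact hφ.add (this.integral_prod_right' (ν := μ)).measurable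

/-- Near a regular point the resolvents are uniformly bounded. -/
lemma IsThetaKernel.eventually_isRegular (hT : IsThetaKernel U V k k₁ k₂ v w F G)
    (ha : StrictMono a) (ha0 : ∀ l, 0 ≤ a l) (hA : ∀ l, a l < A) (hp : 0 < a p)
    (hD : fredholmSeries k (volume.restrict (J a)) ≠ 0) :
    ∃ C, ∀ᶠ t in 𝓝 (a p), IsRegular k v w A C (Function.update a p t) := by
  have hkd := hT.ker.toIsDominated
  have hvw : Integrable (fun x => v x * w x) (volume.restrict (Ioc 0 A)) :=
    (hT.memLp_v A).integrable_mul (hT.memLp_w A)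
  have hlim := hkd.tendsto_fredholmSeries hvw (l := 𝓝 (a p))
    (S := fun t => J (Function.update a p t)) (S₀ := J a) (fun _ => measurableSet_J)
    measurableSet_J (by
      have h1 : ∀ᵐ x ∂(volume.restrict (Ioc 0 A)), x ≠ a p :=
        ae_restrict_of_ae (Measure.ae_ne volume (a p))
      filter_upwards [h1] with x hx using eventually_mem_J_update hx)
  rw [Measure.restrict_restrict_of_subset (J_subset ha0 fun l => (hA l).le)] at hlim
  set D := fredholmSeries k (volume.restrict (J a)) with hDdef
  have hDpos : 0 < ‖D‖ := norm_pos_iff.2 hD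
  have h2 := hlim.norm.eventually (lt_mem_nhds (half_lt_self hDpos))
  set W := ∫ x in Ioc 0 A, v x * w x
  -- Near a_p the determinant stays above half its size at a_p, and W is the total weight of (0, A],
  -- which contains all the sets in question.
  refine ⟨(∑' n, minorBound W n) / (‖D‖ / 2), ?_⟩
  filter_upwards [h2, eventually_update ha ha0 hA hp] with t ht ⟨hm, h0, hle⟩
  have hsub := J_subset h0 hle
  rw [Measure.restrict_restrict_of_subset hsub] at ht
  have hvw' : Integrable (fun x => v x * w x) (volume.restrict (J (Function.update a p t))) :=
    hvw.mono_measure (Measure.restrict_mono hsub le_rfl)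
  have hDt : fredholmSeries k (volume.restrict (J (Function.update a p t))) ≠ 0 :=
    norm_pos_iff.1 ((half_pos hDpos).trans ht)
  have hres := hkd.isResolventKernel hvw' hDt
  refine ⟨hm, h0, hle, hres.meas, ?_, fun x y => (hres.bound x y).trans ?_, hres.eq_left,
    hres.eq_right⟩
  · exact div_nonneg (tsum_nonneg fun n => minorBound_nonneg (hkd.integral_weights_nonneg hvw) n)
      (half_pos hDpos).le
  · have hW : 0 ≤ W := hkd.integral_weights_nonneg hvw
    have hW' := hkd.integral_weights_nonneg hvw'
    have hWle : ∫ x in J (Function.update a p t), v x * w x ≤ W :=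
      setIntegral_mono_set hvw (Eventually.of_forall fun x =>
        mul_nonneg (hkd.v_nonneg x) (hkd.w_nonneg x)) hsub.eventuallyLE
    have hle : ∑' n, minorBound (∫ x in J (Function.update a p t), v x * w x) n
        ≤ ∑' n, minorBound W n := by
      refine Summable.tsum_le_tsum (fun n => ?_) (summable_minorBound hW') (summable_minorBound hW)
      unfold minorBound
      have := hadamardConst_nonneg (n + 1)
      gcongr
    have h3 : 0 ≤ ∑' n, minorBound W n := tsum_nonneg fun n => minorBound_nonneg hW n
    have h4 := mul_nonneg (hkd.v_nonneg x) (hkd.w_nonneg y)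
    gcongr

/-- Fubini's theorem with an interval integral. -/
lemma IsDominated.integral_comp_interval {K R : ℝ → ℝ → ℂ} {v' w' : ℝ → ℝ} {μ : Measure ℝ}
    [SFinite μ] {h : ℝ → ℂ} (hK : IsDominated K v w) (hR : IsDominated R v' w')
    (hwv : Integrable (fun z => w z * v' z) μ) (hh : AEStronglyMeasurable h (volume.restrict (Ioc 0 A)))
    (hwh : IntegrableOn (fun y => w' y * ‖h y‖) (Ioc 0 A)) {s t : ℝ} (hs : s ∈ Icc 0 A)
    (ht : t ∈ Icc 0 A) (x : ℝ) :
    Integrable (fun z => K x z * ∫ y in s..t, R z y * h y) μ ∧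
    ∫ z, K x z * (∫ y in s..t, R z y * h y) ∂μ = ∫ y in s..t, (∫ z, K x z * R z y ∂μ) * h y := by
  have hi : ∀ s t, s ∈ Icc 0 A → t ∈ Icc 0 A → Ioc s t ⊆ Ioc 0 A := fun s t hs ht =>
    Ioc_subset_Ioc hs.1 ht.2
  have key : ∀ s t, s ∈ Icc 0 A → t ∈ Icc 0 A →
      Integrable (fun z => K x z * ∫ y in Ioc s t, R z y * h y) μ ∧
      ∫ z, K x z * (∫ y in Ioc s t, R z y * h y) ∂μ
        = ∫ y in Ioc s t, (∫ z, K x z * R z y ∂μ) * h y := by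
    intro s t hs ht
    have hh' := hh.mono_set (hi s t hs ht)
    have hwh' := hwh.mono_set (hi s t hs ht)
    refine ⟨?_, hK.integral_comp hR hwv hh' hwh' x⟩
    refine hK.integrable_mul (hR.aestronglyMeasurable_integral hh') ?_ x
    refine (hwv.mul_const (∫ y in Ioc s t, w' y * ‖h y‖)).mono' ?_ (Eventually.of_forall fun z => ?_)
    · exact hK.meas_w.aestronglyMeasurable.mul (hR.aestronglyMeasurable_integral hh').norm
    · rw [Real.norm_of_nonneg (mul_nonneg (hK.w_nonneg z) (norm_nonneg _)), mul_assoc]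
      exact mul_le_mul_of_nonneg_left (hR.norm_integral_le hwh' z) (hK.w_nonneg z)
  obtain ⟨h1, h2⟩ := key s t hs ht
  obtain ⟨h3, h4⟩ := key t s ht hs
  simp only [intervalIntegral, mul_sub]
  exact ⟨h1.sub h3, by rw [integral_sub h1 h3, h2, h4]⟩

/-! ### Comparison of the solutions for two positions of an endpoint -/

section Pair

variable (hT : IsThetaKernel U V k k₁ k₂ v w F G) (hφm : Measurable φ)
  (hφb : ∀ x, ‖φ x‖ ≤ B * v x)

include hT hφm hφb

lemma IsThetaKernel.memLp_phi (hreg : IsRegular k v w A C a) :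
    MemLp φ 2 (volume.restrict (J a)) :=
  IsThetaKernel.memLp_J (IsThetaKernel.memLp_of_bound hT.memLp_v hφm hφb) hreg.nonneg hreg.le

lemma IsThetaKernel.measurable_sol (hreg : IsRegular k v w A C a) :
    Measurable (sol k (J a) φ) :=
  measurable_resolve hreg.res.meas hφm

/-- The bound depends on the endpoints only through A and C, hence is uniform while an endpoint
moves. -/
lemma IsThetaKernel.norm_sol_le (hreg : IsRegular k v w A C a) (x : ℝ) :
    ‖sol k (J a) φ x‖ ≤ (B + C * ∫ y in Ioc 0 A, w y * ‖φ y‖) * v x := by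
  have hkd := hT.ker.toIsDominated
  have hv := IsThetaKernel.memLp_J hT.memLp_v hreg.nonneg hreg.le
  have hw := IsThetaKernel.memLp_J hT.memLp_w hreg.nonneg hreg.le
  refine (norm_resolve_le hkd hreg.res hv hw (hT.memLp_phi hφm hφb hreg) hφb x).trans ?_
  refine mul_le_mul_of_nonneg_right ?_ (hkd.v_nonneg x)
  have h1 := integrable_mul_norm (hT.memLp_w A)
    (IsThetaKernel.memLp_of_bound hT.memLp_v hφm hφb A)
  have h2 : ∫ y in J a, w y * ‖φ y‖ ≤ ∫ y in Ioc 0 A, w y * ‖φ y‖ :=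
    setIntegral_mono_set h1 (Eventually.of_forall fun x =>
        mul_nonneg (hkd.w_nonneg x) (norm_nonneg _)) (J_subset hreg.nonneg hreg.le).eventuallyLE
  have := hreg.res.nonneg
  gcongr

lemma IsThetaKernel.memLp_sol (hreg : IsRegular k v w A C a) (A' : ℝ) :
    MemLp (sol k (J a) φ) 2 (volume.restrict (Ioc 0 A')) :=
  IsThetaKernel.memLp_of_bound hT.memLp_v (hT.measurable_sol hφm hφb hreg)
    (hT.norm_sol_le hφm hφb hreg) A'

/-- On the old set J the new solution solves the equation with the extra source ± ∫ k(x,y) u(y) dy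
over the interval swept out. Applying 1 + R for the old set and (1 + R) k = R gives an exact
identity, in which no resolvent kernel of the new set occurs. -/
lemma IsThetaKernel.sol_update {t : ℝ} (hreg : IsRegular k v w A C a)
    (hreg' : IsRegular k v w A C (Function.update a p t)) (x : ℝ) :
    sol k (J (Function.update a p t)) φ x = sol k (J a) φ x +
      endSign p * ∫ y in (a p)..t, resKernel k (J a) x y * sol k (J (Function.update a p t)) φ y := by
  set u := sol k (J (Function.update a p t)) φ with hu
  set R := resKernel k (J a) with hRdef
  have hkd := hT.ker.toIsDominated
  have hRd := hreg.res.isDominated hkd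
  have hv := IsThetaKernel.memLp_J hT.memLp_v hreg.nonneg hreg.le
  have hw := IsThetaKernel.memLp_J hT.memLp_w hreg.nonneg hreg.le
  have hv' := IsThetaKernel.memLp_J hT.memLp_v hreg'.nonneg hreg'.le
  have hw' := IsThetaKernel.memLp_J hT.memLp_w hreg'.nonneg hreg'.le
  have hum := hT.memLp_sol hφm hφb hreg'
  have huJ := IsThetaKernel.memLp_J hum hreg.nonneg hreg.le
  have hwu := integrable_mul_norm (hT.memLp_w A) (hum A)
  have hap : a p ∈ Icc 0 A := ⟨hreg.nonneg p, hreg.le p⟩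
  have htp : t ∈ Icc 0 A := ⟨by simpa using hreg'.nonneg p, by simpa using hreg'.le p⟩
  have hi : ∀ x, ∫ y in J (Function.update a p t), k x y * u y
      = (∫ y in J a, k x y * u y) + endSign p * ∫ y in (a p)..t, k x y * u y := fun x =>
    setIntegral_J_update hreg.mono hreg.nonneg hreg.le hreg'.mono hreg'.nonneg hreg'.le
      (hkd.integrable_mul (hum A).aestronglyMeasurable hwu x)
  have hII : ∀ {k v w}, IsDominated k v w → IntegrableOn (fun y => w y * ‖u y‖) (Ioc 0 A) →
      ∀ x, IntervalIntegrable (fun y => k x y * u y) volume (a p) t := fun hk hwu x =>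
    intervalIntegrable_of_Ioc (hk.integrable_mul (hum A).aestronglyMeasurable hwu x)
      hap.1 hap.2 htp.1 htp.2
  have key := eq_resolve hkd hreg.res hv hw (T := Set.univ)
    (h := fun x => φ x + endSign p * ∫ y in (a p)..t, k x y * u y) (u := u)
    (Eventually.of_forall fun _ => trivial) huJ (fun x _ => by
      have h1 := resolve_sub hkd hreg'.res hv' hw' (hT.memLp_phi hφm hφb hreg') x
      have h2 := hi x
      change u x - ∫ y in J (Function.update a p t), k x y * u y = φ x at h1
      rw [h2] at h1
      linear_combination h1) x trivial
  have hwv : Integrable (fun z => w z * v z) (volume.restrict (J a)) := hw.integrable_mul hv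
  obtain ⟨hint, hfub⟩ := hRd.integral_comp_interval hkd (A := A) hwv (hum A).aestronglyMeasurable
    hwu hap htp x
  have hφJ := hT.memLp_phi hφm hφb hreg
  rw [key]
  unfold resolve sol resolve
  have e1 : ∫ y in J a, R x y * (φ y + endSign p * ∫ z in (a p)..t, k y z * u z)
      = (∫ y in J a, R x y * φ y) + endSign p *
        ∫ y in J a, R x y * ∫ z in (a p)..t, k y z * u z := by
    rw [← integral_const_mul, ← integral_add (hRd.integrable_mul hφJ.aestronglyMeasurable
      (integrable_mul_norm hw hφJ) x) (hint.const_mul _)]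
    refine integral_congr_ae (Eventually.of_forall fun y => ?_)
    ring
  have e2 : ∫ y in (a p)..t, R x y * u y = (∫ y in (a p)..t, k x y * u y)
      + ∫ y in (a p)..t, (∫ z in J a, R x z * k z y) * u y := by
    have h3 : ∀ y, (∫ z in J a, R x z * k z y) * u y = R x y * u y - k x y * u y := fun y => by
      have h4 : R x y = k x y + ∫ z in J a, R x z * k z y := hreg.res.eq_right x y
      rw [h4]; ring
    simp only [h3]
    rw [intervalIntegral.integral_sub (hII hRd hwu x) (hII hkd hwu x)]
    ring
  rw [e1, hfub, e2]
  ring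

/-- Insert `sol_update` and use Fubini. Over the swept interval the integrand is ψ from the change
of the domain plus ∫ ψ R from the change of the solution, together the adjoint solution for ψ. -/
lemma IsThetaKernel.integral_sol_update {t B' : ℝ} {ψ : ℝ → ℂ} (hψm : Measurable ψ)
    (hψb : ∀ x, ‖ψ x‖ ≤ B' * w x) (hreg : IsRegular k v w A C a)
    (hreg' : IsRegular k v w A C (Function.update a p t)) :
    ∫ x in J (Function.update a p t), ψ x * sol k (J (Function.update a p t)) φ x
      = (∫ x in J a, ψ x * sol k (J a) φ x) + endSign p *
        ∫ y in (a p)..t, sol (fun x y => k y x) (J a) ψ y *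
          sol k (J (Function.update a p t)) φ y := by
  have hupd := fun x => hT.sol_update hφm hφb hreg hreg' x
  have hbd := hT.norm_sol_le hφm hφb hreg'
  have hum := hT.memLp_sol hφm hφb hreg'
  set u := sol k (J (Function.update a p t)) φ with hu
  set R := resKernel k (J a) with hRdef
  have hkd := hT.ker.toIsDominated
  have hRd := hreg.res.isDominated hkd
  have hψ := IsThetaKernel.memLp_of_bound hT.memLp_w hψm hψb
  have hψs := hT.swap.memLp_sol hψm hψb hreg.swap
  have hu0 := hT.memLp_sol hφm hφb hreg
  have hw := IsThetaKernel.memLp_J hT.memLp_w hreg.nonneg hreg.le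
  have hv := IsThetaKernel.memLp_J hT.memLp_v hreg.nonneg hreg.le
  -- ψ is regarded as a kernel constant in its first variable, so that
  -- `IsDominated.integral_comp_interval` applies; the point 0 at which it is evaluated below is
  -- arbitrary.
  have hψd : IsDominated (fun _ z => ψ z) (fun _ : ℝ => 1) (fun z => |B'| * w z) :=
    { meas := hψm.comp measurable_snd
      meas_v := measurable_const
      meas_w := hkd.meas_w.const_mul _
      v_nonneg := fun _ => zero_le_one
      w_nonneg := fun z => mul_nonneg (abs_nonneg _) (hkd.w_nonneg z)
      bound := fun x y => by
        rw [one_mul]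
        exact (hψb y).trans (mul_le_mul_of_nonneg_right (le_abs_self _) (hkd.w_nonneg y)) }
  have hwu := integrable_mul_norm (hT.memLp_w A) (hum A)
  have hap : a p ∈ Icc 0 A := ⟨hreg.nonneg p, hreg.le p⟩
  have htp : t ∈ Icc 0 A := ⟨by simpa using hreg'.nonneg p, by simpa using hreg'.le p⟩
  have hwv : Integrable (fun z => |B'| * w z * (C * v z)) (volume.restrict (J a)) :=
    (hw.const_mul _).integrable_mul (hv.const_mul _)
  obtain ⟨hint, hfub⟩ := hψd.integral_comp_interval hRd (A := A) hwv (hum A).aestronglyMeasurable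
    hwu hap htp 0
  have hψu0 : IntegrableOn (fun x => ψ x * sol k (J a) φ x) (J a) :=
    ((hψ A).integrable_mul (hu0 A)).mono_measure
      (Measure.restrict_mono (J_subset hreg.nonneg hreg.le) le_rfl)
  have hψu : IntegrableOn (fun x => ψ x * u x) (Ioc 0 A) := (hψ A).integrable_mul (hum A)
  have hsu : IntegrableOn (fun x => sol (fun x y => k y x) (J a) ψ x * u x) (Ioc 0 A) :=
    (hψs A).integrable_mul (hum A)
  rw [setIntegral_J_update hreg.mono hreg.nonneg hreg.le hreg'.mono hreg'.nonneg hreg'.le hψu]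
  have e1 : ∫ x in J a, ψ x * u x = (∫ x in J a, ψ x * sol k (J a) φ x) + endSign p *
      ∫ x in J a, ψ x * ∫ y in (a p)..t, R x y * u y := by
    rw [← integral_const_mul, ← integral_add hψu0 (hint.const_mul _)]
    refine integral_congr_ae (Eventually.of_forall fun x => ?_)
    simp only
    rw [hupd x]
    ring
  have e2 : ∫ y in (a p)..t, (∫ z in J a, ψ z * R z y) * u y
      = (∫ y in (a p)..t, sol (fun x y => k y x) (J a) ψ y * u y) - ∫ y in (a p)..t, ψ y * u y := by
    rw [← intervalIntegral.integral_sub (intervalIntegrable_of_Ioc hsu hap.1 hap.2 htp.1 htp.2)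
      (intervalIntegrable_of_Ioc hψu hap.1 hap.2 htp.1 htp.2)]
    refine intervalIntegral.integral_congr fun y _ => ?_
    simp only [sol, resolve, resKernel_swap, mul_comm (ψ _), ← hRdef]
    ring
  rw [e1, hfub, e2]
  ring

end Pair

/-- The derivative at the left endpoint of an integral whose integrand depends on the endpoint. -/
lemma hasDerivAt_integral_of_tendsto {h : ℝ → ℝ → ℂ} {s : ℝ} {L : ℂ}
    (hlim : Tendsto (Function.uncurry h) (𝓝 (s, s)) (𝓝 L))
    (hint : ∀ᶠ t in 𝓝 s, IntervalIntegrable (h t) volume s t) :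
    HasDerivAt (fun t => ∫ y in s..t, h t y) L s := by
  rw [hasDerivAt_iff_isLittleO, Asymptotics.isLittleO_iff]
  intro ε hε
  have h1 := hlim.eventually (Metric.closedBall_mem_nhds L hε)
  rw [nhds_prod_eq, Filter.eventually_prod_iff] at h1
  obtain ⟨P₁, hP₁, P₂, hP₂, hP⟩ := h1
  obtain ⟨δ, hδ, hball⟩ := Metric.eventually_nhds_iff_ball.1 hP₂
  filter_upwards [hP₁, hint, Metric.ball_mem_nhds s hδ] with t ht1 ht2 ht3
  have e : (∫ y in s..t, h t y) - (∫ y in s..s, h s y) - (t - s) • L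
      = ∫ y in s..t, (h t y - L) := by
    rw [intervalIntegral.integral_sub ht2 (by simp), intervalIntegral.integral_same,
      intervalIntegral.integral_const]
    simp
  rw [e]
  refine (intervalIntegral.norm_integral_le_of_norm_le_const (C := ε) fun y hy => ?_).trans ?_
  · have hy' : y ∈ Metric.ball s δ := by
      rw [Metric.mem_ball, Real.dist_eq] at ht3 ⊢
      have := Set.abs_sub_left_of_mem_uIcc (Set.uIoc_subset_uIcc hy)
      exact this.trans_lt ht3
    have := hP ht1 (hball y hy')
    simpa [dist_eq_norm] using this
  · rw [Real.norm_eq_abs]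

/-! ### Derivatives with respect to an endpoint -/

section Derivatives

variable (hT : IsThetaKernel U V k k₁ k₂ v w F G) (hφm : Measurable φ)
  (hφb : ∀ x, ‖φ x‖ ≤ B * v x) (hp : 0 < a p)
  (hreg : ∀ᶠ t in 𝓝 (a p), IsRegular k v w A C (Function.update a p t))

include hT hφm hφb hp hreg

lemma IsThetaKernel.isRegular_self : IsRegular k v w A C a := by
  simpa using hreg.self_of_nhds

lemma IsThetaKernel.continuousAt_sol {x : ℝ} (hx : x ∈ U) (hc : ContinuousAt φ x) :
    ContinuousAt (sol k (J a) φ) x := by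
  have h := hT.isRegular_self hφm hφb hp hreg
  have h0 := IsThetaKernel.ae_pos h.nonneg h.le
  exact continuousAt_resolve hT.ker h.res (IsThetaKernel.memLp_J hT.memLp_v h.nonneg h.le)
    (IsThetaKernel.memLp_J hT.memLp_w h.nonneg h.le) (h0.mono fun x hx => hT.subU hx)
    (h0.mono fun x hx => hT.subV hx) (hT.memLp_phi hφm hφb h) hx hc

lemma IsThetaKernel.continuousAt_resKernel {x y : ℝ} (hx : x ∈ U) (hy : y ∈ V) :
    ContinuousAt (Function.uncurry (resKernel k (J a))) (x, y) := by
  have h := hT.isRegular_self hφm hφb hp hreg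
  have h0 := IsThetaKernel.ae_pos h.nonneg h.le
  exact continuousAt_resolventKernel hT.ker h.res (IsThetaKernel.memLp_J hT.memLp_v h.nonneg h.le)
    (IsThetaKernel.memLp_J hT.memLp_w h.nonneg h.le) (h0.mono fun x hx => hT.subU hx)
    (h0.mono fun x hx => hT.subV hx) hx hy

/-- By `sol_update` and the uniform bounds on R and on the new solution, the two solutions differ by
O(|t - a_p|) locally uniformly; the old one is continuous. -/
lemma IsThetaKernel.tendsto_sol_update (hc : ContinuousAt φ (a p)) :
    Tendsto (fun q : ℝ × ℝ => sol k (J (Function.update a p q.1)) φ q.2) (𝓝 (a p, a p))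
      (𝓝 (sol k (J a) φ (a p))) := by
  have h0 := hT.isRegular_self hφm hφb hp hreg
  have hRc := hT.continuousAt_resKernel hφm hφb hp hreg (hT.subU hp) (hT.subV hp)
  set R := resKernel k (J a) with hR
  set L := ‖R (a p) (a p)‖ + 1 with hL
  have hRb : ∀ᶠ q in 𝓝 (a p, a p), ‖Function.uncurry R q‖ ≤ L :=
    (hRc.norm.eventually (gt_mem_nhds (by simp [hL]))).mono fun q hq => le_of_lt hq
  obtain ⟨b, hb⟩ := hT.ker.locU (a p) (hT.subU hp)
  set B' := B + C * ∫ y in Ioc 0 A, w y * ‖φ y‖ with hB'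
  rw [nhds_prod_eq, Filter.eventually_prod_iff] at hRb
  obtain ⟨P₁, hP₁, P₂, hP₂, hP⟩ := hRb
  obtain ⟨δ, hδ, hball⟩ := Metric.eventually_nhds_iff_ball.1 (hP₂.and hb)
  have hlim0 : Tendsto (fun q : ℝ × ℝ => sol k (J a) φ q.2) (𝓝 (a p, a p))
      (𝓝 (sol k (J a) φ (a p))) :=
    (hT.continuousAt_sol hφm hφb hp hreg (hT.subU hp) hc).tendsto.comp continuous_snd.continuousAt
  have hdiff : Tendsto (fun q : ℝ × ℝ => sol k (J (Function.update a p q.1)) φ q.2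
      - sol k (J a) φ q.2) (𝓝 (a p, a p)) (𝓝 0) := by
    have hz : Tendsto (fun q : ℝ × ℝ => (L * (|B'| * b)) * |q.1 - a p|) (𝓝 (a p, a p)) (𝓝 0) := by
      have : Continuous fun q : ℝ × ℝ => (L * (|B'| * b)) * |q.1 - a p| := by fun_prop
      have h := this.tendsto (a p, a p)
      simpa using h
    refine squeeze_zero_norm' ?_ hz
    rw [nhds_prod_eq]
    filter_upwards [prod_mem_prod (inter_mem hreg (Metric.ball_mem_nhds (a p) hδ)) hP₁]
      with q hq
    have hq1 : IsRegular k v w A C (Function.update a p q.1) := hq.1.1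
    rw [hT.sol_update hφm hφb h0 hq1, add_sub_cancel_left, norm_mul]
    have hs : ‖endSign p‖ = 1 := by unfold endSign; split_ifs <;> simp
    rw [hs, one_mul]
    refine intervalIntegral.norm_integral_le_of_norm_le_const fun y hy => ?_
    have hy' : y ∈ Metric.ball (a p) δ := by
      have h1 := hq.1.2
      rw [Metric.mem_ball, Real.dist_eq] at h1 ⊢
      exact (Set.abs_sub_left_of_mem_uIcc (Set.uIoc_subset_uIcc hy)).trans_lt h1
    have h2 := hball y hy'
    have h3 : ‖R q.2 y‖ ≤ L := hP hq.2 h2.1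
    have h4 := hT.norm_sol_le hφm hφb hq1 y
    rw [norm_mul]
    have h5 : 0 ≤ v y := hT.ker.v_nonneg y
    refine mul_le_mul h3 (h4.trans ?_) (norm_nonneg _) ((norm_nonneg _).trans h3)
    calc B' * v y ≤ |B'| * v y := mul_le_mul_of_nonneg_right (le_abs_self _) h5
      _ ≤ |B'| * b := mul_le_mul_of_nonneg_left h2.2 (abs_nonneg _)
  simpa using hdiff.add hlim0

/-- The derivative of the integral term in `sol_update`. -/
lemma IsThetaKernel.hasDerivAt_integral_resKernel (hc : ContinuousAt φ (a p)) {x : ℝ → ℝ}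
    (hx : x (a p) ∈ U) (hxc : ContinuousAt x (a p)) :
    HasDerivAt (fun t => ∫ y in (a p)..t, resKernel k (J a) (x t) y *
      sol k (J (Function.update a p t)) φ y)
      (resKernel k (J a) (x (a p)) (a p) * sol k (J a) φ (a p)) (a p) := by
  have h0 := hT.isRegular_self hφm hφb hp hreg
  have hkd := hT.ker.toIsDominated
  have hRd := h0.res.isDominated hkd
  refine hasDerivAt_integral_of_tendsto
    (h := fun t y => resKernel k (J a) (x t) y * sol k (J (Function.update a p t)) φ y) ?_ ?_
  · have h1 := hT.continuousAt_resKernel hφm hφb hp hreg hx (hT.subV hp)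
    have h2 : Tendsto (fun q : ℝ × ℝ => (x q.1, q.2)) (𝓝 (a p, a p)) (𝓝 (x (a p), a p)) := by
      rw [nhds_prod_eq, nhds_prod_eq]
      exact Tendsto.prodMap hxc tendsto_id
    have h3 : Tendsto (fun q : ℝ × ℝ => resKernel k (J a) (x q.1) q.2) (𝓝 (a p, a p))
        (𝓝 (resKernel k (J a) (x (a p)) (a p))) := by
      generalize resKernel k (J a) = R at h1
      exact Tendsto.comp h1 h2
    exact h3.mul (hT.tendsto_sol_update hφm hφb hp hreg hc)
  · filter_upwards [hreg] with t ht
    have hum := hT.memLp_sol hφm hφb ht A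
    exact intervalIntegrable_of_Ioc (hRd.integrable_mul hum.aestronglyMeasurable
      (integrable_mul_norm (hT.memLp_w A) hum) _) (h0.nonneg p) (h0.le p)
      (by simpa using ht.nonneg p) (by simpa using ht.le p)

lemma IsThetaKernel.hasDerivAt_sol (hc : ContinuousAt φ (a p)) {x : ℝ} (hx : x ∈ U) :
    HasDerivAt (fun t => sol k (J (Function.update a p t)) φ x)
      (endSign p * (resKernel k (J a) x (a p) * sol k (J a) φ (a p))) (a p) := by
  have h0 := hT.isRegular_self hφm hφb hp hreg
  have h1 := ((hT.hasDerivAt_integral_resKernel hφm hφb hp hreg hc (x := fun _ => x) hx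
    continuousAt_const).const_mul (endSign p)).const_add (sol k (J a) φ x)
  refine h1.congr_of_eventuallyEq ?_
  filter_upwards [hreg] with t ht using hT.sol_update hφm hφb h0 ht x

/-- The endpoint is also the evaluation point here. In `sol_update` the first term is the old
solution at t, the second an integral from a_p to t; their derivatives add up. -/
lemma IsThetaKernel.hasDerivAt_sol_diag (hc : ContinuousAt φ (a p)) {d : ℂ}
    (hd : HasDerivAt (sol k (J a) φ) d (a p)) :
    HasDerivAt (fun t => sol k (J (Function.update a p t)) φ t)
      (d + endSign p * (resKernel k (J a) (a p) (a p) * sol k (J a) φ (a p))) (a p) := by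
  have h0 := hT.isRegular_self hφm hφb hp hreg
  have h1 := hd.add ((hT.hasDerivAt_integral_resKernel hφm hφb hp hreg hc (x := fun t => t)
    (hT.subU hp) continuousAt_id).const_mul (endSign p))
  refine h1.congr_of_eventuallyEq ?_
  filter_upwards [hreg] with t ht using hT.sol_update hφm hφb h0 ht t

lemma IsThetaKernel.hasDerivAt_integral_sol {B' : ℝ} {ψ : ℝ → ℂ} (hψm : Measurable ψ)
    (hψb : ∀ x, ‖ψ x‖ ≤ B' * w x) (hc : ContinuousAt φ (a p)) (hcψ : ContinuousAt ψ (a p)) :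
    HasDerivAt (fun t => ∫ x in J (Function.update a p t),
      ψ x * sol k (J (Function.update a p t)) φ x)
      (endSign p * (sol (fun x y => k y x) (J a) ψ (a p) * sol k (J a) φ (a p))) (a p) := by
  have h0 := hT.isRegular_self hφm hφb hp hreg
  have hψs := hT.swap.memLp_sol hψm hψb h0.swap A
  have h1 : HasDerivAt (fun t => ∫ y in (a p)..t, sol (fun x y => k y x) (J a) ψ y *
      sol k (J (Function.update a p t)) φ y)
      (sol (fun x y => k y x) (J a) ψ (a p) * sol k (J a) φ (a p)) (a p) := by
    refine hasDerivAt_integral_of_tendsto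
      (h := fun t y => sol (fun x y => k y x) (J a) ψ y *
        sol k (J (Function.update a p t)) φ y) ?_ ?_
    · refine Tendsto.mul ?_ (hT.tendsto_sol_update hφm hφb hp hreg hc)
      exact (hT.swap.continuousAt_sol hψm hψb hp (hreg.mono fun t ht => ht.swap) (hT.subV hp)
        hcψ).tendsto.comp continuous_snd.continuousAt
    · filter_upwards [hreg] with t ht
      have hum := hT.memLp_sol hφm hφb ht A
      exact intervalIntegrable_of_Ioc (hψs.integrable_mul hum) (h0.nonneg p) (h0.le p)
        (by simpa using ht.nonneg p) (by simpa using ht.le p)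
  refine ((h1.const_mul (endSign p)).const_add
    (∫ x in J a, ψ x * sol k (J a) φ x)).congr_of_eventuallyEq ?_
  filter_upwards [hreg] with t ht using hT.integral_sol_update hφm hφb hψm hψb h0 ht

end Derivatives

end Moving

end GenBessel

end

noncomputable section

namespace GenBessel

/-! ### Kernels of the form `∫_0^1 F(tx) G(ty) dt` -/

/-- `∫_0^1 F(tx) G(ty) dt`. -/
def scaleKernel (F G : ℝ → ℂ) (x y : ℝ) : ℂ := ∫ t in Ioc (0 : ℝ) 1, F (t * x) * G (t * y)

/-- `F` is continuous and bounded by the monotone function `p` of `|x|`. -/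
structure IsLeftFactor (p : ℝ → ℝ) (F : ℝ → ℂ) : Prop where
  mono : Monotone p
  nonneg : ∀ x, 0 ≤ p x
  cont : Continuous F
  bound : ∀ x, ‖F x‖ ≤ p |x|

/-- `G` is continuous on `(0, ∞)`, zero elsewhere, and bounded by `q(y) y ^ (-1/4)` for a monotone
function `q`. -/
structure IsRightFactor (q : ℝ → ℝ) (G : ℝ → ℂ) : Prop where
  mono : Monotone q
  nonneg : ∀ x, 0 ≤ q x
  meas : Measurable G
  zero : ∀ y, y ≤ 0 → G y = 0
  cont : ∀ y, 0 < y → ContinuousAt G y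
  bound : ∀ y, 0 < y → ‖G y‖ ≤ q y * y ^ (-1 / 4 : ℝ)

/-- The weight of a right factor. -/
def rightWeight (q : ℝ → ℝ) (y : ℝ) : ℝ := if 0 < y then 4 / 3 * q y * y ^ (-1 / 4 : ℝ) else 0

lemma integrableOn_rpow_unit : IntegrableOn (fun t : ℝ => t ^ (-1 / 4 : ℝ)) (Ioc 0 1) := by
  have := intervalIntegral.intervalIntegrable_rpow' (r := -1 / 4) (a := 0) (b := 1) (by norm_num)
  rwa [intervalIntegrable_iff_integrableOn_Ioc_of_le zero_le_one] at this

/-- The source of the constant in `rightWeight`. -/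
lemma setIntegral_rpow_unit : ∫ t in Ioc (0 : ℝ) 1, t ^ (-1 / 4 : ℝ) = 4 / 3 := by
  rw [← intervalIntegral.integral_of_le zero_le_one, integral_rpow (Or.inl (by norm_num))]
  norm_num

section ScaleKernel

variable {p q : ℝ → ℝ} {F F₁ G G₁ : ℝ → ℂ}

lemma IsLeftFactor.bound_scale (hF : IsLeftFactor p F) {t r : ℝ} (ht : t ∈ Ioc (0 : ℝ) 1) {x : ℝ}
    (hx : |x| ≤ r) : ‖F (t * x)‖ ≤ p r := by
  refine (hF.bound _).trans (hF.mono ?_)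
  rw [abs_mul, abs_of_pos ht.1]
  exact (mul_le_of_le_one_left (abs_nonneg x) ht.2).trans hx

lemma IsRightFactor.bound_scale (hG : IsRightFactor q G) {t s r : ℝ} (ht : t ∈ Ioc (0 : ℝ) 1)
    (hs : 0 < s) {y : ℝ} (hsy : s ≤ y) (hy : y ≤ r) :
    ‖G (t * y)‖ ≤ q r * s ^ (-1 / 4 : ℝ) * t ^ (-1 / 4 : ℝ) := by
  have hy0 : 0 < y := hs.trans_le hsy
  refine (hG.bound _ (mul_pos ht.1 hy0)).trans ?_
  rw [Real.mul_rpow ht.1.le hy0.le, mul_assoc, mul_comm (t ^ (-1 / 4 : ℝ))]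
  have h1 : q (t * y) ≤ q r := hG.mono ((mul_le_of_le_one_left hy0.le ht.2).trans hy)
  have h2 : y ^ (-1 / 4 : ℝ) ≤ s ^ (-1 / 4 : ℝ) :=
    Real.rpow_le_rpow_of_nonpos hs hsy (by norm_num)
  have h3 := Real.rpow_nonneg ht.1.le (-1 / 4 : ℝ)
  have h4 := Real.rpow_nonneg hy0.le (-1 / 4 : ℝ)
  have h5 := hG.nonneg r
  gcongr

lemma norm_mul_scale_le (hF : IsLeftFactor p F) (hG : IsRightFactor q G) {t s r b : ℝ}
    (ht : t ∈ Ioc (0 : ℝ) 1) {x y : ℝ} (hx : |x| ≤ b) (hs : 0 < s) (hsy : s ≤ y) (hy : y ≤ r) :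
    ‖F (t * x) * G (t * y)‖ ≤ p b * (q r * s ^ (-1 / 4 : ℝ)) * t ^ (-1 / 4 : ℝ) := by
  rw [norm_mul, mul_assoc]
  exact mul_le_mul (hF.bound_scale ht hx) (hG.bound_scale ht hs hsy hy) (norm_nonneg _)
    (hF.nonneg _)

lemma measurable_mul_scale (hF : IsLeftFactor p F) (hG : IsRightFactor q G) (x y : ℝ) :
    Measurable fun t : ℝ => F (t * x) * G (t * y) :=
  (hF.cont.measurable.comp (measurable_id.mul_const x)).mul
    (hG.meas.comp (measurable_id.mul_const y))

lemma integrableOn_mul_scale (hF : IsLeftFactor p F) (hG : IsRightFactor q G) (x : ℝ) {y : ℝ}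
    (hy : 0 < y) : IntegrableOn (fun t : ℝ => F (t * x) * G (t * y)) (Ioc 0 1) := by
  refine Integrable.mono' (integrableOn_rpow_unit.const_mul (p |x| * (q y * y ^ (-1 / 4 : ℝ))))
    (measurable_mul_scale hF hG x y).aestronglyMeasurable ?_
  filter_upwards [self_mem_ae_restrict measurableSet_Ioc] with t ht
  exact norm_mul_scale_le hF hG ht le_rfl hy le_rfl le_rfl

lemma rightWeight_nonneg (hq : ∀ x, 0 ≤ q x) (y : ℝ) : 0 ≤ rightWeight q y := by
  unfold rightWeight
  split_ifs with h
  · exact mul_nonneg (mul_nonneg (by norm_num) (hq y)) (Real.rpow_nonneg h.le _)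
  · exact le_rfl

lemma measurable_rightWeight (hq : Monotone q) : Measurable (rightWeight q) :=
  Measurable.ite measurableSet_Ioi ((hq.measurable.const_mul _).mul
    (measurable_id.pow_const _)) measurable_const

/-- For t ≤ 1 monotonicity gives |F(tx)| ≤ p|x| and |G(ty)| ≤ q(y) y^(-1/4) t^(-1/4); integrating
t^(-1/4) leaves a product of a function of x and a function of y. -/
lemma isDominated_scaleKernel (hF : IsLeftFactor p F) (hG : IsRightFactor q G) :
    IsDominated (scaleKernel F G) (fun x => p |x|) (rightWeight q) where
  meas := by
    have : StronglyMeasurable fun z : (ℝ × ℝ) × ℝ => F (z.2 * z.1.1) * G (z.2 * z.1.2) :=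
      ((hF.cont.measurable.comp (by fun_prop)).mul (hG.meas.comp (by fun_prop))).stronglyMeasurable
    exact (this.integral_prod_right' (ν := volume.restrict (Ioc 0 1))).measurable
  meas_v := hF.mono.measurable.comp (by fun_prop)
  meas_w := measurable_rightWeight hG.mono
  v_nonneg x := hF.nonneg _
  w_nonneg := rightWeight_nonneg hG.nonneg
  bound x y := by
    unfold rightWeight
    split_ifs with hy
    · have h := norm_integral_le_of_norm_le (μ := volume.restrict (Ioc (0 : ℝ) 1))
        (f := fun t => F (t * x) * G (t * y))
        (integrableOn_rpow_unit.const_mul (p |x| * (q y * y ^ (-1 / 4 : ℝ)))) (by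
          filter_upwards [self_mem_ae_restrict measurableSet_Ioc] with t ht
          exact norm_mul_scale_le hF hG ht le_rfl hy le_rfl le_rfl)
      refine h.trans (le_of_eq ?_)
      rw [integral_const_mul, setIntegral_rpow_unit]
      ring
    · have : scaleKernel F G x y = ∫ t in Ioc (0 : ℝ) 1, (0 : ℂ) := by
        refine setIntegral_congr_fun measurableSet_Ioc fun t ht => ?_
        rw [hG.zero _ (mul_nonpos_of_nonneg_of_nonpos ht.1.le (not_lt.mp hy)), mul_zero]
      simp [this]

lemma isKernel_scaleKernel (hF : IsLeftFactor p F) (hG : IsRightFactor q G) :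
    IsKernel univ (Ioi 0) (scaleKernel F G) (fun x => p |x|) (rightWeight q) where
  toIsDominated := isDominated_scaleKernel hF hG
  openU := isOpen_univ
  openV := isOpen_Ioi
  cont x _ y hy := by
    have hy : 0 < y := hy
    have hev : ∀ᶠ z : ℝ × ℝ in 𝓝 (x, y), |z.1| ≤ |x| + 1 ∧ y / 2 ≤ z.2 ∧ z.2 ≤ y + 1 := by
      refine ((continuous_fst.abs.tendsto (x, y)).eventually_le_const (by simp)).and
        (((continuous_snd.tendsto (x, y)).eventually_const_le (by simpa using hy)).and
        ((continuous_snd.tendsto (x, y)).eventually_le_const (by simp)))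
    refine continuousAt_of_dominated (F := fun (z : ℝ × ℝ) t => F (t * z.1) * G (t * z.2))
      (bound := fun t => p (|x| + 1) * (q (y + 1) * (y / 2) ^ (-1 / 4 : ℝ)) * t ^ (-1 / 4 : ℝ))
      (Eventually.of_forall fun z => (measurable_mul_scale hF hG _ _).aestronglyMeasurable) ?_
      (integrableOn_rpow_unit.const_mul _) ?_
    · filter_upwards [hev] with z hz
      filter_upwards [self_mem_ae_restrict measurableSet_Ioc] with t ht
      exact norm_mul_scale_le hF hG ht hz.1 (half_pos hy) hz.2.1 hz.2.2
    · filter_upwards [self_mem_ae_restrict measurableSet_Ioc] with t ht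
      refine ContinuousAt.mul ((hF.cont.comp (by fun_prop)).continuousAt) ?_
      exact ContinuousAt.comp (f := fun z : ℝ × ℝ => t * z.2) (hG.cont _ (mul_pos ht.1 hy))
        (by fun_prop)
  locU x _ := ⟨p (|x| + 1), by
    filter_upwards [(continuous_abs.tendsto x).eventually_le_const (lt_add_one |x|)] with y hy
    exact hF.mono hy⟩
  locV y hy := by
    have hy : 0 < y := hy
    refine ⟨4 / 3 * q (y + 1) * (y / 2) ^ (-1 / 4 : ℝ), ?_⟩
    filter_upwards [Ioo_mem_nhds (half_lt_self hy) (lt_add_one y)] with z hz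
    have hz0 : 0 < z := (half_pos hy).trans hz.1
    rw [rightWeight, if_pos hz0]
    have h1 := hG.mono hz.2.le
    have h2 : z ^ (-1 / 4 : ℝ) ≤ (y / 2) ^ (-1 / 4 : ℝ) :=
      Real.rpow_le_rpow_of_nonpos (half_pos hy) hz.1.le (by norm_num)
    have h4 := Real.rpow_nonneg hz0.le (-1 / 4 : ℝ)
    have h5 := hG.nonneg (y + 1)
    gcongr

lemma hasDerivAt_scaleKernel_left (hF : IsLeftFactor p F) (hF₁ : IsLeftFactor p F₁)
    (hG : IsRightFactor q G) (hd : ∀ x, 0 < x → HasDerivAt F (F₁ x / x) x) {x y : ℝ} (hx : 0 < x)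
    (hy : 0 < y) : HasDerivAt (fun x => scaleKernel F G x y) (scaleKernel F₁ G x y / x) x := by
  have hnhds : Ioo (x / 2) (x + 1) ∈ 𝓝 x := Ioo_mem_nhds (half_lt_self hx) (lt_add_one x)
  have h := (hasDerivAt_integral_of_dominated_loc_of_deriv_le
    (μ := volume.restrict (Ioc (0 : ℝ) 1)) (F := fun x t => F (t * x) * G (t * y))
    (F' := fun x t => F₁ (t * x) * G (t * y) / x) (x₀ := x) (s := Ioo (x / 2) (x + 1))
    (bound := fun t => p (x + 1) * (q y * y ^ (-1 / 4 : ℝ)) / (x / 2) * t ^ (-1 / 4 : ℝ))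
    hnhds (Eventually.of_forall fun z => (measurable_mul_scale hF hG _ _).aestronglyMeasurable)
    (integrableOn_mul_scale hF hG x hy)
    ((measurable_mul_scale hF₁ hG _ _).div_const _).aestronglyMeasurable ?_
    (integrableOn_rpow_unit.const_mul _) ?_).2
  · rwa [integral_div] at h
  · filter_upwards [self_mem_ae_restrict measurableSet_Ioc] with t ht z hz
    have hz0 : 0 < z := (half_pos hx).trans hz.1
    have h1 := norm_mul_scale_le hF₁ hG (x := z) (b := x + 1) ht
      (by rw [abs_of_pos hz0]; exact hz.2.le) hy le_rfl le_rfl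
    rw [norm_div, Complex.norm_real, Real.norm_of_nonneg hz0.le, div_mul_eq_mul_div]
    exact div_le_div₀ ((norm_nonneg _).trans h1) h1 (half_pos hx) hz.1.le
  · filter_upwards [self_mem_ae_restrict measurableSet_Ioc] with t ht z hz
    have hz0 : 0 < z := (half_pos hx).trans hz.1
    have h1 := ((hd (t * z) (mul_pos ht.1 hz0)).scomp z ((hasDerivAt_id z).const_mul t)).mul_const
      (G (t * y))
    refine h1.congr_deriv ?_
    have h2 : (t : ℂ) ≠ 0 := by exact_mod_cast ht.1.ne'
    have h3 : (z : ℂ) ≠ 0 := by exact_mod_cast hz0.ne'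
    simp only [mul_one, Complex.real_smul, Complex.ofReal_mul]
    field_simp

lemma hasDerivAt_scaleKernel_right (hF : IsLeftFactor p F) (hG : IsRightFactor q G)
    (hG₁ : IsRightFactor q G₁) (hd : ∀ x, 0 < x → HasDerivAt G (G₁ x / x) x) (x : ℝ) {y : ℝ}
    (hy : 0 < y) : HasDerivAt (fun y => scaleKernel F G x y) (scaleKernel F G₁ x y / y) y := by
  have hnhds : Ioo (y / 2) (y + 1) ∈ 𝓝 y := Ioo_mem_nhds (half_lt_self hy) (lt_add_one y)
  have h := (hasDerivAt_integral_of_dominated_loc_of_deriv_le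
    (μ := volume.restrict (Ioc (0 : ℝ) 1)) (F := fun y t => F (t * x) * G (t * y))
    (F' := fun y t => F (t * x) * G₁ (t * y) / y) (x₀ := y) (s := Ioo (y / 2) (y + 1))
    (bound := fun t => p |x| * (q (y + 1) * (y / 2) ^ (-1 / 4 : ℝ)) / (y / 2) * t ^ (-1 / 4 : ℝ))
    hnhds (Eventually.of_forall fun z => (measurable_mul_scale hF hG _ _).aestronglyMeasurable)
    (integrableOn_mul_scale hF hG x hy)
    ((measurable_mul_scale hF hG₁ _ _).div_const _).aestronglyMeasurable ?_
    (integrableOn_rpow_unit.const_mul _) ?_).2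
  · rwa [integral_div] at h
  · filter_upwards [self_mem_ae_restrict measurableSet_Ioc] with t ht z hz
    have hz0 : 0 < z := (half_pos hy).trans hz.1
    have h1 := norm_mul_scale_le hF hG₁ (x := x) ht le_rfl (half_pos hy) hz.1.le hz.2.le
    rw [norm_div, Complex.norm_real, Real.norm_of_nonneg hz0.le, div_mul_eq_mul_div]
    exact div_le_div₀ ((norm_nonneg _).trans h1) h1 (half_pos hy) hz.1.le
  · filter_upwards [self_mem_ae_restrict measurableSet_Ioc] with t ht z hz
    have hz0 : 0 < z := (half_pos hy).trans hz.1
    have h1 := ((hd (t * z) (mul_pos ht.1 hz0)).scomp z ((hasDerivAt_id z).const_mul t)).const_mul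
      (F (t * x))
    refine h1.congr_deriv ?_
    have h2 : (t : ℂ) ≠ 0 := by exact_mod_cast ht.1.ne'
    have h3 : (z : ℂ) ≠ 0 := by exact_mod_cast hz0.ne'
    simp only [mul_one, Complex.real_smul, Complex.ofReal_mul]
    field_simp

lemma tendsto_rpow_zero {r : ℝ} (hr : 0 < r) : Tendsto (fun t : ℝ => t ^ r) (𝓝[>] 0) (𝓝 0) := by
  have := (Real.continuousAt_rpow_const 0 r (Or.inr hr.le)).tendsto
  rw [Real.zero_rpow hr.ne'] at this
  exact this.mono_left nhdsWithin_le_nhds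

/-- The left-hand side is the integral over (0, 1) of d/dt [t F(tx) G(ty)], and t F(tx) G(ty) is
O(t^(3/4)) at 0. -/
lemma scaleKernel_euler (hF : IsLeftFactor p F) (hF₁ : IsLeftFactor p F₁)
    (hG : IsRightFactor q G) (hG₁ : IsRightFactor q G₁)
    (hdF : ∀ x, 0 < x → HasDerivAt F (F₁ x / x) x)
    (hdG : ∀ x, 0 < x → HasDerivAt G (G₁ x / x) x) {x y : ℝ} (hx : 0 < x) (hy : 0 < y) :
    scaleKernel F₁ G x y + scaleKernel F G₁ x y + scaleKernel F G x y = F x * G y := by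
  have i1 := integrableOn_mul_scale hF₁ hG x hy
  have i2 := integrableOn_mul_scale hF hG₁ x hy
  have i3 := integrableOn_mul_scale hF hG x hy
  have hsum : IntegrableOn (fun t : ℝ => F₁ (t * x) * G (t * y) + F (t * x) * G₁ (t * y)
      + F (t * x) * G (t * y)) (Ioc 0 1) := (i1.add i2).add i3
  have e : scaleKernel F₁ G x y + scaleKernel F G₁ x y + scaleKernel F G x y
      = ∫ t in (0 : ℝ)..1, (F₁ (t * x) * G (t * y) + F (t * x) * G₁ (t * y)
        + F (t * x) * G (t * y)) := by
    have i12 : IntegrableOn (fun t : ℝ => F₁ (t * x) * G (t * y) + F (t * x) * G₁ (t * y))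
      (Ioc 0 1) := i1.add i2
    rw [intervalIntegral.integral_of_le zero_le_one, integral_add i12 i3, integral_add i1 i2]
    rfl
  have hder : ∀ t : ℝ, 0 < t → HasDerivAt (fun t : ℝ => (t : ℂ) * (F (t * x) * G (t * y)))
      (F₁ (t * x) * G (t * y) + F (t * x) * G₁ (t * y) + F (t * x) * G (t * y)) t := by
    intro t ht
    have h1 := (hdF (t * x) (mul_pos ht hx)).scomp t ((hasDerivAt_id t).mul_const x)
    have h2 := (hdG (t * y) (mul_pos ht hy)).scomp t ((hasDerivAt_id t).mul_const y)
    have h3 := (Complex.ofRealCLM.hasDerivAt (x := t)).mul (h1.mul h2)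
    refine h3.congr_deriv ?_
    have n1 : (t : ℂ) ≠ 0 := by exact_mod_cast ht.ne'
    have n2 : (x : ℂ) ≠ 0 := by exact_mod_cast hx.ne'
    have n3 : (y : ℂ) ≠ 0 := by exact_mod_cast hy.ne'
    simp only [one_mul, Complex.real_smul, Complex.ofReal_mul, Complex.ofRealCLM_apply,
      Complex.ofReal_one, Function.comp, id]
    simp only [Pi.mul_apply, Function.comp]
    field_simp
    ring
  rw [e, intervalIntegral.integral_eq_sub_of_hasDerivAt_of_tendsto zero_lt_one
    (fun t ht => hder t ht.1) ((intervalIntegrable_iff_integrableOn_Ioc_of_le zero_le_one).mpr hsum)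
    (fa := 0) (fb := F x * G y)]
  · ring
  · refine squeeze_zero_norm' (a := fun t => p |x| * (q y * y ^ (-1 / 4 : ℝ)) * t ^ (3 / 4 : ℝ))
      ?_ ?_
    · filter_upwards [Ioc_mem_nhdsGT (zero_lt_one' ℝ)] with t ht
      rw [norm_mul, Complex.norm_real, Real.norm_of_nonneg ht.1.le]
      refine (mul_le_mul_of_nonneg_left (norm_mul_scale_le hF hG ht le_rfl hy le_rfl le_rfl)
        ht.1.le).trans (le_of_eq ?_)
      have : t ^ (3 / 4 : ℝ) = t * t ^ (-1 / 4 : ℝ) := by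
        rw [← Real.rpow_one_add' ht.1.le (by norm_num)]; norm_num
      rw [this]; ring
    · simpa using (tendsto_rpow_zero (r := 3 / 4) (by norm_num)).const_mul
        (p |x| * (q y * y ^ (-1 / 4 : ℝ)))
  · have h := (hder 1 zero_lt_one).continuousAt.tendsto.mono_left
      (nhdsWithin_le_nhds (s := Iio 1))
    simpa using h

lemma memLp_rightWeight (hq : Monotone q) (hq0 : ∀ x, 0 ≤ q x) (A : ℝ) :
    MemLp (rightWeight q) 2 (volume.restrict (Ioc 0 A)) := by
  have h1 : MemLp (fun y : ℝ => y ^ (-1 / 4 : ℝ)) 2 (volume.restrict (Ioc 0 A)) := by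
    have hm : Measurable fun y : ℝ => y ^ (-1 / 4 : ℝ) := by fun_prop
    rw [memLp_two_iff_integrable_sq hm.aestronglyMeasurable]
    rcases le_or_gt A 0 with hA | hA
    · rw [Ioc_eq_empty (not_lt.mpr hA)]; simp
    · have h2 := intervalIntegral.intervalIntegrable_rpow' (r := -1 / 2) (a := 0) (b := A)
        (by norm_num)
      rw [intervalIntegrable_iff_integrableOn_Ioc_of_le hA.le] at h2
      refine h2.congr_fun (fun y hy => ?_) measurableSet_Ioc
      simp only
      rw [← Real.rpow_natCast, ← Real.rpow_mul hy.1.le]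
      norm_num
  refine (h1.const_mul (4 / 3 * q A)).mono' (measurable_rightWeight hq).aestronglyMeasurable ?_
  filter_upwards [self_mem_ae_restrict measurableSet_Ioc] with y hy
  rw [Real.norm_of_nonneg (rightWeight_nonneg hq0 y), rightWeight, if_pos hy.1]
  have h4 := Real.rpow_nonneg hy.1.le (-1 / 4 : ℝ)
  have h5 := hq hy.2
  gcongr

lemma memLp_leftWeight (hp : Monotone p) (hp0 : ∀ x, 0 ≤ p x) (A : ℝ) :
    MemLp (fun x => p |x|) 2 (volume.restrict (Ioc 0 A)) := by
  refine MemLp.of_bound (hp.measurable.comp (by fun_prop)).aestronglyMeasurable (p A) ?_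
  filter_upwards [self_mem_ae_restrict measurableSet_Ioc] with y hy
  rw [Real.norm_of_nonneg (hp0 _), abs_of_pos hy.1]
  exact hp hy.2

lemma IsRightFactor.norm_le (hG : IsRightFactor q G) (y : ℝ) : ‖G y‖ ≤ rightWeight q y := by
  unfold rightWeight
  split_ifs with hy
  · refine (hG.bound y hy).trans ?_
    have h1 := mul_nonneg (hG.nonneg y) (Real.rpow_nonneg hy.le (-1 / 4 : ℝ))
    nlinarith
  · rw [hG.zero y (not_lt.mp hy), norm_zero]

/-- Differentiation keeps the form of the kernel and replaces one factor by its logarithmic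
derivative. The factors and their derivatives are required to share the bounds p and q, so that one
pair of weights dominates all three kernels. -/
lemma isThetaKernel_scaleKernel (hF : IsLeftFactor p F) (hF₁ : IsLeftFactor p F₁)
    (hG : IsRightFactor q G) (hG₁ : IsRightFactor q G₁)
    (hdF : ∀ x, 0 < x → HasDerivAt F (F₁ x / x) x)
    (hdG : ∀ x, 0 < x → HasDerivAt G (G₁ x / x) x) :
    IsThetaKernel univ (Ioi 0) (scaleKernel F G) (scaleKernel F₁ G) (scaleKernel F G₁)
      (fun x => p |x|) (rightWeight q) F G where
  ker := isKernel_scaleKernel hF hG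
  ker₁ := isKernel_scaleKernel hF₁ hG
  ker₂ := isKernel_scaleKernel hF hG₁
  subU := subset_univ _
  subV := Subset.rfl
  memLp_v := memLp_leftWeight hF.mono hF.nonneg
  memLp_w := memLp_rightWeight hG.mono hG.nonneg
  vanish := by
    refine squeeze_zero_norm' (a := fun t => p 1 * (4 / 3 * q 1) * t ^ (3 / 4 : ℝ)) ?_ ?_
    · filter_upwards [Ioc_mem_nhdsGT (zero_lt_one' ℝ)] with t ht
      have h0 := rightWeight_nonneg hG.nonneg t
      have h1 := hF.nonneg |t|
      rw [Real.norm_of_nonneg (mul_nonneg ht.1.le (mul_nonneg h1 h0)), rightWeight, if_pos ht.1,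
        abs_of_pos ht.1]
      have : t ^ (3 / 4 : ℝ) = t * t ^ (-1 / 4 : ℝ) := by
        rw [← Real.rpow_one_add' ht.1.le (by norm_num)]; norm_num
      rw [this]
      have h2 := hF.mono ht.2
      have h3 := hG.mono ht.2
      have h4 := Real.rpow_nonneg ht.1.le (-1 / 4 : ℝ)
      have h5 := hF.nonneg 1
      have h6 := hG.nonneg t
      calc t * (p t * (4 / 3 * q t * t ^ (-1 / 4 : ℝ)))
          = p t * (4 / 3 * q t) * (t * t ^ (-1 / 4 : ℝ)) := by ring
        _ ≤ p 1 * (4 / 3 * q 1) * (t * t ^ (-1 / 4 : ℝ)) := by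
          have := mul_nonneg ht.1.le h4
          gcongr
    · simpa using (tendsto_rpow_zero (r := 3 / 4) (by norm_num)).const_mul (p 1 * (4 / 3 * q 1))
  deriv₁ x y hx hy := hasDerivAt_scaleKernel_left hF hF₁ hG hdF hx hy
  deriv₂ x y hx hy := hasDerivAt_scaleKernel_right hF hG hG₁ hdG x hy
  euler_eq x y hx hy := scaleKernel_euler hF hF₁ hG hG₁ hdF hdG hx hy
  memLp_F A := (memLp_leftWeight hF.mono hF.nonneg A).mono' hF.cont.aestronglyMeasurable
    (Eventually.of_forall hF.bound)
  memLp_G A := (memLp_rightWeight hG.mono hG.nonneg A).mono' hG.meas.aestronglyMeasurable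
    (Eventually.of_forall hG.norm_le)

end ScaleKernel

end GenBessel

end

noncomputable section

namespace GenBessel

/-! ### The generalized Bessel kernel as an integral -/

section BesselKernel

variable {M : ℕ} (ν : Fin (M + 1) → ℕ)

/-- `φ_j`, extended continuously to the whole line. -/
def phiExt (j : ℕ) (x : ℝ) : ℂ := if 0 < x then phi ν j x else limUnder (𝓝[>] 0) (phi ν j)

/-- `ψ_j`, extended by `0` to the whole line. -/
def psiExt (j : ℕ) (y : ℝ) : ℂ := if 0 < y then psi ν j y else 0

/-- The generalized Bessel kernel as the integral `∫_0^1 f(tx) g(ty) dt`. -/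
def besselKernel : ℝ → ℝ → ℂ :=
  scaleKernel (fun x => (-1) ^ (M + 1) * phiExt ν 0 x) (psiExt ν M)

variable {ν}

lemma phiExt_of_pos {j : ℕ} {x : ℝ} (hx : 0 < x) : phiExt ν j x = phi ν j x := if_pos hx

lemma psiExt_of_pos {j : ℕ} {x : ℝ} (hx : 0 < x) : psiExt ν j x = psi ν j x := if_pos hx

lemma phiExt_eventuallyEq (j : ℕ) {x : ℝ} (hx : 0 < x) : phiExt ν j =ᶠ[𝓝 x] phi ν j := by
  filter_upwards [Ioi_mem_nhds hx] with y hy using phiExt_of_pos hy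

lemma psiExt_eventuallyEq (j : ℕ) {x : ℝ} (hx : 0 < x) : psiExt ν j =ᶠ[𝓝 x] psi ν j := by
  filter_upwards [Ioi_mem_nhds hx] with y hy using psiExt_of_pos hy

lemma hasDerivAt_phiExt (hν : ν 0 = 0) {j : ℕ} (hj : j < M) {x : ℝ} (hx : 0 < x) :
    HasDerivAt (phiExt ν j) (-phiExt ν (j + 1) x / x) x := by
  rw [phiExt_of_pos hx]
  exact (hasDerivAt_phi hν hj hx).congr_of_eventuallyEq (phiExt_eventuallyEq j hx)

lemma hasDerivAt_phiExt_last (hν : ν 0 = 0) {x : ℝ} (hx : 0 < x) :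
    HasDerivAt (phiExt ν M) (((-1) ^ (M + 1) * x * phiExt ν 0 x
      + ∑ i ∈ Finset.range (M + 1), beta ν i * phiExt ν i x) / x) x := by
  simp only [phiExt_of_pos hx]
  exact (hasDerivAt_phi_last hν hx).congr_of_eventuallyEq (phiExt_eventuallyEq M hx)

lemma hasDerivAt_psiExt (hν : ν 0 = 0) {j : ℕ} (hj : 1 ≤ j) (hjM : j ≤ M) {x : ℝ} (hx : 0 < x) :
    HasDerivAt (psiExt ν j) ((psiExt ν (j - 1) x - beta ν j * psiExt ν M x) / x) x := by
  simp only [psiExt_of_pos hx]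
  exact (hasDerivAt_psi hν hj hjM hx).congr_of_eventuallyEq (psiExt_eventuallyEq j hx)

lemma hasDerivAt_psiExt_zero (hν : ν 0 = 0) {x : ℝ} (hx : 0 < x) :
    HasDerivAt (psiExt ν 0) (((-1) ^ M * x * psiExt ν M x - beta ν 0 * psiExt ν M x) / x) x := by
  simp only [psiExt_of_pos hx]
  exact (hasDerivAt_psi_zero hν hx).congr_of_eventuallyEq (psiExt_eventuallyEq 0 hx)

lemma continuousAt_phiExt_of_pos (hν : ν 0 = 0) {j : ℕ} (hj : j ≤ M) {x : ℝ} (hx : 0 < x) :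
    ContinuousAt (phiExt ν j) x := by
  rcases hj.lt_or_eq with h | rfl
  · exact (hasDerivAt_phiExt hν h hx).continuousAt
  · exact (hasDerivAt_phiExt_last hν hx).continuousAt

lemma continuousAt_psiExt (hν : ν 0 = 0) {j : ℕ} (hj : j ≤ M) {x : ℝ} (hx : 0 < x) :
    ContinuousAt (psiExt ν j) x := by
  rcases Nat.eq_zero_or_pos j with rfl | h
  · exact (hasDerivAt_psiExt_zero hν hx).continuousAt
  · exact (hasDerivAt_psiExt hν h hj hx).continuousAt

lemma tendsto_phi_zero (hν : ν 0 = 0) {j : ℕ} (hj : 1 ≤ j) :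
    Tendsto (phi ν j) (𝓝[>] 0) (𝓝 0) := by
  obtain ⟨C, hC, h⟩ := norm_phi_le hν hj (zero_lt_one' ℝ)
  refine squeeze_zero_norm' (a := fun x => C * x ^ (1 / 2 : ℝ)) ?_ ?_
  · filter_upwards [Ioc_mem_nhdsGT (zero_lt_one' ℝ)] with t ht using h t ht.1 ht.2
  · simpa using (tendsto_rpow_zero (r := 1 / 2) (by norm_num)).const_mul C

lemma continuous_phiExt (hν : ν 0 = 0) (hM : 1 ≤ M) {j : ℕ} (hj : j ≤ M) :
    Continuous (phiExt ν j) := by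
  have hlim : Tendsto (phi ν j) (𝓝[>] 0) (𝓝 (limUnder (𝓝[>] 0) (phi ν j))) := by
    refine tendsto_nhds_limUnder ?_
    rcases Nat.eq_zero_or_pos j with rfl | h
    · exact exists_tendsto_phi_zero hν hM
    · exact ⟨0, tendsto_phi_zero hν h⟩
  rw [continuous_iff_continuousAt]
  intro x
  rcases lt_trichotomy x 0 with hx | rfl | hx
  · refine (continuousAt_const (y := limUnder (𝓝[>] 0) (phi ν j))).congr ?_
    filter_upwards [Iio_mem_nhds hx] with y hy using (if_neg (not_lt.mpr (le_of_lt hy))).symm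
  · have h0 : phiExt ν j 0 = limUnder (𝓝[>] 0) (phi ν j) := if_neg (lt_irrefl _)
    rw [ContinuousAt, h0, ← nhdsLE_sup_nhdsGT]
    refine Tendsto.sup ?_ ?_
    · refine tendsto_const_nhds.congr' ?_
      filter_upwards [self_mem_nhdsWithin] with y hy using (if_neg (not_lt.mpr hy)).symm
    · refine hlim.congr' ?_
      filter_upwards [self_mem_nhdsWithin] with y hy using (phiExt_of_pos hy).symm
  · exact continuousAt_phiExt_of_pos hν hj hx

lemma measurable_psiExt (hν : ν 0 = 0) {j : ℕ} (hj : j ≤ M) : Measurable (psiExt ν j) := by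
  have h : ContinuousOn (psi ν j) (Ioi 0) := fun x hx =>
    ((continuousAt_psiExt hν hj hx).congr (psiExt_eventuallyEq j hx)).continuousWithinAt
  classical
  have e : psiExt ν j = (Ioi (0 : ℝ)).piecewise (psi ν j) (fun _ => 0) := by
    funext x
    simp [psiExt, Set.piecewise]
  rw [e]
  exact h.measurable_piecewise continuousOn_const measurableSet_Ioi

/-- A locally bounded function is bounded by a monotone function of `|x|`. -/
lemma exists_monotone_bound {h : ℝ → ℝ} (hb : ∀ A, 0 < A → ∃ C, ∀ x, |x| ≤ A → h x ≤ C) :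
    ∃ p : ℝ → ℝ, Monotone p ∧ (∀ x, 0 ≤ p x) ∧ ∀ x, h x ≤ p |x| := by
  choose C hC using fun n : ℕ => hb (n + 1) (by positivity)
  refine ⟨fun x => ∑ i ∈ Finset.range (⌈x⌉₊ + 1), |C i|, fun x y hxy => ?_,
    fun x => Finset.sum_nonneg fun i _ => abs_nonneg _, fun x => ?_⟩
  · refine Finset.sum_le_sum_of_subset_of_nonneg ?_ fun i _ _ => abs_nonneg _
    exact Finset.range_subset_range.mpr (by have := Nat.ceil_mono hxy; omega)
  · refine (hC ⌈|x|⌉₊ x ((Nat.le_ceil _).trans (by linarith))).trans ((le_abs_self _).trans ?_)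
    exact Finset.single_le_sum (f := fun i => |C i|) (fun i _ => abs_nonneg _)
      (Finset.self_mem_range_succ _)

lemma exists_isLeftFactor (hν : ν 0 = 0) (hM : 1 ≤ M) :
    ∃ p, ∀ j ≤ M, IsLeftFactor p (phiExt ν j) := by
  obtain ⟨p, hp, hp0, h⟩ := exists_monotone_bound
    (h := fun x => ∑ j ∈ Finset.range (M + 1), ‖phiExt ν j x‖) (fun A hA => by
      have hc : Continuous fun x => ∑ j ∈ Finset.range (M + 1), ‖phiExt ν j x‖ :=
        continuous_finsetSum _ fun j hj =>
          (continuous_phiExt hν hM (Finset.mem_range_succ_iff.mp hj)).norm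
      obtain ⟨C, hC⟩ := (isCompact_Icc (a := -A) (b := A)).bddAbove_image hc.continuousOn
      exact ⟨C, fun x hx => hC (mem_image_of_mem _ (abs_le.mp hx))⟩)
  refine ⟨p, fun j hj => ⟨hp, hp0, continuous_phiExt hν hM hj, fun x => le_trans ?_ (h x)⟩⟩
  exact Finset.single_le_sum (f := fun j => ‖phiExt ν j x‖) (fun j _ => norm_nonneg _)
    (Finset.mem_range_succ_iff.mpr hj)

lemma exists_isRightFactor (hν : ν 0 = 0) : ∃ q, ∀ j ≤ M, IsRightFactor q (psiExt ν j) := by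
  obtain ⟨q, hq, hq0, h⟩ := exists_monotone_bound
    -- For y ≤ 0 the power is irrelevant, since the extension of ψ_j vanishes there.
    (h := fun y => ∑ j ∈ Finset.range (M + 1), ‖psiExt ν j y‖ * y ^ (1 / 4 : ℝ)) (fun A hA => by
      choose C hC h using fun j => norm_psi_le (ν := ν) j hA
      refine ⟨∑ j ∈ Finset.range (M + 1), C j, fun y hy => Finset.sum_le_sum fun j _ => ?_⟩
      rcases le_or_gt y 0 with hy0 | hy0
      · rw [psiExt, if_neg (not_lt.mpr hy0), norm_zero, zero_mul]
        exact hC j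
      · rw [psiExt_of_pos hy0]
        refine (mul_le_mul_of_nonneg_right (h j y hy0 ((le_abs_self y).trans hy))
          (Real.rpow_nonneg hy0.le _)).trans (le_of_eq ?_)
        rw [mul_assoc, ← Real.rpow_add hy0]
        norm_num)
  refine ⟨q, fun j hj => ⟨hq, hq0, measurable_psiExt hν hj, fun y hy => if_neg (not_lt.mpr hy),
    fun y hy => continuousAt_psiExt hν hj hy, fun y hy => ?_⟩⟩
  have h1 := h y
  rw [abs_of_pos hy] at h1
  have h2 := (Finset.single_le_sum (f := fun j => ‖psiExt ν j y‖ * y ^ (1 / 4 : ℝ))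
    (fun j _ => mul_nonneg (norm_nonneg _) (Real.rpow_nonneg hy.le _))
    (Finset.mem_range_succ_iff.mpr hj)).trans h1
  have h3 := mul_le_mul_of_nonneg_right h2 (Real.rpow_nonneg hy.le (-1 / 4 : ℝ))
  rwa [mul_assoc, ← Real.rpow_add hy, show (1 / 4 + -1 / 4 : ℝ) = 0 by norm_num, Real.rpow_zero,
    mul_one] at h3

lemma IsLeftFactor.const_mul {p : ℝ → ℝ} {F : ℝ → ℂ} (hF : IsLeftFactor p F) {c : ℂ}
    (hc : ‖c‖ = 1) : IsLeftFactor p fun x => c * F x where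
  mono := hF.mono
  nonneg := hF.nonneg
  cont := hF.cont.const_mul c
  bound x := by rw [norm_mul, hc, one_mul]; exact hF.bound x

lemma IsRightFactor.sub_const_mul {q : ℝ → ℝ} {G H : ℝ → ℂ} (hG : IsRightFactor q G)
    (hH : IsRightFactor q H) (c : ℂ) :
    IsRightFactor (fun y => (1 + ‖c‖) * q y) fun y => G y - c * H y where
  mono := hG.mono.const_mul (by positivity)
  nonneg y := mul_nonneg (by positivity) (hG.nonneg y)
  meas := hG.meas.sub (hH.meas.const_mul c)
  zero y hy := by rw [hG.zero y hy, hH.zero y hy]; simp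
  cont y hy := (hG.cont y hy).sub ((hH.cont y hy).const_mul c)
  bound y hy := by
    refine (norm_sub_le _ _).trans ?_
    rw [norm_mul]
    have h1 := hG.bound y hy
    have h2 := mul_le_mul_of_nonneg_left (hH.bound y hy) (norm_nonneg c)
    linarith

/-- Enlarges the bound of ψ_M to the one which `sub_const_mul` gives for θψ_M, so that both have a
common weight. -/
lemma IsRightFactor.one_add_mul {q : ℝ → ℝ} {G : ℝ → ℂ} (hG : IsRightFactor q G) {c : ℝ}
    (hc : 0 ≤ c) : IsRightFactor (fun y => (1 + c) * q y) G where
  mono := hG.mono.const_mul (by positivity)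
  nonneg y := mul_nonneg (by positivity) (hG.nonneg y)
  meas := hG.meas
  zero := hG.zero
  cont := hG.cont
  bound y hy := by
    have h1 := hG.bound y hy
    have h2 := mul_nonneg hc (mul_nonneg (hG.nonneg y) (Real.rpow_nonneg hy.le (-1 / 4 : ℝ)))
    linarith

/-- The generalized Bessel kernel has the properties on which the resolvent calculus rests. -/
lemma exists_isThetaKernel (hν : ν 0 = 0) (hM : 1 ≤ M) : ∃ k₁ k₂ v w,
    IsThetaKernel univ (Ioi 0) (besselKernel ν) k₁ k₂ v w
      (fun x => (-1) ^ (M + 1) * phiExt ν 0 x) (psiExt ν M) ∧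
    (∀ j ≤ M, ∀ x, ‖phiExt ν j x‖ ≤ 1 * v x) ∧ (∀ j ≤ M, ∀ x, ‖psiExt ν j x‖ ≤ 1 * w x) := by
  obtain ⟨p, hp⟩ := exists_isLeftFactor hν hM
  obtain ⟨q, hq⟩ := exists_isRightFactor hν
  have hn : ∀ n : ℕ, ‖((-1) ^ n : ℂ)‖ = 1 := fun n => by simp
  have hβ := norm_nonneg (beta ν M)
  -- The factors are f and g; their logarithmic derivatives are (-1)^M φ_1 and ψ_(M-1) - β_M ψ_M.
  refine ⟨_, _, _, _, isThetaKernel_scaleKernel ((hp 0 (Nat.zero_le _)).const_mul (hn (M + 1)))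
    ((hp 1 hM).const_mul (hn M)) ((hq M le_rfl).one_add_mul hβ)
    ((hq (M - 1) (Nat.sub_le _ _)).sub_const_mul (hq M le_rfl) (beta ν M)) ?_
    (fun x hx => hasDerivAt_psiExt hν hM le_rfl hx), fun j hj x => ?_, fun j hj x => ?_⟩
  · intro x hx
    refine ((hasDerivAt_phiExt hν hM hx).const_mul ((-1) ^ (M + 1))).congr_deriv ?_
    rw [pow_succ]
    ring
  · rw [one_mul]; exact (hp j hj).bound x
  · rw [one_mul]; exact ((hq j hj).one_add_mul hβ).norm_le x

/-- The algebra of the two dual systems: the products φ_(i+1) ψ_i cancel in pairs, the β-terms of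
dφ_M cancel those of the dψ_i, and only the two terms with X and Y survive. -/
lemma sum_euler_eq {φ ψ β dφ dψ : ℕ → ℂ} {e X Y : ℂ} (h₁ : ∀ i < M, dφ i = -φ (i + 1))
    (h₂ : dφ M = e * X * φ 0 + ∑ i ∈ Finset.range (M + 1), β i * φ i)
    (h₃ : ∀ i < M, dψ (i + 1) = ψ i - β (i + 1) * ψ M)
    (h₄ : dψ 0 = -e * Y * ψ M - β 0 * ψ M) :
    ∑ i ∈ Finset.range (M + 1), (dφ i * ψ i + φ i * dψ i) = (X - Y) * (e * φ 0 * ψ M) := by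
  rw [Finset.sum_add_distrib, Finset.sum_range_succ, Finset.sum_range_succ' (fun i => φ i * dψ i),
    h₂, h₄, Finset.sum_range_succ' (fun i => β i * φ i)]
  have e1 : ∑ i ∈ Finset.range M, dφ i * ψ i = ∑ i ∈ Finset.range M, -(φ (i + 1) * ψ i) :=
    Finset.sum_congr rfl fun i hi => by rw [h₁ i (Finset.mem_range.mp hi)]; ring
  have e2 : ∑ i ∈ Finset.range M, φ (i + 1) * dψ (i + 1) = ∑ i ∈ Finset.range M, φ (i + 1) * ψ i
      - (∑ i ∈ Finset.range M, β (i + 1) * φ (i + 1)) * ψ M := by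
    rw [Finset.sum_mul, ← Finset.sum_sub_distrib]
    exact Finset.sum_congr rfl fun i hi => by rw [h₃ i (Finset.mem_range.mp hi)]; ring
  rw [e1, e2, Finset.sum_neg_distrib]
  ring

lemma differentiableAt_phi (hν : ν 0 = 0) {j : ℕ} (hj : j ≤ M) {x : ℝ} (hx : 0 < x) :
    DifferentiableAt ℝ (phi ν j) x := by
  rcases hj.lt_or_eq with h | rfl
  · exact (hasDerivAt_phi hν h hx).differentiableAt
  · exact (hasDerivAt_phi_last hν hx).differentiableAt

lemma differentiableAt_psi (hν : ν 0 = 0) {j : ℕ} (hj : j ≤ M) {x : ℝ} (hx : 0 < x) :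
    DifferentiableAt ℝ (psi ν j) x := by
  rcases Nat.eq_zero_or_pos j with rfl | h
  · exact (hasDerivAt_psi_zero hν hx).differentiableAt
  · exact (hasDerivAt_psi hν h hj hx).differentiableAt

lemma sum_phi_mul_psi_euler (hν : ν 0 = 0) {x y : ℝ} (hx : 0 < x) (hy : 0 < y) :
    ∑ i ∈ Finset.range (M + 1), (x * deriv (phi ν i) x * psi ν i y
      + phi ν i x * (y * deriv (psi ν i) y))
      = ((x : ℂ) - y) * ((-1) ^ (M + 1) * phi ν 0 x * psi ν M y) := by
  have hx' : (x : ℂ) ≠ 0 := by exact_mod_cast hx.ne'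
  have hy' : (y : ℂ) ≠ 0 := by exact_mod_cast hy.ne'
  refine sum_euler_eq (φ := fun i => phi ν i x) (ψ := fun i => psi ν i y)
    (β := beta ν) (dφ := fun i => x * deriv (phi ν i) x) (dψ := fun i => y * deriv (psi ν i) y)
    (fun i hi => ?_) ?_ (fun i hi => ?_) ?_
  · rw [(hasDerivAt_phi hν hi hx).deriv]; field_simp
  · rw [(hasDerivAt_phi_last hν hx).deriv]; field_simp
  · rw [(hasDerivAt_psi hν (Nat.le_add_left 1 i) hi hy).deriv]; field_simp; rfl
  · rw [(hasDerivAt_psi_zero hν hy).deriv, pow_succ]; field_simp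

lemma tendsto_mul_const_nhdsGT {x : ℝ} (hx : 0 < x) :
    Tendsto (fun t : ℝ => t * x) (𝓝[>] 0) (𝓝[>] 0) := by
  refine tendsto_nhdsWithin_iff.mpr ⟨?_, ?_⟩
  · have h : Continuous fun t : ℝ => t * x := by fun_prop
    have := h.tendsto 0
    rw [zero_mul] at this
    exact this.mono_left nhdsWithin_le_nhds
  · filter_upwards [self_mem_nhdsWithin] with t ht using mul_pos ht hx

/-- For i = 0, φ_0 has a limit and ψ_0 tends to 0; for i ≥ 1 the product is O(t^(1/2 - 1/4)). -/
lemma tendsto_sum_phi_mul_psi (hν : ν 0 = 0) (hM : 1 ≤ M) {x y : ℝ} (hx : 0 < x) (hy : 0 < y) :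
    Tendsto (fun t : ℝ => ∑ i ∈ Finset.range (M + 1), phi ν i (t * x) * psi ν i (t * y))
      (𝓝[>] 0) (𝓝 0) := by
  suffices h : ∀ i ∈ Finset.range (M + 1),
      Tendsto (fun t : ℝ => phi ν i (t * x) * psi ν i (t * y)) (𝓝[>] 0) (𝓝 0) by
    simpa using tendsto_finsetSum _ h
  intro i hi
  rcases Nat.eq_zero_or_pos i with rfl | hi
  · obtain ⟨L, hL⟩ := exists_tendsto_phi_zero hν hM
    obtain ⟨C, hC, h⟩ := norm_psi_zero_le (ν := ν) (zero_lt_one' ℝ)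
    have h1 : Tendsto (psi ν 0) (𝓝[>] 0) (𝓝 0) := by
      refine squeeze_zero_norm' (a := fun x => C * x ^ (1 / 2 : ℝ)) ?_ ?_
      · filter_upwards [Ioc_mem_nhdsGT (zero_lt_one' ℝ)] with t ht using h t ht.1 ht.2
      · simpa using (tendsto_rpow_zero (r := 1 / 2) (by norm_num)).const_mul C
    simpa using (hL.comp (tendsto_mul_const_nhdsGT hx)).mul (h1.comp (tendsto_mul_const_nhdsGT hy))
  · obtain ⟨C, hC, h⟩ := norm_phi_le hν hi hx
    obtain ⟨D, hD, h'⟩ := norm_psi_le (ν := ν) i hy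
    refine squeeze_zero_norm' (a := fun t => C * x ^ (1 / 2 : ℝ) * (D * y ^ (-1 / 4 : ℝ))
      * t ^ (1 / 4 : ℝ)) ?_ ?_
    · filter_upwards [Ioc_mem_nhdsGT (zero_lt_one' ℝ)] with t ht
      have h1 := h (t * x) (mul_pos ht.1 hx) (mul_le_of_le_one_left hx.le ht.2)
      have h2 := h' (t * y) (mul_pos ht.1 hy) (mul_le_of_le_one_left hy.le ht.2)
      rw [norm_mul]
      refine (mul_le_mul h1 h2 (norm_nonneg _) ((norm_nonneg _).trans h1)).trans (le_of_eq ?_)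
      rw [Real.mul_rpow ht.1.le hx.le, Real.mul_rpow ht.1.le hy.le,
        show (1 / 4 : ℝ) = 1 / 2 + -1 / 4 by norm_num, Real.rpow_add ht.1]
      ring
    · simpa using (tendsto_rpow_zero (r := 1 / 4) (by norm_num)).const_mul
        (C * x ^ (1 / 2 : ℝ) * (D * y ^ (-1 / 4 : ℝ)))

/-- The integrable form of the kernel on `(0, ∞)`. -/
lemma sub_mul_besselKernel_of_pos (hν : ν 0 = 0) (hM : 1 ≤ M) {x y : ℝ} (hx : 0 < x) (hy : 0 < y) :
    ((x : ℂ) - y) * besselKernel ν x y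
      = ∑ i ∈ Finset.range (M + 1), phi ν i x * psi ν i y := by
  obtain ⟨p, hp⟩ := exists_isLeftFactor hν hM
  obtain ⟨q, hq⟩ := exists_isRightFactor hν
  have hn : ‖((-1) ^ (M + 1) : ℂ)‖ = 1 := by simp
  have hint := integrableOn_mul_scale ((hp 0 (Nat.zero_le _)).const_mul hn) (hq M le_rfl) x hy
  -- Along the ray the derivative of Σ φ_i(tx) ψ_i(ty) is x - y times the integrand of the kernel,
  -- so the identity is the fundamental theorem of calculus with zero contribution from t = 0.
  have hder : ∀ t : ℝ, 0 < t → HasDerivAt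
      (fun t : ℝ => ∑ i ∈ Finset.range (M + 1), phi ν i (t * x) * psi ν i (t * y))
      (((x : ℂ) - y) * ((-1) ^ (M + 1) * phiExt ν 0 (t * x) * psiExt ν M (t * y))) t := by
    intro t ht
    have htx := mul_pos ht hx
    have hty := mul_pos ht hy
    have h := HasDerivAt.fun_sum (u := Finset.range (M + 1)) (x := t)
      (A := fun i t => phi ν i (t * x) * psi ν i (t * y))
      (A' := fun i => (x * deriv (phi ν i) (t * x)) * psi ν i (t * y)
        + phi ν i (t * x) * (y * deriv (psi ν i) (t * y))) (fun i hi => by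
        have hi' := Finset.mem_range_succ_iff.mp hi
        have h1 := (differentiableAt_phi hν hi' htx).hasDerivAt.scomp t
          ((hasDerivAt_id t).mul_const x)
        have h2 := (differentiableAt_psi hν hi' hty).hasDerivAt.scomp t
          ((hasDerivAt_id t).mul_const y)
        refine (h1.mul h2).congr_deriv ?_
        simp [Function.comp])
    refine h.congr_deriv ?_
    rw [phiExt_of_pos htx, psiExt_of_pos hty]
    have key := sum_phi_mul_psi_euler hν htx hty
    have ht' : (t : ℂ) ≠ 0 := by exact_mod_cast ht.ne'
    apply mul_left_cancel₀ ht'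
    rw [Finset.mul_sum]
    push_cast at key
    refine Eq.trans (Finset.sum_congr rfl fun i _ => ?_) (key.trans ?_) <;> ring
  have hlim0 : Tendsto (fun t : ℝ => ∑ i ∈ Finset.range (M + 1), phi ν i (t * x) * psi ν i (t * y))
      (𝓝[>] 0) (𝓝 0) := tendsto_sum_phi_mul_psi hν hM hx hy
  have hlim1 := (hder 1 zero_lt_one).continuousAt.tendsto.mono_left
    (nhdsWithin_le_nhds (s := Iio 1))
  have hfin := intervalIntegral.integral_eq_sub_of_hasDerivAt_of_tendsto zero_lt_one
    (fun t ht => hder t ht.1) ((intervalIntegrable_iff_integrableOn_Ioc_of_le zero_le_one).mpr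
      (hint.const_mul _)) hlim0 hlim1
  rw [intervalIntegral.integral_of_le zero_le_one, integral_const_mul] at hfin
  simpa [besselKernel, scaleKernel] using hfin

/-- The integrable form of the kernel. -/
lemma sub_mul_besselKernel (hν : ν 0 = 0) (hM : 1 ≤ M) : ∀ x ∈ Ici (0 : ℝ), ∀ y ∈ Ioi (0 : ℝ),
    ((x : ℂ) - y) * besselKernel ν x y = ∑ i : Fin (M + 1), phiExt ν i x * psiExt ν i y := by
  intro x hx y hy
  have hpos : ∀ x : ℝ, 0 < x → ((x : ℂ) - y) * besselKernel ν x y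
      = ∑ i : Fin (M + 1), phiExt ν i x * psiExt ν i y := by
    intro x hx
    rw [sub_mul_besselKernel_of_pos hν hM hx hy, Finset.sum_range]
    exact Finset.sum_congr rfl fun i _ => by rw [phiExt_of_pos hx, psiExt_of_pos hy]
  rcases (mem_Ici.mp hx).eq_or_lt with rfl | hx
  -- x = 0 is reached by continuity. This point is needed because the first endpoint may be 0.
  · obtain ⟨_, _, _, _, hT, -, -⟩ := exists_isThetaKernel hν hM
    have h1 : ContinuousAt (fun x : ℝ => ((x : ℂ) - y) * besselKernel ν x y) 0 :=
      ContinuousAt.mul (by fun_prop) (hT.ker.continuousAt_left (mem_univ _) hy)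
    have h2 : ContinuousAt (fun x : ℝ => ∑ i : Fin (M + 1), phiExt ν i x * psiExt ν i y) 0 :=
      (continuous_finsetSum _ fun i _ => (continuous_phiExt hν hM
        (Nat.lt_succ_iff.mp i.2)).mul continuous_const).continuousAt
    refine tendsto_nhds_unique (h1.tendsto.mono_left (nhdsWithin_le_nhds (s := Ioi 0)))
      ((h2.tendsto.mono_left nhdsWithin_le_nhds).congr' ?_)
    filter_upwards [self_mem_nhdsWithin] with z hz using (hpos z hz).symm
  · exact hpos x hx

/-- On the diagonal, Σ φ_j(z) ψ_j(x) vanishes at z = x and its slope there is the integral kernel at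
(z, x), whose limit as z → x exists by continuity. -/
lemma K_eq_besselKernel (hν : ν 0 = 0) (hM : 1 ≤ M) {x y : ℝ} (hx : 0 < x) (hy : 0 < y) :
    K ν x y = besselKernel ν x y := by
  unfold K
  split_ifs with h
  · subst h
    obtain ⟨_, _, _, _, hT, -, -⟩ := exists_isThetaKernel hν hM
    have hN := sub_mul_besselKernel_of_pos hν hM hx hx
    rw [sub_self, zero_mul] at hN
    have hd : HasDerivAt (fun z => ∑ j ∈ Finset.range (M + 1), phi ν j z * psi ν j x)
        (∑ j ∈ Finset.range (M + 1), deriv (phi ν j) x * psi ν j x) x :=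
      HasDerivAt.fun_sum fun j hj => (differentiableAt_phi hν (Finset.mem_range_succ_iff.mp hj)
        hx).hasDerivAt.mul_const _
    rw [hasDerivAt_iff_tendsto_slope] at hd
    refine tendsto_nhds_unique hd (((hT.ker.continuousAt_left (mem_univ x) hx).tendsto.mono_left
      nhdsWithin_le_nhds).congr' ?_)
    filter_upwards [self_mem_nhdsWithin, nhdsWithin_le_nhds (Ioi_mem_nhds hx)] with z hz hz0
    have hzx : (z : ℂ) - x ≠ 0 := sub_ne_zero.mpr (by exact_mod_cast hz)
    rw [slope_def_module, ← hN, sub_zero, ← sub_mul_besselKernel_of_pos hν hM hz0 hx,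
      Complex.real_smul]
    push_cast
    field_simp
  · have hxy : (x : ℂ) - y ≠ 0 := sub_ne_zero.mpr (by exact_mod_cast h)
    rw [← sub_mul_besselKernel_of_pos hν hM hx hy]
    field_simp

end BesselKernel

end GenBessel

end

noncomputable section

namespace GenBessel

/-! ### The quantities of the theorem in terms of the resolvent -/

section Quantities

variable {M m : ℕ} {ν : Fin (M + 1) → ℕ} {a : Fin (2 * m) → ℝ}

/-- The Fredholm determinant only involves the values of the kernel on `(0, ∞)`. -/
lemma fredholmDet_eq (hν : ν 0 = 0) (hM : 1 ≤ M) (ha0 : ∀ l, 0 ≤ a l) :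
    fredholmDet ν a = fredholmSeries (besselKernel ν) (volume.restrict (J a)) := by
  unfold fredholmDet fredholmSeries
  refine tsum_congr fun n => ?_
  rw [fredholmCoeff, ← Measure.restrict_pi_pi, ← volume_pi]
  congr 1
  refine setIntegral_congr_fun (MeasurableSet.univ_pi fun _ => measurableSet_J) fun x hx => ?_
  have hpos : ∀ i, 0 < x i := fun i => by
    obtain ⟨k, hk⟩ := Set.mem_iUnion.1 (hx i trivial)
    exact (ha0 _).trans_lt hk.1
  simp only [kernelMatrix, K_eq_besselKernel hν hM (hpos _) (hpos _)]

/-- The endpoints lie in the closure of `J`. -/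
lemma neBot_nhdsWithin_J (ha : StrictMono a) (l : Fin (2 * m)) : (𝓝[J a] (a l)).NeBot := by
  rw [← mem_closure_iff_nhdsWithin_neBot]
  have key : ∀ k : Fin m, Icc (left a k) (right a k) ⊆ closure (J a) := fun k => by
    rw [← closure_Ioo (left_lt_right ha k).ne]
    exact closure_mono (Set.subset_iUnion (fun k => Ioo (left a k) (right a k)) k)
  have hl : (l : ℕ) / 2 < m := by omega
  have hlt := (left_lt_right ha ⟨(l : ℕ) / 2, hl⟩).le
  rcases Nat.even_or_odd' (l : ℕ) with ⟨i, h | h⟩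
  · have e : a l = left a ⟨(l : ℕ) / 2, hl⟩ := by
      unfold left; congr 1; ext; simp only; omega
    rw [e]
    exact key _ ⟨le_rfl, hlt⟩
  · have e : a l = right a ⟨(l : ℕ) / 2, hl⟩ := by
      unfold right; congr 1; ext; simp only; omega
    rw [e]
    exact key _ ⟨hlt, le_rfl⟩

lemma sol_swap (k : ℝ → ℝ → ℂ) (S : Set ℝ) (h : ℝ → ℂ) : sol (fun x y => k y x) S h
    = resolve (fun x y => resKernel k S y x) (volume.restrict S) h := by
  rw [sol, resKernel_swap]

/-! ### Identification of the chosen solution with the one given by the resolvent kernel -/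

section Resolvent

variable {U V : Set ℝ} {k k₁ k₂ κ : ℝ → ℝ → ℂ} {v w : ℝ → ℝ} {F G φ φ₀ : ℝ → ℂ} {A B C : ℝ}
  (hT : IsThetaKernel U V k k₁ k₂ v w F G) (hreg : IsRegular k v w A C a) (hφm : Measurable φ)
  (hφb : ∀ x, ‖φ x‖ ≤ B * v x)

include hT hreg hφm hφb

lemma IsThetaKernel.memLp_sol_J : MemLp (sol k (J a) φ) 2 (volume.restrict (J a)) :=
  IsThetaKernel.memLp_J (hT.memLp_sol hφm hφb hreg) hreg.nonneg hreg.le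

lemma IsThetaKernel.continuousAt_sol_of_isRegular {x : ℝ} (hx : x ∈ U) (hc : ContinuousAt φ x) :
    ContinuousAt (sol k (J a) φ) x := by
  have h0 := IsThetaKernel.ae_pos hreg.nonneg hreg.le
  exact continuousAt_resolve hT.ker hreg.res (IsThetaKernel.memLp_J hT.memLp_v hreg.nonneg hreg.le)
    (IsThetaKernel.memLp_J hT.memLp_w hreg.nonneg hreg.le) (h0.mono fun x hx => hT.subU hx)
    (h0.mono fun x hx => hT.subV hx) (hT.memLp_phi hφm hφb hreg) hx hc

variable (hκ : ∀ x y, 0 < x → 0 < y → κ x y = k x y) (hφ₀ : ∀ x, 0 < x → φ₀ x = φ x)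

include hκ hφ₀

lemma IsThetaKernel.isResolventOf_sol : IsResolventOf κ (J a) φ₀ (sol k (J a) φ) := by
  refine ⟨hT.memLp_sol_J hreg hφm hφb, fun x hx => ?_⟩
  rw [hφ₀ x hx, ← resolve_sub hT.ker.toIsDominated hreg.res
    (IsThetaKernel.memLp_J hT.memLp_v hreg.nonneg hreg.le)
    (IsThetaKernel.memLp_J hT.memLp_w hreg.nonneg hreg.le) (hT.memLp_phi hφm hφb hreg) x]
  congr 1
  refine setIntegral_congr_fun measurableSet_J fun y hy => ?_
  simp only [hκ x y hx (J_subset hreg.nonneg hreg.le hy).1]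
  rfl

lemma IsThetaKernel.eq_sol {u : ℝ → ℂ} (hu : IsResolventOf κ (J a) φ₀ u) {x : ℝ} (hx : 0 < x) :
    u x = sol k (J a) φ x := by
  refine eq_resolve hT.ker.toIsDominated hreg.res
    (IsThetaKernel.memLp_J hT.memLp_v hreg.nonneg hreg.le)
    (IsThetaKernel.memLp_J hT.memLp_w hreg.nonneg hreg.le) (T := Ioi 0)
    (IsThetaKernel.ae_pos hreg.nonneg hreg.le) hu.1 (fun x hx => ?_) x hx
  rw [← hφ₀ x hx, ← hu.2 x hx]
  congr 1
  refine setIntegral_congr_fun measurableSet_J fun y hy => ?_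
  simp only [hκ x y hx (J_subset hreg.nonneg hreg.le hy).1]

/-- `resolvent` is a choice; it satisfies the equation because `sol` is a solution. `eq_sol` then
determines its values on (0, ∞). -/
lemma IsThetaKernel.isResolventOf_resolvent :
    IsResolventOf κ (J a) φ₀ (resolvent κ (J a) φ₀) :=
  Classical.epsilon_spec ⟨_, hT.isResolventOf_sol hreg hφm hφb hκ hφ₀⟩

lemma IsThetaKernel.resolvent_eq_sol {x : ℝ} (hx : 0 < x) :
    resolvent κ (J a) φ₀ x = sol k (J a) φ x :=
  hT.eq_sol hreg hφm hφb hκ hφ₀ (hT.isResolventOf_resolvent hreg hφm hφb hκ hφ₀) hx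

lemma IsThetaKernel.tendsto_resolvent {x : ℝ} (hx : x ∈ U) (hc : ContinuousAt φ x) :
    Tendsto (resolvent κ (J a) φ₀) (𝓝[J a] x) (𝓝 (sol k (J a) φ x)) := by
  refine ((hT.continuousAt_sol_of_isRegular hreg hφm hφb hx hc).tendsto.mono_left
    nhdsWithin_le_nhds).congr' ?_
  filter_upwards [self_mem_nhdsWithin] with y hy
  exact (hT.resolvent_eq_sol hreg hφm hφb hκ hφ₀ (J_subset hreg.nonneg hreg.le hy).1).symm

end Resolvent

/-- `𝒬_j` on the whole line. -/
abbrev solQ (ν : Fin (M + 1) → ℕ) (j : ℕ) (a : Fin (2 * m) → ℝ) : ℝ → ℂ :=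
  sol (besselKernel ν) (J a) (phiExt ν j)

/-- `𝒫_j` on the whole line. -/
abbrev solP (ν : Fin (M + 1) → ℕ) (j : ℕ) (a : Fin (2 * m) → ℝ) : ℝ → ℂ :=
  sol (fun x y => besselKernel ν y x) (J a) (psiExt ν j)

/-- The resolvent of the generalized Bessel kernel exists on `J a`. -/
structure IsBesselRegular (ν : Fin (M + 1) → ℕ) (k₁ k₂ : ℝ → ℝ → ℂ) (v w : ℝ → ℝ) (A C : ℝ)
    (a : Fin (2 * m) → ℝ) : Prop where
  nu_zero : ν 0 = 0
  one_le : 1 ≤ M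
  theta : IsThetaKernel univ (Ioi 0) (besselKernel ν) k₁ k₂ v w
      (fun x => (-1) ^ (M + 1) * phiExt ν 0 x) (psiExt ν M)
  phi_le : ∀ j ≤ M, ∀ x, ‖phiExt ν j x‖ ≤ 1 * v x
  psi_le : ∀ j ≤ M, ∀ x, ‖psiExt ν j x‖ ≤ 1 * w x
  reg : IsRegular (besselKernel ν) v w A C a

namespace IsBesselRegular

variable {k₁ k₂ : ℝ → ℝ → ℂ} {v w : ℝ → ℝ} {A C : ℝ}
  (hB : IsBesselRegular ν k₁ k₂ v w A C a) {j : ℕ} (hj : j ≤ M)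

include hB

lemma memLp_v : MemLp v 2 (volume.restrict (J a)) :=
  IsThetaKernel.memLp_J hB.theta.memLp_v hB.reg.nonneg hB.reg.le

lemma memLp_w : MemLp w 2 (volume.restrict (J a)) :=
  IsThetaKernel.memLp_J hB.theta.memLp_w hB.reg.nonneg hB.reg.le

lemma ae_pos : ∀ᵐ x ∂(volume.restrict (J a)), x ∈ Ioi (0 : ℝ) :=
  IsThetaKernel.ae_pos hB.reg.nonneg hB.reg.le

lemma ae_le : ∀ᵐ x ∂(volume.restrict (J a)), |x| ≤ A :=
  IsThetaKernel.ae_le hB.reg.nonneg hB.reg.le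

lemma pos_of_mem {x : ℝ} (hx : x ∈ J a) : 0 < x := (J_subset hB.reg.nonneg hB.reg.le hx).1

lemma kernel_eq {x y : ℝ} (hx : 0 < x) (hy : 0 < y) : K ν x y = besselKernel ν x y :=
  K_eq_besselKernel hB.nu_zero hB.one_le hx hy

include hj

lemma continuous_phi : Continuous (phiExt ν j) := continuous_phiExt hB.nu_zero hB.one_le hj

lemma measurable_phi : Measurable (phiExt ν j) := (hB.continuous_phi hj).measurable

lemma measurable_psi : Measurable (psiExt ν j) := measurable_psiExt hB.nu_zero hj

lemma memLp_phi : MemLp (phiExt ν j) 2 (volume.restrict (J a)) :=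
  hB.theta.memLp_phi (hB.measurable_phi hj) (hB.phi_le j hj) hB.reg

lemma memLp_psi : MemLp (psiExt ν j) 2 (volume.restrict (J a)) :=
  hB.theta.swap.memLp_phi (hB.measurable_psi hj) (hB.psi_le j hj) hB.reg.swap

lemma memLp_solP : MemLp (solP ν j a) 2 (volume.restrict (J a)) :=
  hB.theta.swap.memLp_sol_J hB.reg.swap (hB.measurable_psi hj) (hB.psi_le j hj)

lemma isResolventOf_Q : IsResolventOf (K ν) (J a) (phi ν j) (Q ν j a) :=
  hB.theta.isResolventOf_resolvent hB.reg (hB.measurable_phi hj) (hB.phi_le j hj)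
    (fun _ _ => hB.kernel_eq) fun _ hx => (phiExt_of_pos hx).symm

lemma isResolventOf_P : IsResolventOf (fun x y => K ν y x) (J a) (psi ν j) (P ν j a) :=
  hB.theta.swap.isResolventOf_resolvent hB.reg.swap (hB.measurable_psi hj) (hB.psi_le j hj)
    (fun _ _ hx hy => hB.kernel_eq hy hx) fun _ hx => (psiExt_of_pos hx).symm

lemma eq_solQ {u : ℝ → ℂ} (hu : IsResolventOf (K ν) (J a) (phi ν j) u) {x : ℝ} (hx : 0 < x) :
    u x = solQ ν j a x :=
  hB.theta.eq_sol hB.reg (hB.measurable_phi hj) (hB.phi_le j hj)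
    (fun _ _ => hB.kernel_eq) (fun _ hx => (phiExt_of_pos hx).symm) hu hx

lemma eq_solP {u : ℝ → ℂ} (hu : IsResolventOf (fun x y => K ν y x) (J a) (psi ν j) u) {x : ℝ}
    (hx : 0 < x) : u x = solP ν j a x :=
  hB.theta.swap.eq_sol hB.reg.swap (hB.measurable_psi hj) (hB.psi_le j hj)
    (fun _ _ hx hy => hB.kernel_eq hy hx) (fun _ hx => (psiExt_of_pos hx).symm) hu hx

lemma tendsto_Q (l : Fin (2 * m)) :
    Tendsto (Q ν j a) (𝓝[J a] (a l)) (𝓝 (solQ ν j a (a l))) :=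
  hB.theta.tendsto_resolvent hB.reg (hB.measurable_phi hj) (hB.phi_le j hj)
    (fun _ _ => hB.kernel_eq) (fun _ hx => (phiExt_of_pos hx).symm) (mem_univ _)
    (hB.continuous_phi hj).continuousAt

lemma tendsto_P {l : Fin (2 * m)} (hl : 0 < a l) :
    Tendsto (P ν j a) (𝓝[J a] (a l)) (𝓝 (solP ν j a (a l))) :=
  hB.theta.swap.tendsto_resolvent hB.reg.swap (hB.measurable_psi hj) (hB.psi_le j hj)
    (fun _ _ hx hy => hB.kernel_eq hy hx) (fun _ hx => (psiExt_of_pos hx).symm) hl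
    (continuousAt_psiExt hB.nu_zero hj hl)

/-- The limit is unique since the endpoint is in the closure of J, and it is a value of a function
continuous on the whole line, so a_l = 0 is allowed. In `yq_eq` it is not, as ψ_j may be singular at
0. -/
lemma xq_eq (l : Fin (2 * m)) : xq ν j l a = prefactor l * solQ ν j a (a l) := by
  have := neBot_nhdsWithin_J hB.reg.mono l
  rw [xq, (hB.tendsto_Q hj l).limUnder_eq]

lemma yq_eq {l : Fin (2 * m)} (hl : 0 < a l) : yq ν j l a = prefactor l * solP ν j a (a l) := by
  have := neBot_nhdsWithin_J hB.reg.mono l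
  rw [yq, (hB.tendsto_P hj hl).limUnder_eq]

lemma integrableOn_phi_mul_P {i : ℕ} (hi : i ≤ M) :
    IntegrableOn (fun x => phi ν i x * P ν j a x) (J a) := by
  have h : IntegrableOn (fun x => phiExt ν i x * solP ν j a x) (J a) :=
    (hB.memLp_phi hi).integrable_mul (hB.memLp_solP hj)
  refine h.congr_fun (fun x hx => ?_) measurableSet_J
  have hx := hB.pos_of_mem hx
  simp only [phiExt_of_pos hx, hB.eq_solP hj (hB.isResolventOf_P hj) hx]

lemma sum_integral_eq {i : ℕ} (hi : i ≤ M) :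
    ∑ k : Fin m, ∫ x in (left a k)..(right a k), phi ν i x * P ν j a x
      = ∫ x in J a, phiExt ν i x * solP ν j a x := by
  rw [← setIntegral_J hB.reg.mono (hB.integrableOn_phi_mul_P hj hi)]
  refine setIntegral_congr_fun measurableSet_J fun x hx => ?_
  have hx := hB.pos_of_mem hx
  simp only [phiExt_of_pos hx, hB.eq_solP hj (hB.isResolventOf_P hj) hx]

lemma xi_eq : xi ν j a = (-1) ^ M * (∫ x in J a, phiExt ν 0 x * solP ν j a x) + beta ν j := by
  rw [xi, hB.sum_integral_eq hj (Nat.zero_le _)]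
  rfl

lemma eta_eq : eta ν j a = (-1) ^ M * ∫ x in J a, phiExt ν j x * solP ν M a x := by
  rw [eta, hB.sum_integral_eq le_rfl hj]

/-- `∫ ψ_i 𝒬_j = ∫ φ_j 𝒫_i`. -/
lemma integral_psi_mul_solQ {i : ℕ} (hi : i ≤ M) :
    ∫ x in J a, psiExt ν i x * solQ ν j a x = ∫ x in J a, phiExt ν j x * solP ν i a x := by
  have h := integral_mul_resolve hB.theta.ker.toIsDominated hB.reg.res hB.memLp_v hB.memLp_w
    (hB.memLp_psi hi) (hB.memLp_phi hj)
  rw [← sol_swap] at h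
  exact h

omit hj

lemma sub_mul_resKernel {x y : ℝ} (hx : 0 ≤ x) (hy : 0 < y) :
    ((x : ℂ) - y) * resKernel (besselKernel ν) (J a) x y
      = ∑ i ∈ Finset.range (M + 1), solQ ν i a x * solP ν i a y := by
  have h := sub_mul_resolventKernel hB.theta.ker.toIsDominated hB.reg.res hB.memLp_v hB.memLp_w
    (φ := fun i : Fin (M + 1) => phiExt ν i) (ψ := fun i : Fin (M + 1) => psiExt ν i)
    (sub_mul_besselKernel hB.nu_zero hB.one_le) (hB.ae_pos.mono fun x hx => Ioi_subset_Ici_self hx) hB.ae_pos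
    hB.ae_le (fun i => hB.memLp_phi (Nat.lt_succ_iff.mp i.2))
    (fun i => hB.memLp_psi (Nat.lt_succ_iff.mp i.2)) x hx y hy
  simp only [← sol_swap] at h
  rw [h, Finset.sum_range]
  rfl

/-- The bilinear sums of the theorem are the resolvent kernel at pairs of endpoints; this is how R
disappears from the final equations. -/
lemma sum_xq_mul_yq {k l : Fin (2 * m)} (hk : 0 < a k) :
    ∑ i ∈ Finset.range (M + 1), xq ν i l a * yq ν i k a = prefactor l * prefactor k *
      (((a l : ℂ) - a k) * resKernel (besselKernel ν) (J a) (a l) (a k)) := by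
  rw [hB.sub_mul_resKernel (hB.reg.nonneg l) hk, Finset.mul_sum]
  refine Finset.sum_congr rfl fun i hi => ?_
  have hi := Finset.mem_range_succ_iff.mp hi
  rw [hB.xq_eq hi, hB.yq_eq hi hk]
  ring

lemma sub_ne_zero {k l : Fin (2 * m)} (hkl : k ≠ l) : (a k : ℂ) - a l ≠ 0 :=
  _root_.sub_ne_zero.mpr (by exact_mod_cast hB.reg.mono.injective.ne hkl)

include hj

lemma sum_erase_xq {l : Fin (2 * m)} :
    ∑ k ∈ Finset.univ.erase l, xq ν j k a * ((a k : ℂ) / ((a l : ℂ) - (a k : ℂ))) *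
      ∑ i ∈ Finset.range (M + 1), xq ν i l a * yq ν i k a
      = -(prefactor l * ∑ k ∈ Finset.univ.erase l, endSign k * a k * solQ ν j a (a k) *
        resKernel (besselKernel ν) (J a) (a l) (a k)) := by
  rw [Finset.mul_sum, ← Finset.sum_neg_distrib]
  refine Finset.sum_congr rfl fun k hk => ?_
  rcases (hB.reg.nonneg k).eq_or_lt with h0 | h0
  -- For a_k = 0 the limit behind y^(k) need not exist, but the factor a_k makes both sides zero.
  · simp [← h0]
  · have hne := hB.sub_ne_zero (Finset.ne_of_mem_erase hk).symm
    rw [hB.sum_xq_mul_yq h0, hB.xq_eq hj]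
    field_simp
    linear_combination (a k * prefactor l * solQ ν j a (a k) *
      resKernel (besselKernel ν) (J a) (a l) (a k)) * prefactor_mul_self k

lemma sum_erase_yq {l : Fin (2 * m)} (hl : 0 < a l) :
    ∑ k ∈ Finset.univ.erase l, yq ν j k a * ((a k : ℂ) / ((a k : ℂ) - (a l : ℂ))) *
      ∑ i ∈ Finset.range (M + 1), xq ν i k a * yq ν i l a
      = -(prefactor l * ∑ k ∈ Finset.univ.erase l, endSign k * a k * solP ν j a (a k) *
        resKernel (besselKernel ν) (J a) (a k) (a l)) := by
  rw [Finset.mul_sum, ← Finset.sum_neg_distrib]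
  refine Finset.sum_congr rfl fun k hk => ?_
  rcases (hB.reg.nonneg k).eq_or_lt with h0 | h0
  · simp [← h0]
  · have hne := hB.sub_ne_zero (Finset.ne_of_mem_erase hk)
    rw [hB.sum_xq_mul_yq hl, hB.yq_eq hj h0]
    field_simp
    linear_combination (a k * prefactor l * solP ν j a (a k) *
      resKernel (besselKernel ν) (J a) (a k) (a l)) * prefactor_mul_self k

/-- `x d/dx 𝒬_j`, when `x d/dx φ_j = φ₁`. -/
lemma hasDerivAt_solQ {φ₁ : ℝ → ℂ} (hφ₁ : ∀ A, MemLp φ₁ 2 (volume.restrict (Ioc 0 A)))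
    (hd : ∀ x, 0 < x → HasDerivAt (phiExt ν j) (φ₁ x / x) x) {x : ℝ} (hx : 0 < x) :
    HasDerivAt (solQ ν j a) ((sol (besselKernel ν) (J a) φ₁ x - eta ν j a * solQ ν 0 a x
      - ∑ l, endSign l * a l * solQ ν j a (a l) * resKernel (besselKernel ν) (J a) x (a l)) / x)
      x := by
  have h1 := hB.theta.hasDerivAt_resolve hB.reg.nonneg hB.reg.le hB.reg.res (hB.measurable_phi hj)
    (hB.phi_le j hj) hx (hd x hx)
  have h2 := hB.theta.theta_resolve hB.reg.mono hB.reg.nonneg hB.reg.le hB.reg.res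
    (hB.measurable_phi hj) (hB.phi_le j hj) hφ₁ hd hx
  rw [h2] at h1
  refine h1.congr_deriv ?_
  have h3 := resolve_const_mul (R := resKernel (besselKernel ν) (J a)) (μ := volume.restrict (J a))
    (h := phiExt ν 0) ((-1) ^ (M + 1)) x
  -- The rank one term is ∫ ψ_M 𝒬_j times the resolvent of (-1)^(M+1) φ_0. Moving the resolvent to
  -- the other factor shows it to be -η_j 𝒬_0.
  have h4 := hB.integral_psi_mul_solQ hj (le_refl M)
  have h5 := hB.eta_eq hj
  rw [← h4] at h5
  unfold solQ sol at *
  rw [h3, h5, pow_succ]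
  ring

/-- `x d/dx 𝒫_j`, when `x d/dx ψ_j = ψ₁`. -/
lemma hasDerivAt_solP {ψ₁ : ℝ → ℂ} (hψ₁ : ∀ A, MemLp ψ₁ 2 (volume.restrict (Ioc 0 A)))
    (hd : ∀ x, 0 < x → HasDerivAt (psiExt ν j) (ψ₁ x / x) x) {x : ℝ} (hx : 0 < x) :
    HasDerivAt (solP ν j a) ((sol (fun x y => besselKernel ν y x) (J a) ψ₁ x
      - (xi ν j a - beta ν j) * solP ν M a x
      - ∑ l, endSign l * a l * solP ν j a (a l) * resKernel (besselKernel ν) (J a) (a l) x) / x)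
      x := by
  have h1 := hB.theta.swap.hasDerivAt_resolve hB.reg.nonneg hB.reg.le hB.reg.swap.res
    (hB.measurable_psi hj) (hB.psi_le j hj) hx (hd x hx)
  have h2 := hB.theta.swap.theta_resolve hB.reg.mono hB.reg.nonneg hB.reg.le hB.reg.swap.res
    (hB.measurable_psi hj) (hB.psi_le j hj) hψ₁ hd hx
  rw [h2] at h1
  refine h1.congr_deriv ?_
  simp only [congrFun (congrFun (resKernel_swap (besselKernel ν) (J a)) x), mul_assoc,
    integral_const_mul]
  rw [hB.xi_eq hj, pow_succ]
  unfold solP sol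
  simp only [mul_assoc]
  ring

omit hj

/-- Commuting x with the resolvent produces the integrals ∫ φ_0 𝒫_i; together with the coefficients
β_i of the differential equation they form ξ_i, which is the reason for the constant term in ξ_i. -/
lemma sol_phi_last {x : ℝ} (hx : 0 < x) :
    sol (besselKernel ν) (J a) (fun x => (-1) ^ (M + 1) * x * phiExt ν 0 x
      + ∑ i ∈ Finset.range (M + 1), beta ν i * phiExt ν i x) x
      = (-1) ^ (M + 1) * x * solQ ν 0 a x
        + ∑ i ∈ Finset.range (M + 1), xi ν i a * solQ ν i a x := by
  have hk := hB.theta.ker.toIsDominated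
  have h0 := hB.memLp_phi (Nat.zero_le M)
  have hφ : ∀ i : Fin (M + 1), MemLp (phiExt ν i) 2 (volume.restrict (J a)) :=
    fun i => hB.memLp_phi (Nat.lt_succ_iff.mp i.2)
  have h1 := resolve_id_mul hk hB.reg.res hB.memLp_v hB.memLp_w
    (φ := fun i : Fin (M + 1) => phiExt ν i) (ψ := fun i : Fin (M + 1) => psiExt ν i)
    (sub_mul_besselKernel hB.nu_zero hB.one_le)
    (hB.ae_pos.mono fun x hx => Ioi_subset_Ici_self hx) hB.ae_pos
    hB.ae_le hφ (fun i => hB.memLp_psi (Nat.lt_succ_iff.mp i.2)) h0 x hx.le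
  have hx0 := memLp_id_mul hB.ae_le h0
  have hsum : MemLp (fun x => ∑ i ∈ Finset.range (M + 1), beta ν i * phiExt ν i x) 2
      (volume.restrict (J a)) :=
    memLp_finsetSum _ fun i hi => (hB.memLp_phi (Finset.mem_range_succ_iff.mp hi)).const_mul _
  have h2 := resolve_sum hk hB.reg.res hB.memLp_v hB.memLp_w (Finset.range (M + 1))
    (c := beta ν) (h := phiExt ν) (fun i hi => hB.memLp_phi (Finset.mem_range_succ_iff.mp hi)) x
  have h3 := resolve_add hk hB.reg.res hB.memLp_v hB.memLp_w
    (hx0.const_mul ((-1 : ℂ) ^ (M + 1))) hsum x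
  have h4 := resolve_const_mul (R := resKernel (besselKernel ν) (J a))
    (μ := volume.restrict (J a)) (h := fun x : ℝ => (x : ℂ) * phiExt ν 0 x) ((-1) ^ (M + 1)) x
  have h5 : ∑ i : Fin (M + 1), solQ ν i a x * ∫ y in J a, psiExt ν i y * solQ ν 0 a y
      = ∑ i ∈ Finset.range (M + 1), (∫ y in J a, phiExt ν 0 y * solP ν i a y) * solQ ν i a x := by
    rw [Finset.sum_range]
    exact Finset.sum_congr rfl fun i _ => by
      rw [hB.integral_psi_mul_solQ (Nat.zero_le M) (Nat.lt_succ_iff.mp i.2), mul_comm]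
  have h6 : ∑ i ∈ Finset.range (M + 1), xi ν i a * solQ ν i a x
      = (-1) ^ M * (∑ i ∈ Finset.range (M + 1),
          (∫ y in J a, phiExt ν 0 y * solP ν i a y) * solQ ν i a x)
        + ∑ i ∈ Finset.range (M + 1), beta ν i * solQ ν i a x := by
    rw [Finset.mul_sum, ← Finset.sum_add_distrib]
    refine Finset.sum_congr rfl fun i hi => ?_
    rw [hB.xi_eq (Finset.mem_range_succ_iff.mp hi)]
    ring
  rw [h6, ← h5]
  simp only [mul_assoc]
  unfold solQ sol
  rw [h3, h4, h1, h2, pow_succ]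
  ring

lemma sol_psi {j : ℕ} (hj : j ≤ M) (x : ℝ) :
    sol (fun x y => besselKernel ν y x) (J a) (fun x => psiExt ν (j - 1) x
      - beta ν j * psiExt ν M x) x = solP ν (j - 1) a x - beta ν j * solP ν M a x := by
  have h := resolve_add hB.theta.swap.ker.toIsDominated hB.reg.swap.res hB.memLp_w hB.memLp_v
    (hB.memLp_psi ((Nat.sub_le j 1).trans hj)) ((hB.memLp_psi (le_refl M)).const_mul (-beta ν j)) x
  have h' := resolve_const_mul (R := resKernel (fun x y => besselKernel ν y x) (J a))
    (μ := volume.restrict (J a)) (h := psiExt ν M) (-beta ν j) x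
  rw [h'] at h
  simp only [neg_mul, ← sub_eq_add_neg] at h
  exact h

/-- The adjoint counterpart of `sol_phi_last`: the commutator of x with the transposed resolvent
produces the η_i. -/
lemma sol_psi_zero {x : ℝ} (hx : 0 < x) :
    sol (fun x y => besselKernel ν y x) (J a) (fun x => (-1) ^ M * x * psiExt ν M x
      - beta ν 0 * psiExt ν M x) x = (-1) ^ M * x * solP ν M a x
        + (∑ i ∈ Finset.range (M + 1), eta ν i a * solP ν i a x) - beta ν 0 * solP ν M a x := by
  have hk := hB.theta.swap.ker.toIsDominated
  have hψM := hB.memLp_psi (le_refl M)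
  -- Transposition reverses the sign of x - y; the sign is put into the first family of functions.
  have hN : ∀ x ∈ Ioi (0 : ℝ), ∀ y ∈ Ici (0 : ℝ), ((x : ℂ) - y) * besselKernel ν y x
      = ∑ i : Fin (M + 1), (-1 * psiExt ν i x) * phiExt ν i y := by
    intro x hx y hy
    have h := sub_mul_besselKernel hB.nu_zero hB.one_le y hy x hx
    rw [show ((x : ℂ) - y) * besselKernel ν y x = -(((y : ℂ) - x) * besselKernel ν y x) by ring, h,
      ← Finset.sum_neg_distrib]
    exact Finset.sum_congr rfl fun i _ => by ring
  have h1 := resolve_id_mul hk hB.reg.swap.res hB.memLp_w hB.memLp_v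
    (φ := fun (i : Fin (M + 1)) x => -1 * psiExt ν i x) (ψ := fun i : Fin (M + 1) => phiExt ν i)
    hN hB.ae_pos (hB.ae_pos.mono fun x hx => Ioi_subset_Ici_self hx)
    hB.ae_le (fun i => (hB.memLp_psi (Nat.lt_succ_iff.mp i.2)).const_mul (-1))
    (fun i => hB.memLp_phi (Nat.lt_succ_iff.mp i.2)) hψM x hx
  have hx0 := memLp_id_mul hB.ae_le hψM
  have h3 := resolve_add hk hB.reg.swap.res hB.memLp_w hB.memLp_v
    (hx0.const_mul ((-1 : ℂ) ^ M)) (hψM.const_mul (-beta ν 0)) x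
  have h4 := fun (c : ℂ) (h : ℝ → ℂ) =>
    resolve_const_mul (R := resKernel (fun x y => besselKernel ν y x) (J a))
    (μ := volume.restrict (J a)) (h := h) c x
  have h6 : ∑ i ∈ Finset.range (M + 1), eta ν i a * solP ν i a x
      = -((-1) ^ M * ∑ i : Fin (M + 1), -1 * solP ν i a x *
          ∫ y in J a, phiExt ν i y * solP ν M a y) := by
    rw [Finset.sum_range, Finset.mul_sum, ← Finset.sum_neg_distrib]
    refine Finset.sum_congr rfl fun i _ => ?_
    rw [hB.eta_eq (Nat.lt_succ_iff.mp i.2)]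
    ring
  rw [h6]
  simp only [h4] at h1 h3
  rw [h1] at h3
  simp only [neg_mul (beta ν 0), ← sub_eq_add_neg] at h3
  simp only [mul_assoc] at h3 ⊢
  unfold solP sol at *
  rw [h3]
  ring

end IsBesselRegular

end Quantities

end GenBessel

end

noncomputable section

namespace GenBessel

/-! ### The partial derivatives -/

section Partial

variable {M m : ℕ} {ν : Fin (M + 1) → ℕ} {a : Fin (2 * m) → ℝ}

lemma exists_isBesselRegular (hM : 1 ≤ M) (hν : ν 0 = 0) (ha0 : ∀ l, 0 ≤ a l) (ha : StrictMono a)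
    (hdet : fredholmDet ν a ≠ 0) : ∃ k₁ k₂ v w A C, IsBesselRegular ν k₁ k₂ v w A C a := by
  obtain ⟨k₁, k₂, v, w, hT, hφ, hψ⟩ := exists_isThetaKernel hν hM
  obtain ⟨A, hA⟩ : ∃ A, ∀ l, a l ≤ A := ⟨∑ l, a l, fun l =>
    Finset.single_le_sum (f := a) (fun l _ => ha0 l) (Finset.mem_univ l)⟩
  rw [fredholmDet_eq hν hM ha0] at hdet
  exact ⟨k₁, k₂, v, w, A, _, hν, hM, hT, hφ, hψ, ha, ha0, hA,
    hT.ker.toIsDominated.isResolventKernel ((IsThetaKernel.memLp_J hT.memLp_v ha0 hA).integrable_mul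
      (IsThetaKernel.memLp_J hT.memLp_w ha0 hA)) hdet⟩

lemma exists_eventually_isBesselRegular (hM : 1 ≤ M) (hν : ν 0 = 0) (ha0 : ∀ l, 0 ≤ a l)
    (ha : StrictMono a) (hdet : fredholmDet ν a ≠ 0) {p : Fin (2 * m)} (hp : 0 < a p) :
    ∃ k₁ k₂ v w A C,
      ∀ᶠ t in 𝓝 (a p), IsBesselRegular ν k₁ k₂ v w A C (Function.update a p t) := by
  obtain ⟨k₁, k₂, v, w, hT, hφ, hψ⟩ := exists_isThetaKernel hν hM
  -- The bound is strict so that it persists when one endpoint moves.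
  have hA : ∀ l, a l < ∑ l, a l + 1 := fun l => (Finset.single_le_sum (f := a)
    (fun l _ => ha0 l) (Finset.mem_univ l)).trans_lt (lt_add_one _)
  rw [fredholmDet_eq hν hM ha0] at hdet
  obtain ⟨C, hC⟩ := hT.eventually_isRegular ha ha0 hA hp hdet
  exact ⟨k₁, k₂, v, w, _, C, hC.mono fun t ht => ⟨hν, hM, hT, hφ, hψ, ht⟩⟩

variable {k₁ k₂ : ℝ → ℝ → ℂ} {v w : ℝ → ℝ} {A C : ℝ} {p : Fin (2 * m)} (hp : 0 < a p)
  (hev : ∀ᶠ t in 𝓝 (a p), IsBesselRegular ν k₁ k₂ v w A C (Function.update a p t)) {j : ℕ}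
  (hj : j ≤ M)

include hev in
lemma isBesselRegular_self : IsBesselRegular ν k₁ k₂ v w A C a := by
  simpa using hev.self_of_nhds

include hp in
lemma eventually_update_pos {l : Fin (2 * m)} (hl : 0 < a l) :
    ∀ᶠ t in 𝓝 (a p), 0 < Function.update a p t l := by
  by_cases h : l = p
  · subst h
    filter_upwards [Ioi_mem_nhds hp] with t ht
    simpa using ht
  · exact Eventually.of_forall fun t => by rwa [Function.update_of_ne h]

include hp hev hj

/-- The fixed endpoint a_l may be 0, since the first variable of the kernel ranges over the whole
line; only the moving endpoint has to be positive. -/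
lemma hasPartialAt_xq {l : Fin (2 * m)} (hl : l ≠ p) :
    HasPartialAt (xq ν j l) a p (-(xq ν j p a / ((a l : ℂ) - (a p : ℂ))) *
      ∑ i ∈ Finset.range (M + 1), xq ν i l a * yq ν i p a) := by
  have hB := isBesselRegular_self hev
  have h := (hB.theta.hasDerivAt_sol (hB.measurable_phi hj) (hB.phi_le j hj) hp
    (hev.mono fun t ht => ht.reg) (hB.continuous_phi hj).continuousAt
    (mem_univ (a l))).const_mul (prefactor l)
  refine (h.congr_of_eventuallyEq ?_).congr_deriv ?_
  · filter_upwards [hev] with t ht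
    rw [ht.xq_eq hj, Function.update_of_ne hl]
  · have hne := hB.sub_ne_zero hl
    rw [hB.sum_xq_mul_yq hp, hB.xq_eq hj]
    field_simp
    linear_combination (prefactor l * solQ ν j a (a p) *
      resKernel (besselKernel ν) (J a) (a l) (a p)) * prefactor_mul_self p

lemma hasPartialAt_yq {l : Fin (2 * m)} (hl : l ≠ p) (hl0 : 0 < a l) :
    HasPartialAt (yq ν j l) a p (-(yq ν j p a / ((a p : ℂ) - (a l : ℂ))) *
      ∑ i ∈ Finset.range (M + 1), xq ν i p a * yq ν i l a) := by
  have hB := isBesselRegular_self hev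
  have h := (hB.theta.swap.hasDerivAt_sol (hB.measurable_psi hj) (hB.psi_le j hj) hp
    (hev.mono fun t ht => ht.reg.swap) (continuousAt_psiExt hB.nu_zero hj hp)
    (x := a l) hl0).const_mul (prefactor l)
  refine (h.congr_of_eventuallyEq ?_).congr_deriv ?_
  · filter_upwards [hev] with t ht
    rw [ht.yq_eq hj (by rwa [Function.update_of_ne hl]), Function.update_of_ne hl]
  · have hne := hB.sub_ne_zero hl.symm
    rw [hB.sum_xq_mul_yq hl0, hB.yq_eq hj hp, resKernel_swap]
    field_simp
    linear_combination (prefactor l * solP ν j a (a p) *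
      resKernel (besselKernel ν) (J a) (a p) (a l)) * prefactor_mul_self p

/-- The boundary sum in θ𝒬_j runs over all endpoints. Its term at a_p cancels against the derivative
caused by the moving domain, which leaves the sum over the other endpoints. -/
lemma exists_hasPartialAt_xq_self {φ₁ : ℝ → ℂ}
    (hφ₁ : ∀ A, MemLp φ₁ 2 (volume.restrict (Ioc 0 A)))
    (hd : ∀ x, 0 < x → HasDerivAt (phiExt ν j) (φ₁ x / x) x) :
    ∃ d, HasPartialAt (xq ν j p) a p d ∧
      (a p : ℂ) * d = -(eta ν j a * xq ν 0 p a)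
        + prefactor p * sol (besselKernel ν) (J a) φ₁ (a p)
        + ∑ k ∈ Finset.univ.erase p, xq ν j k a * ((a k : ℂ) / ((a p : ℂ) - (a k : ℂ))) *
            ∑ i ∈ Finset.range (M + 1), xq ν i p a * yq ν i k a := by
  have hB := isBesselRegular_self hev
  have h := (hB.theta.hasDerivAt_sol_diag (hB.measurable_phi hj) (hB.phi_le j hj) hp
    (hev.mono fun t ht => ht.reg) (hB.continuous_phi hj).continuousAt
    (hB.hasDerivAt_solQ hj hφ₁ hd hp)).const_mul (prefactor p)
  refine ⟨_, h.congr_of_eventuallyEq ?_, ?_⟩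
  · filter_upwards [hev] with t ht
    rw [ht.xq_eq hj, Function.update_self]
  · have hne : (a p : ℂ) ≠ 0 := by exact_mod_cast hp.ne'
    rw [hB.sum_erase_xq hj, hB.xq_eq (Nat.zero_le M),
      ← Finset.add_sum_erase _ _ (Finset.mem_univ p)]
    field_simp
    ring

/-- As for `xq`, with the transposed kernel. The term with β_j compensates the constant contained in
ξ_j and is cancelled later by the -β_j ψ_M in θψ_j. -/
lemma exists_hasPartialAt_yq_self {ψ₁ : ℝ → ℂ}
    (hψ₁ : ∀ A, MemLp ψ₁ 2 (volume.restrict (Ioc 0 A)))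
    (hd : ∀ x, 0 < x → HasDerivAt (psiExt ν j) (ψ₁ x / x) x) :
    ∃ d, HasPartialAt (yq ν j p) a p d ∧
      (a p : ℂ) * d = -(xi ν j a * yq ν M p a) + beta ν j * yq ν M p a
        + prefactor p * sol (fun x y => besselKernel ν y x) (J a) ψ₁ (a p)
        + ∑ k ∈ Finset.univ.erase p, yq ν j k a * ((a k : ℂ) / ((a k : ℂ) - (a p : ℂ))) *
            ∑ i ∈ Finset.range (M + 1), xq ν i k a * yq ν i p a := by
  have hB := isBesselRegular_self hev
  have h := (hB.theta.swap.hasDerivAt_sol_diag (hB.measurable_psi hj) (hB.psi_le j hj) hp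
    (hev.mono fun t ht => ht.reg.swap) (continuousAt_psiExt hB.nu_zero hj hp)
    (hB.hasDerivAt_solP hj hψ₁ hd hp)).const_mul (prefactor p)
  refine ⟨_, h.congr_of_eventuallyEq ?_, ?_⟩
  · filter_upwards [hev, eventually_update_pos hp hp] with t ht ht0
    rw [ht.yq_eq hj ht0, Function.update_self]
  · have hne : (a p : ℂ) ≠ 0 := by exact_mod_cast hp.ne'
    rw [hB.sum_erase_yq hj hp, hB.yq_eq le_rfl hp, resKernel_swap,
      ← Finset.add_sum_erase _ _ (Finset.mem_univ p)]
    field_simp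
    ring

lemma hasDerivAt_integral_phi_mul_solP {i : ℕ} (hi : i ≤ M) :
    HasDerivAt (fun t => ∫ x in J (Function.update a p t),
      phiExt ν i x * solP ν j (Function.update a p t) x)
      (endSign p * (solQ ν i a (a p) * solP ν j a (a p))) (a p) := by
  have hB := isBesselRegular_self hev
  exact hB.theta.swap.hasDerivAt_integral_sol (hB.measurable_psi hj) (hB.psi_le j hj) hp
    (hev.mono fun t ht => ht.reg.swap) (hB.measurable_phi hi) (hB.phi_le i hi)
    (continuousAt_psiExt hB.nu_zero hj hp) (hB.continuous_phi hi).continuousAt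

lemma hasPartialAt_xi :
    HasPartialAt (xi ν j) a p ((-1) ^ (M + 1) * xq ν 0 p a * yq ν j p a) := by
  have hB := isBesselRegular_self hev
  have h := ((hasDerivAt_integral_phi_mul_solP hp hev hj (Nat.zero_le M)).const_mul
    ((-1 : ℂ) ^ M)).add_const (beta ν j)
  refine (h.congr_of_eventuallyEq ?_).congr_deriv ?_
  · filter_upwards [hev] with t ht using ht.xi_eq hj
  · rw [hB.xq_eq (Nat.zero_le M), hB.yq_eq hj hp, pow_succ]
    linear_combination ((-1) ^ M * solQ ν 0 a (a p) * solP ν j a (a p)) * prefactor_mul_self p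

lemma hasPartialAt_eta :
    HasPartialAt (eta ν j) a p ((-1) ^ (M + 1) * xq ν j p a * yq ν M p a) := by
  have hB := isBesselRegular_self hev
  have h := (hasDerivAt_integral_phi_mul_solP hp hev le_rfl hj).const_mul ((-1 : ℂ) ^ M)
  refine (h.congr_of_eventuallyEq ?_).congr_deriv ?_
  · filter_upwards [hev] with t ht using ht.eta_eq hj
  · rw [hB.xq_eq hj, hB.yq_eq le_rfl hp, pow_succ]
    linear_combination ((-1) ^ M * solQ ν j a (a p) * solP ν M a (a p)) * prefactor_mul_self p

end Partial

/-! ### The equations for x_j^(l) and y_j^(l) with respect to their own endpoint -/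

section Equations

variable {M m : ℕ} {ν : Fin (M + 1) → ℕ} {a : Fin (2 * m) → ℝ} {k₁ k₂ : ℝ → ℝ → ℂ} {v w : ℝ → ℝ}
  {A C : ℝ} {p : Fin (2 * m)} (hp : 0 < a p)
  (hev : ∀ᶠ t in 𝓝 (a p), IsBesselRegular ν k₁ k₂ v w A C (Function.update a p t)) {j : ℕ}

lemma IsBesselRegular.memLp_phi_Ioc (hB : IsBesselRegular ν k₁ k₂ v w A C a) (hj : j ≤ M) (b : ℝ) :
    MemLp (phiExt ν j) 2 (volume.restrict (Ioc 0 b)) :=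
  IsThetaKernel.memLp_of_bound hB.theta.memLp_v (hB.measurable_phi hj) (hB.phi_le j hj) b

lemma IsBesselRegular.memLp_psi_Ioc (hB : IsBesselRegular ν k₁ k₂ v w A C a) (hj : j ≤ M) (b : ℝ) :
    MemLp (psiExt ν j) 2 (volume.restrict (Ioc 0 b)) :=
  IsThetaKernel.memLp_of_bound hB.theta.memLp_w (hB.measurable_psi hj) (hB.psi_le j hj) b

lemma memLp_id_mul_Ioc {h : ℝ → ℂ} {b : ℝ} (hh : MemLp h 2 (volume.restrict (Ioc 0 b))) :
    MemLp (fun x : ℝ => (x : ℂ) * h x) 2 (volume.restrict (Ioc 0 b)) := by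
  refine memLp_id_mul (A := b) ?_ hh
  filter_upwards [self_mem_ae_restrict measurableSet_Ioc] with x hx
  rw [abs_of_pos hx.1]
  exact hx.2

include hp hev

lemma exists_hasPartialAt_xq_of_lt (hj : j < M) : ∃ d, HasPartialAt (xq ν j p) a p d ∧
    (a p : ℂ) * d = -(eta ν j a * xq ν 0 p a) - xq ν (j + 1) p a
      + ∑ k ∈ Finset.univ.erase p, xq ν j k a * ((a k : ℂ) / ((a p : ℂ) - (a k : ℂ))) *
          ∑ i ∈ Finset.range (M + 1), xq ν i p a * yq ν i k a := by
  have hB := isBesselRegular_self hev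
  obtain ⟨d, hd, e⟩ := exists_hasPartialAt_xq_self hp hev hj.le
    (φ₁ := fun x => -1 * phiExt ν (j + 1) x) (fun b => (hB.memLp_phi_Ioc hj b).const_mul (-1))
    (fun x hx => by rw [neg_one_mul]; exact hasDerivAt_phiExt hB.nu_zero hj hx)
  refine ⟨d, hd, e.trans ?_⟩
  rw [sol, resolve_const_mul, hB.xq_eq hj]
  unfold solQ sol
  ring

lemma exists_hasPartialAt_xq_last : ∃ d, HasPartialAt (xq ν M p) a p d ∧
    (a p : ℂ) * d = -(eta ν M a * xq ν 0 p a) + (-1) ^ (M + 1) * (a p : ℂ) * xq ν 0 p a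
      + ∑ i ∈ Finset.range (M + 1), xi ν i a * xq ν i p a
      + ∑ k ∈ Finset.univ.erase p, xq ν M k a * ((a k : ℂ) / ((a p : ℂ) - (a k : ℂ))) *
          ∑ i ∈ Finset.range (M + 1), xq ν i p a * yq ν i k a := by
  have hB := isBesselRegular_self hev
  obtain ⟨d, hd, e⟩ := exists_hasPartialAt_xq_self hp hev (le_refl M)
    (φ₁ := fun x : ℝ => (-1) ^ (M + 1) * x * phiExt ν 0 x
      + ∑ i ∈ Finset.range (M + 1), beta ν i * phiExt ν i x) (fun b => by
        simp only [mul_assoc]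
        exact ((memLp_id_mul_Ioc (hB.memLp_phi_Ioc (Nat.zero_le M) b)).const_mul _).add
          (memLp_finsetSum _ fun i hi =>
            (hB.memLp_phi_Ioc (Finset.mem_range_succ_iff.mp hi) b).const_mul _))
    (fun x hx => hasDerivAt_phiExt_last hB.nu_zero hx)
  refine ⟨d, hd, e.trans ?_⟩
  have e1 : ∑ i ∈ Finset.range (M + 1), xi ν i a * xq ν i p a
      = prefactor p * ∑ i ∈ Finset.range (M + 1), xi ν i a * solQ ν i a (a p) := by
    rw [Finset.mul_sum]
    refine Finset.sum_congr rfl fun i hi => ?_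
    rw [hB.xq_eq (Finset.mem_range_succ_iff.mp hi)]
    ring
  rw [hB.sol_phi_last hp, e1, hB.xq_eq (Nat.zero_le M)]
  ring

lemma exists_hasPartialAt_yq_of_pos (hj1 : 1 ≤ j) (hj : j ≤ M) :
    ∃ d, HasPartialAt (yq ν j p) a p d ∧
    (a p : ℂ) * d = -(xi ν j a * yq ν M p a) + yq ν (j - 1) p a
      + ∑ k ∈ Finset.univ.erase p, yq ν j k a * ((a k : ℂ) / ((a k : ℂ) - (a p : ℂ))) *
          ∑ i ∈ Finset.range (M + 1), xq ν i k a * yq ν i p a := by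
  have hB := isBesselRegular_self hev
  have hj' : j - 1 ≤ M := (Nat.sub_le _ _).trans hj
  obtain ⟨d, hd, e⟩ := exists_hasPartialAt_yq_self hp hev hj
    (ψ₁ := fun x => psiExt ν (j - 1) x - beta ν j * psiExt ν M x)
    (fun b => (hB.memLp_psi_Ioc hj' b).sub ((hB.memLp_psi_Ioc (le_refl M) b).const_mul _))
    (fun x hx => hasDerivAt_psiExt hB.nu_zero hj1 hj hx)
  refine ⟨d, hd, e.trans ?_⟩
  rw [hB.sol_psi hj, hB.yq_eq hj' hp, hB.yq_eq le_rfl hp]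
  ring

lemma exists_hasPartialAt_yq_zero : ∃ d, HasPartialAt (yq ν 0 p) a p d ∧
    (a p : ℂ) * d = -(xi ν 0 a * yq ν M p a) + (-1) ^ M * (a p : ℂ) * yq ν M p a
      + ∑ i ∈ Finset.range (M + 1), eta ν i a * yq ν i p a
      + ∑ k ∈ Finset.univ.erase p, yq ν 0 k a * ((a k : ℂ) / ((a k : ℂ) - (a p : ℂ))) *
          ∑ i ∈ Finset.range (M + 1), xq ν i k a * yq ν i p a := by
  have hB := isBesselRegular_self hev
  obtain ⟨d, hd, e⟩ := exists_hasPartialAt_yq_self hp hev (Nat.zero_le M)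
    (ψ₁ := fun x : ℝ => (-1) ^ M * x * psiExt ν M x - beta ν 0 * psiExt ν M x) (fun b => by
        simp only [mul_assoc]
        exact ((memLp_id_mul_Ioc (hB.memLp_psi_Ioc (le_refl M) b)).const_mul _).sub
          ((hB.memLp_psi_Ioc (le_refl M) b).const_mul _))
    (fun x hx => hasDerivAt_psiExt_zero hB.nu_zero hx)
  refine ⟨d, hd, e.trans ?_⟩
  have e1 : ∑ i ∈ Finset.range (M + 1), eta ν i a * yq ν i p a
      = prefactor p * ∑ i ∈ Finset.range (M + 1), eta ν i a * solP ν i a (a p) := by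
    rw [Finset.mul_sum]
    refine Finset.sum_congr rfl fun i hi => ?_
    rw [hB.yq_eq (Finset.mem_range_succ_iff.mp hi) hp]
    ring
  rw [hB.sol_psi_zero hp, e1, hB.yq_eq le_rfl hp]
  ring

end Equations

end GenBessel

end

/-! ### The theorem -/

open GenBessel in
theorem proposition3p3 (M m : ℕ) (hM : 1 ≤ M) (ν : Fin (M + 1) → ℕ) (hν : ν 0 = 0)
    (a : Fin (2 * m) → ℝ) (ha0 : ∀ l, 0 ≤ a l) (ha : StrictMono a)
    (hdet : fredholmDet ν a ≠ 0) :
    -- the quantities are well defined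
    (∀ j ≤ M,
      (IsResolventOf (K ν) (J a) (phi ν j) (Q ν j a) ∧
        ∀ u, IsResolventOf (K ν) (J a) (phi ν j) u → ∀ x, 0 < x → u x = Q ν j a x) ∧
      (IsResolventOf (fun x y => K ν y x) (J a) (psi ν j) (P ν j a) ∧
        ∀ u, IsResolventOf (fun x y => K ν y x) (J a) (psi ν j) u →
          ∀ x, 0 < x → u x = P ν j a x) ∧
      (∀ l, ∃ q, Tendsto (Q ν j a) (𝓝[J a] (a l)) (𝓝 q)) ∧
      (∀ l, 0 < a l → ∃ p, Tendsto (P ν j a) (𝓝[J a] (a l)) (𝓝 p)) ∧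
      IntegrableOn (fun x => phi ν 0 x * P ν j a x) (J a) ∧
      IntegrableOn (fun x => phi ν j x * P ν M a x) (J a)) ∧
    -- (a)
    (∀ j ≤ M, ∀ k l, k ≠ l → 0 < a k →
      HasPartialAt (xq ν j l) a k
        (-(xq ν j k a / ((a l : ℂ) - (a k : ℂ))) *
          ∑ i ∈ Finset.range (M + 1), xq ν i l a * yq ν i k a)) ∧
    -- (b)
    (∀ j ≤ M, ∀ k l, k ≠ l → 0 < a k → 0 < a l →
      HasPartialAt (yq ν j l) a k
        (-(yq ν j k a / ((a k : ℂ) - (a l : ℂ))) *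
          ∑ i ∈ Finset.range (M + 1), xq ν i k a * yq ν i l a)) ∧
    -- (c)
    (∀ j < M, ∀ l, 0 < a l → ∃ d, HasPartialAt (xq ν j l) a l d ∧
      (a l : ℂ) * d = -(eta ν j a * xq ν 0 l a) - xq ν (j + 1) l a
        + ∑ k ∈ Finset.univ.erase l, xq ν j k a * ((a k : ℂ) / ((a l : ℂ) - (a k : ℂ))) *
            ∑ i ∈ Finset.range (M + 1), xq ν i l a * yq ν i k a) ∧
    (∀ l, 0 < a l → ∃ d, HasPartialAt (xq ν M l) a l d ∧
      (a l : ℂ) * d = -(eta ν M a * xq ν 0 l a) + (-1) ^ (M + 1) * (a l : ℂ) * xq ν 0 l a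
        + ∑ i ∈ Finset.range (M + 1), xi ν i a * xq ν i l a
        + ∑ k ∈ Finset.univ.erase l, xq ν M k a * ((a k : ℂ) / ((a l : ℂ) - (a k : ℂ))) *
            ∑ i ∈ Finset.range (M + 1), xq ν i l a * yq ν i k a) ∧
    -- (d)
    (∀ j, 1 ≤ j → j ≤ M → ∀ l, 0 < a l → ∃ d, HasPartialAt (yq ν j l) a l d ∧
      (a l : ℂ) * d = -(xi ν j a * yq ν M l a) + yq ν (j - 1) l a
        + ∑ k ∈ Finset.univ.erase l, yq ν j k a * ((a k : ℂ) / ((a k : ℂ) - (a l : ℂ))) *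
            ∑ i ∈ Finset.range (M + 1), xq ν i k a * yq ν i l a) ∧
    (∀ l, 0 < a l → ∃ d, HasPartialAt (yq ν 0 l) a l d ∧
      (a l : ℂ) * d = -(xi ν 0 a * yq ν M l a) + (-1) ^ M * (a l : ℂ) * yq ν M l a
        + ∑ i ∈ Finset.range (M + 1), eta ν i a * yq ν i l a
        + ∑ k ∈ Finset.univ.erase l, yq ν 0 k a * ((a k : ℂ) / ((a k : ℂ) - (a l : ℂ))) *
            ∑ i ∈ Finset.range (M + 1), xq ν i k a * yq ν i l a) ∧
    -- (e)
    (∀ j ≤ M, ∀ l, 0 < a l →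
      HasPartialAt (xi ν j) a l ((-1) ^ (M + 1) * xq ν 0 l a * yq ν j l a)) ∧
    -- (f)
    (∀ j ≤ M, ∀ l, 0 < a l →
      HasPartialAt (eta ν j) a l ((-1) ^ (M + 1) * xq ν j l a * yq ν M l a)) := by
  have hex := fun (p : Fin (2 * m)) (hp : 0 < a p) =>
    exists_eventually_isBesselRegular hM hν ha0 ha hdet hp
  refine ⟨fun j hj => ?_, fun j hj k l hkl hk => ?_, fun j hj k l hkl hk hl => ?_,
    fun j hj l hl => ?_, fun l hl => ?_, fun j hj1 hj l hl => ?_, fun l hl => ?_,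
    fun j hj l hl => ?_, fun j hj l hl => ?_⟩
  · obtain ⟨_, _, _, _, _, _, hB⟩ := exists_isBesselRegular hM hν ha0 ha hdet
    have hQ := hB.isResolventOf_Q hj
    have hP := hB.isResolventOf_P hj
    exact ⟨⟨hQ, fun u hu x hx => (hB.eq_solQ hj hu hx).trans (hB.eq_solQ hj hQ hx).symm⟩,
      ⟨hP, fun u hu x hx => (hB.eq_solP hj hu hx).trans (hB.eq_solP hj hP hx).symm⟩,
      fun l => ⟨_, hB.tendsto_Q hj l⟩, fun l hl => ⟨_, hB.tendsto_P hj hl⟩,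
      hB.integrableOn_phi_mul_P hj (Nat.zero_le M), hB.integrableOn_phi_mul_P le_rfl hj⟩
  · obtain ⟨_, _, _, _, _, _, hev⟩ := hex k hk
    exact hasPartialAt_xq hk hev hj hkl.symm
  · obtain ⟨_, _, _, _, _, _, hev⟩ := hex k hk
    exact hasPartialAt_yq hk hev hj hkl.symm hl
  · obtain ⟨_, _, _, _, _, _, hev⟩ := hex l hl
    exact exists_hasPartialAt_xq_of_lt hl hev hj
  · obtain ⟨_, _, _, _, _, _, hev⟩ := hex l hl
    exact exists_hasPartialAt_xq_last hl hev
  · obtain ⟨_, _, _, _, _, _, hev⟩ := hex l hl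
    exact exists_hasPartialAt_yq_of_pos hl hev hj1 hj
  · obtain ⟨_, _, _, _, _, _, hev⟩ := hex l hl
    exact exists_hasPartialAt_yq_zero hl hev
  · obtain ⟨_, _, _, _, _, _, hev⟩ := hex l hl
    exact hasPartialAt_xi hl hev hj
  · obtain ⟨_, _, _, _, _, _, hev⟩ := hex l hl
    exact hasPartialAt_eta hl hev hj
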